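/- Let $k$ be a non-archimedean local field of characteristic different from $2$, let $W$ be a four-dimensional symplectic space over $k$ with basis $e_1,e_2,e_3,e_4$ such that $\langle e_1,e_3\rangle=\langle e_2,e_4\rangle=1$ and $\langle e_i,e_j\rangle=0$ for all other pairs $i<j$, and let $G=\mathrm{GSp}_4(k)=\mathrm{GSp}(W)$ with similitude character $\lambda$. Let $$N=\left\{\begin{pmatrix}1&n\\0&1\end{pmatrix} : n\in \mathrm{Sym}_2(k)\right\}$$ be the unipotent radical of the Siegel parabolic (the stabilizer of $\langle e_1,e_2\rangle$), let $Q$ be the Klingen parabolic (the stabilizer of the line $\langle e_1\rangle$), and let $M'\cong k^*\times \mathrm{GL}_2(k)$ be its Levi subgroup stabilizing also $\langle e_3\rangle$. Let $\psi_{00}$ be a nontrivial additive character of $k$, let $s\in\mathrm{Sym}_2(k)$ with $\det s\neq0$, and let $\psi(n)=\psi_{00}(\mathrm{tr}(sn))$ be the corresponding nondegenerate character of $N$. Let $K$ be a two-dimensional commutative $k$-algebra, embedded as a $k$-algebra in $M_2(k)$ in such a way that ${}^tg\,s\,g=\det(g)\,s$ for all $g\in K^*$; embed $K^*$ in $G$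 by $g\mapsto \mathrm{diag}(g,\det g\cdot{}^tg^{-1})$, so that $K^*$ centralizes $\psi$. For a (continuous) character $\chi:K^*\to\mathbb{C}^*$ and a representation $\pi$ of $G$, let $\mathrm{Hom}_R(\pi,\chi)$ be the space of linear forms on $\pi$ on which $K^*$ acts by $\chi$ and $N$ by $\psi$ (here $R=K^*N$); $\pi$ is said to have a Bessel model for $K$ if $\mathrm{Hom}_R(\pi,\chi)\neq0$ for some $\chi$. Let $\rho:Q\to\mathbb{C}^*$ be a (continuous) one-dimensional representation of $Q$, and let $\pi=\mathrm{ind}_Q^{G}\rho$ be the corresponding principal series representation (normalized smooth induction). Then: 1. $\pi$ has a Bessel model for $K$ if and only if $K\cong k\oplus k$. 2. Suppose $K\cong k\oplus k$. Then there is $x\in G$ with $xK^*x^{-1}\subset M'$; call a character $\chi$ of $K^*$ a restriction of $\rho$ to $K^*$ if $\chi(t)=\rho(xtx^{-1})$ for all $t \in K^*$, for some such $x$. If $\chi$ is a restriction of $\rho$ to $K^*$, then $\dim\mathrm{Hom}_R(\pi,\chi)=1$, except that $\dim\mathrm{Hom}_R(\pi,\chi)=2$ when $\rho$ is trivial on $\{q\in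 Q:\lambda(q)=1\}$. If $\chi$ is not a restriction of $\rho$ to $K^*$, then $\mathrm{Hom}_R(\pi,\chi)=0$. -/

import Mathlib

open Matrix

namespace GSp4Bessel

noncomputable section

/-- The group `GSp₄(k)` of symplectic similitudes of `k⁴`. The basis `e₁, e₂, e₃, e₄` is indexed by
`inl 0, inl 1, inr 0, inr 1`; up to a sign, `Matrix.J` is the Gram matrix of the form with
`⟨e₁, e₃⟩ = ⟨e₂, e₄⟩ = 1` and `⟨eᵢ, eⱼ⟩ = 0` for all other `i < j`. -/
def GSp4 (k : Type*) [Field k] : Subgroup (GL (Fin 2 ⊕ Fin 2) k) where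
  carrier := {g | ∃ c : kˣ, (g.val)ᵀ * J (Fin 2) k * g.val = (c : k) • J (Fin 2) k}
  one_mem' := ⟨1, by simp⟩
  mul_mem' := by
    rintro a b ⟨c, hc⟩ ⟨d, hd⟩
    refine ⟨c * d, ?_⟩
    calc ((a * b).val)ᵀ * J (Fin 2) k * (a * b).val
        = (b.val)ᵀ * ((a.val)ᵀ * J (Fin 2) k * a.val) * b.val := by
          simp [Matrix.mul_assoc]
      _ = ((c * d : kˣ) : k) • J (Fin 2) k := by
          rw [hc, Matrix.mul_smul, Matrix.smul_mul, hd, smul_smul, Units.val_mul]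
  inv_mem' := by
    rintro a ⟨c, hc⟩
    refine ⟨c⁻¹, ?_⟩
    have h1 : a.val * (a⁻¹).val = 1 := by simp
    have h2 : ((a⁻¹).val)ᵀ * (a.val)ᵀ = 1 := by rw [← Matrix.transpose_mul, h1]; simp
    have h3 : J (Fin 2) k = (c : k) • (((a⁻¹).val)ᵀ * J (Fin 2) k * (a⁻¹).val) := by
      calc J (Fin 2) k
          = (((a⁻¹).val)ᵀ * (a.val)ᵀ) * J (Fin 2) k * (a.val * (a⁻¹).val) := by
            rw [h1, h2]; simp
        _ = ((a⁻¹).val)ᵀ * ((a.val)ᵀ * J (Fin 2) k * a.val) * (a⁻¹).val := by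
            simp only [Matrix.mul_assoc]
        _ = (c : k) • (((a⁻¹).val)ᵀ * J (Fin 2) k * (a⁻¹).val) := by
            rw [hc, Matrix.mul_smul, Matrix.smul_mul]
    conv_rhs => rw [h3]
    rw [smul_smul]
    simp

section Groups

variable {k : Type*} [Field k]

/-- The similitude factor `λ(g)`, characterized by `⟨g v, g w⟩ = λ(g) ⟨v, w⟩`; it is read off from
one entry of `gᵀ J g = λ(g) J`, the corresponding entry of `J` being `1`. -/
def similitude (g : GSp4 k) : k :=
  ((g.val.val)ᵀ * J (Fin 2) k * g.val.val) (Sum.inr 0) (Sum.inl 0)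

/-- The stabilizer in `GSp₄(k)` of the line spanned by a basis vector. -/
def lineStabilizer (k : Type*) [Field k] (j : Fin 2 ⊕ Fin 2) : Subgroup (GSp4 k) where
  carrier := {g | ∃ c : k, g.val.val *ᵥ Pi.single j 1 = c • Pi.single j 1}
  one_mem' := ⟨1, by
    show (1 : Matrix _ _ k) *ᵥ Pi.single j 1 = (1 : k) • Pi.single j 1
    rw [Matrix.one_mulVec, one_smul]⟩
  mul_mem' := by
    rintro a b ⟨c, hc⟩ ⟨d, hd⟩
    refine ⟨d * c, ?_⟩
    have : (a * b).val.val = a.val.val * b.val.val := rfl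
    rw [this, ← Matrix.mulVec_mulVec, hd, Matrix.mulVec_smul, hc, smul_smul]
  inv_mem' := by
    rintro a ⟨c, hc⟩
    have h1 : (a⁻¹).val.val * a.val.val = 1 := by simp
    have h2 : c • ((a⁻¹).val.val *ᵥ Pi.single j 1) = Pi.single j 1 := by
      rw [← Matrix.mulVec_smul, ← hc, Matrix.mulVec_mulVec, h1, Matrix.one_mulVec]
    have hc0 : c ≠ 0 := by
      rintro rfl
      have := congrFun h2 j
      simp at this
    refine ⟨c⁻¹, ?_⟩
    show (a⁻¹).val.val *ᵥ Pi.single j 1 = c⁻¹ • Pi.single j 1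
    conv_rhs => rw [← h2]
    rw [smul_smul, inv_mul_cancel₀ hc0, one_smul]

/-- The Klingen parabolic `Q`, the stabilizer of the (isotropic) line spanned by `e₁`. -/
def klingen (k : Type*) [Field k] : Subgroup (GSp4 k) := lineStabilizer k (Sum.inl 0)

/-- The Levi subgroup `M' ≅ k* × GL₂(k)` of `Q`, the stabilizer of the two lines spanned by `e₁`
and by `e₃`. -/
def klingenLevi (k : Type*) [Field k] : Subgroup (GSp4 k) :=
  lineStabilizer k (Sum.inl 0) ⊓ lineStabilizer k (Sum.inr 0)

theorem klingenLevi_le : klingenLevi k ≤ klingen k := inf_le_left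

/-- The embedding `g ↦ diag(g, det g · ᵗg⁻¹)` of `GL₂(k)` in the Levi subgroup of the Siegel
parabolic of `GSp₄(k)`. -/
def siegelGL (g : GL (Fin 2) k) : GSp4 k :=
  ⟨⟨fromBlocks g.val 0 0 (g.val.det • ((g⁻¹).val)ᵀ),
    fromBlocks (g⁻¹).val 0 0 ((g⁻¹).val.det • (g.val)ᵀ),
    by
      have h : g.val.det * (g⁻¹).val.det = 1 := by rw [← Matrix.det_mul]; simp
      have h2 : ((g⁻¹).val)ᵀ * (g.val)ᵀ = 1 := by
        rw [← Matrix.transpose_mul, Units.mul_inv, Matrix.transpose_one]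
      have h3 : (g.val.det • ((g⁻¹).val)ᵀ) * ((g⁻¹).val.det • (g.val)ᵀ) = 1 := by
        rw [Matrix.smul_mul, Matrix.mul_smul, smul_smul, h, h2, one_smul]
      rw [fromBlocks_multiply, h3, Units.mul_inv]
      simp,
    by
      have h : (g⁻¹).val.det * g.val.det = 1 := by rw [← Matrix.det_mul]; simp
      have h2 : (g.val)ᵀ * ((g⁻¹).val)ᵀ = 1 := by
        rw [← Matrix.transpose_mul, Units.inv_mul, Matrix.transpose_one]
      have h3 : ((g⁻¹).val.det • (g.val)ᵀ) * (g.val.det • ((g⁻¹).val)ᵀ) = 1 := by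
        rw [Matrix.smul_mul, Matrix.mul_smul, smul_smul, h, h2, one_smul]
      rw [fromBlocks_multiply, h3, Units.inv_mul]
      simp⟩,
    ⟨Units.map (detMonoidHom : Matrix (Fin 2) (Fin 2) k →* k) g, by
      have h2 : (g.val)ᵀ * ((g⁻¹).val)ᵀ = 1 := by
        rw [← Matrix.transpose_mul, Units.inv_mul, Matrix.transpose_one]
      have h4 : (g⁻¹).val * g.val = 1 := Units.inv_mul g
      have h3 : (g.val)ᵀ * (g.val.det • ((g⁻¹).val)ᵀ) = g.val.det • (1 : Matrix _ _ k) := by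
        rw [Matrix.mul_smul, h2]
      show (fromBlocks g.val 0 0 (g.val.det • ((g⁻¹).val)ᵀ))ᵀ * J (Fin 2) k *
        fromBlocks g.val 0 0 (g.val.det • ((g⁻¹).val)ᵀ) = g.val.det • J (Fin 2) k
      simp only [J, fromBlocks_transpose, fromBlocks_multiply, fromBlocks_smul, transpose_smul,
        transpose_transpose, transpose_zero, Matrix.mul_zero, Matrix.zero_mul, add_zero, zero_add,
        Matrix.mul_one, Matrix.mul_neg, Matrix.neg_mul, neg_zero, smul_zero, smul_neg, h3,
        Matrix.smul_mul, h4]⟩⟩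

/-- The element `(1 n; 0 1)` of the unipotent radical `N ≅ Sym₂(k)` of the Siegel parabolic, the
stabilizer of the isotropic plane spanned by `e₁` and `e₂`. -/
def siegelN (n : Matrix (Fin 2) (Fin 2) k) (hn : n.IsSymm) : GSp4 k :=
  ⟨⟨fromBlocks 1 n 0 1, fromBlocks 1 (-n) 0 1,
    by simp [fromBlocks_multiply], by simp [fromBlocks_multiply]⟩,
    ⟨1, by simp [J, fromBlocks_transpose, fromBlocks_multiply, hn.eq]⟩⟩

end Groups

section Bessel

variable {k : Type*} [Field k] {K : Type*} [CommRing K] [Algebra k K]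

/-- The embedding `K* → GSp₄(k)` attached to an embedding `ι` of `K` in `M₂(k)`. -/
def torus (ι : K →ₐ[k] Matrix (Fin 2) (Fin 2) k) (t : Kˣ) : GSp4 k :=
  siegelGL (Units.map (ι : K →* Matrix (Fin 2) (Fin 2) k) t)

/-- The space `Hom_R(π, χ)` of Bessel functionals, where `R = K* N` and `χ` is extended to `R` by
the character `n ↦ ψ₀₀(tr (s n))` of `N`: the linear forms on the space of `π` on which `K*` acts by
`χ` and `N` by this character. -/
def besselFunctionals {V : Type*} [AddCommGroup V] [Module ℂ V]
    (π : Representation ℂ (GSp4 k) V) (ψ₀₀ : AddChar k ℂ) (s : Matrix (Fin 2) (Fin 2) k)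
    (ι : K →ₐ[k] Matrix (Fin 2) (Fin 2) k) (χ : Kˣ →* ℂˣ) : Submodule ℂ (Module.Dual ℂ V) where
  carrier := {ℓ | (∀ (t : Kˣ) (v : V), ℓ (π (torus ι t) v) = (χ t : ℂ) * ℓ v) ∧
    ∀ (n : Matrix (Fin 2) (Fin 2) k) (hn : n.IsSymm) (v : V),
      ℓ (π (siegelN n hn) v) = ψ₀₀ (s * n).trace * ℓ v}
  zero_mem' := by simp
  add_mem' := by
    rintro a b ⟨ha, ha'⟩ ⟨hb, hb'⟩
    refine ⟨fun t v => ?_, fun n hn v => ?_⟩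
    · simp [ha, hb, mul_add]
    · simp [ha', hb', mul_add]
  smul_mem' := by
    rintro c a ⟨ha, ha'⟩
    refine ⟨fun t v => ?_, fun n hn v => ?_⟩
    · simp [ha, mul_left_comm]
    · simp [ha', mul_left_comm]

end Bessel

section Induction

variable {k : Type*} [Field k] [ValuativeRel k] [TopologicalSpace k]
  [IsNonarchimedeanLocalField k]

/-- The normalized absolute value of a non-archimedean local field: it sends a uniformizer to the
inverse of the number of elements of the residue field. -/
def normalizedAbs (x : k) : ℝ :=
  open scoped Classical in
  if x = 0 then 0 else
    (Nat.card (IsLocalRing.ResidueField (ValuativeRel.valuation k).integer) : ℝ) ^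
      WithZero.log (IsNonarchimedeanLocalField.valueGroupWithZeroIsoInt k
        (ValuativeRel.valuation k x))

/-- The square root `δ_Q^{1/2}` of the modulus character `δ_Q(q) = |det Ad(q)|` (on the Lie algebra
of the unipotent radical) of the Klingen parabolic. If `q e₁ = a e₁`, then `q` acts on the centre of
that Lie algebra by `a² / λ(q)` and on its two-dimensional abelianization with determinant
`a² / λ(q)`, so that `δ_Q(q) = |a² / λ(q)|²`. -/
def sqrtModulus (q : klingen k) : ℝ :=
  normalizedAbs ((q.val.val.val (Sum.inl 0) (Sum.inl 0)) ^ 2 / similitude q.val)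

/-- The space of the representation of `GSp₄(k)` obtained by normalized smooth induction from the
character `ρ` of `Q`. -/
def inducedSpace (ρ : klingen k →ₜ* ℂˣ) : Submodule ℂ (GSp4 k → ℂ) where
  carrier := {f | (∀ (q : klingen k) (g : GSp4 k),
      f (q.val * g) = (sqrtModulus q : ℂ) * (ρ q : ℂ) * f g) ∧
    ∃ U : OpenSubgroup (GSp4 k), ∀ u ∈ U, ∀ g : GSp4 k, f (g * u) = f g}
  zero_mem' := ⟨by simp, ⊤, by simp⟩
  add_mem' := by
    rintro a b ⟨ha, U, hU⟩ ⟨hb, V, hV⟩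
    refine ⟨fun q g => by simp [ha, hb, mul_add], U ⊓ V, fun u hu g => ?_⟩
    have hu' := OpenSubgroup.mem_inf.mp hu
    simp [hU u hu'.1, hV u hu'.2]
  smul_mem' := by
    rintro c a ⟨ha, U, hU⟩
    exact ⟨fun q g => by simp [ha, mul_left_comm], U, fun u hu g => by simp [hU u hu]⟩

/-- The representation `ind_Q^{GSp₄(k)} ρ` (normalized induction), by right translations. -/
def inducedRep (ρ : klingen k →ₜ* ℂˣ) : Representation ℂ (GSp4 k) (inducedSpace ρ) where
  toFun x :=
    { toFun := fun f => ⟨fun g => f.val (g * x), by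
        obtain ⟨hf, U, hU⟩ := f.property
        refine ⟨fun q g => ?_, U.comap (MulAut.conj x⁻¹).toMonoidHom ?_, fun u hu g => ?_⟩
        · show f.val (q.val * g * x) = _
          rw [mul_assoc]
          exact hf q _
        · show Continuous fun g : GSp4 k => x⁻¹ * g * x⁻¹⁻¹
          fun_prop
        · have h := hU (x⁻¹ * u * x) (by simpa using hu) (g * x)
          show f.val (g * u * x) = f.val (g * x)
          rw [← h]
          group⟩
      map_add' := fun f f' => rfl
      map_smul' := fun c f => rfl }
  map_one' := by ext f g; simp
  map_mul' x y := by ext f g; simp [mul_assoc]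

/-- `χ` is obtained by restricting `ρ` to `K*` embedded in the Levi subgroup of `Q`, where the
embedding is the given one of `K*` in `GSp₄(k)` followed by a conjugation of `GSp₄(k)` that carries
`K*` into that Levi subgroup. -/
def IsRestriction {K : Type*} [CommRing K] [Algebra k K] (ρ : klingen k →ₜ* ℂˣ)
    (ι : K →ₐ[k] Matrix (Fin 2) (Fin 2) k) (χ : Kˣ →* ℂˣ) : Prop :=
  ∃ (x : GSp4 k) (h : ∀ t : Kˣ, x * torus ι t * x⁻¹ ∈ klingenLevi k),
    ∀ t : Kˣ, χ t = ρ ⟨x * torus ι t * x⁻¹, klingenLevi_le (h t)⟩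

end Induction

end

end GSp4Bessel

namespace GSp4Bessel

noncomputable section

set_option linter.unusedSimpArgs false
set_option linter.unnecessarySeqFocus false
set_option linter.unusedSectionVars false

open ValuativeRel Filter Topology

/-! ### Topology of the local field: balls, locally constant characters, Haar measure. -/

section Field
variable {k : Type*} [Field k] [ValuativeRel k] [TopologicalSpace k]
  [IsNonarchimedeanLocalField k]

/-! Since `2` is invertible, a character of `Q` depends only on the eigenvalue on `e₁` and on the
similitude (`character_eq`), and `Sp₄(k)` is transitive on nonzero vectors. So the induced
representation can be realized on locally constant homogeneous functions on `k⁴` without the origin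
(`homogFun`, `exists_homogFun_eq`). Write a vector as `(u, w)` with `u, w` in `k²`. An element `n`
of `N` fixes `w` and moves `u` by a translation by `n w`, so `N` preserves every fibre over `w`.

A functional on which `N` acts by a nondegenerate character can only live over those `w ≠ 0` for
which the character is trivial on the stabilizer `{n : n w = 0}`. This stabilizer is spanned by the
square of the rotated vector `perp w`, so the condition is that `perp w` is isotropic for `s`; over
`w = 0` the group `N` acts trivially and nothing survives. Compactness of the sphere turns this
heuristic into `functional_eq_zero_of_zeroFibers`. The form `s` has isotropic vectors exactly when
`K` is split (`nonempty_algEquiv_of_isotropic`, `exists_isotropic_of_algEquiv`), which settles the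
nonsplit case.

In the split case a change of basis makes `s` antidiagonal and `K*` diagonal, and the isotropic
lines become the two coordinate axes. By homogeneity only the fibres over the two basis vectors
matter. On such a fibre `N` acts through all translations, so the only candidate functional is the
integral against a character. Functions on the fibre need not have compact support, but their
differences under `N` do; dividing the integral of a difference by `ψ(n) - 1` regularizes the
functional (`besselFunctional`). The two functionals so obtained form a basis of the space of `(N,
ψ)`-equivariant functionals (`linearIndependent_splitFunctional`, `mem_span_splitFunctional`).

The torus acts on each of them by a value of `ρ`, because `δ_Q^{1/2}` cancels the Jacobian of the
action on the fibre. The resulting two characters of `K*` are exactly the restrictions of `ρ`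
(`isRestriction_split_iff`), and they coincide exactly when `ρ` is trivial on elements of similitude
`1` (`splitChar_eq_iff`). The dimension for `χ` is the number of these characters, counted by fibre,
that equal `χ`. -/

theorem normalizedAbs_zero : normalizedAbs (0 : k) = 0 := by simp [normalizedAbs]

theorem card_residueField_pos :
    (0 : ℝ) < (Nat.card (IsLocalRing.ResidueField (valuation k).integer) : ℝ) := by
  exact_mod_cast Nat.card_pos

theorem normalizedAbs_of_ne_zero {x : k} (hx : x ≠ 0) : normalizedAbs x =
    (Nat.card (IsLocalRing.ResidueField (valuation k).integer) : ℝ) ^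
      WithZero.log (IsNonarchimedeanLocalField.valueGroupWithZeroIsoInt k (valuation k x)) := by
  simp [normalizedAbs, hx]

theorem normalizedAbs_ne_zero {x : k} (hx : x ≠ 0) : normalizedAbs x ≠ 0 := by
  rw [normalizedAbs_of_ne_zero hx]
  exact zpow_ne_zero _ card_residueField_pos.ne'

theorem normalizedAbs_mul (x y : k) :
    normalizedAbs (x * y) = normalizedAbs x * normalizedAbs y := by
  rcases eq_or_ne x 0 with rfl | hx
  · simp [normalizedAbs_zero]
  rcases eq_or_ne y 0 with rfl | hy
  · simp [normalizedAbs_zero]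
  rw [normalizedAbs_of_ne_zero hx, normalizedAbs_of_ne_zero hy,
    normalizedAbs_of_ne_zero (mul_ne_zero hx hy), map_mul, map_mul, WithZero.log_mul,
    zpow_add₀ card_residueField_pos.ne']
  · simpa using hx
  · simpa using hy

theorem normalizedAbs_eq_one_of_valuation {x : k} (hx : valuation k x = 1) :
    normalizedAbs x = 1 := by
  have h0 : x ≠ 0 := by rintro rfl; simp at hx
  rw [normalizedAbs_of_ne_zero h0, hx]
  simp

/-- The normalized absolute value as a homomorphism on the multiplicative group. -/
def absHom : kˣ →* ℂˣ where
  toFun x := Units.mk0 (normalizedAbs (x : k) : ℂ)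
    (by exact_mod_cast normalizedAbs_ne_zero x.ne_zero)
  map_one' := by ext; simp [normalizedAbs_eq_one_of_valuation]
  map_mul' x y := by ext; simp [normalizedAbs_mul]

theorem absHom_apply (x : kˣ) : ((absHom x : ℂˣ) : ℂ) = (normalizedAbs (x : k) : ℂ) := rfl

theorem hasBasis_nhds_zero_ball :
    (𝓝 (0 : k)).HasBasis (fun r : k => r ≠ 0) fun r => {x | valuation k x ≤ valuation k r} := by
  refine (IsValuativeTopology.hasBasis_nhds_zero' k).to_hasBasis (fun γ hγ => ?_) fun r hr => ?_
  · obtain ⟨t, ht, ht1⟩ := Valuation.IsNontrivial.exists_lt_one (v := valuation k)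
    obtain ⟨r, rfl⟩ := valuation_surjective γ
    simp only [ne_eq, map_eq_zero] at hγ ht
    refine ⟨r * t, mul_ne_zero hγ (by simpa using ht), fun x hx => ?_⟩
    refine lt_of_le_of_lt (b := valuation k (r * t)) hx ?_
    rw [map_mul]
    have : 0 < valuation k r := by simpa [zero_lt_iff] using hγ
    simpa using mul_lt_mul_of_pos_left ht1 this
  · refine ⟨valuation k r, by simpa using hr, fun x hx => ?_⟩
    exact le_of_lt (b := valuation k r) hx

theorem ball_mem_nhds_zero {r : k} (hr : r ≠ 0) :
    {x : k | valuation k x ≤ valuation k r} ∈ 𝓝 (0 : k) :=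
  hasBasis_nhds_zero_ball.mem_of_mem hr

theorem eventually_sub_le (x : k) {r : k} (hr : r ≠ 0) :
    ∀ᶠ y in 𝓝 x, valuation k (y - x) ≤ valuation k r := by
  have : Tendsto (fun y => y - x) (𝓝 x) (𝓝 0) := by
    have : Continuous fun y : k => y - x := by fun_prop
    simpa using this.tendsto x
  exact this (ball_mem_nhds_zero hr)

theorem eventually_valuation_eq {x : k} (hx : x ≠ 0) :
    ∀ᶠ y in 𝓝 x, valuation k y = valuation k x := by
  obtain ⟨t, ht, ht1⟩ := Valuation.IsNontrivial.exists_lt_one (v := valuation k)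
  have ht' : t ≠ 0 := by simpa using ht
  filter_upwards [eventually_sub_le x (mul_ne_zero hx ht')] with y hy
  refine Valuation.map_eq_of_sub_lt _ (lt_of_le_of_lt hy ?_)
  rw [map_mul]
  have : 0 < valuation k x := by simpa [zero_lt_iff] using hx
  simpa using mul_lt_mul_of_pos_left ht1 this

instance : T2Space k := by
  refine IsTopologicalAddGroup.t2Space_of_zero_sep fun x hx => ?_
  obtain ⟨t, ht, ht1⟩ := Valuation.IsNontrivial.exists_lt_one (v := valuation k)
  have ht' : t ≠ 0 := by simpa using ht
  refine ⟨_, ball_mem_nhds_zero (mul_ne_zero hx ht'), fun h => ?_⟩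
  have h' : valuation k x ≤ valuation k (x * t) := h
  have : 0 < valuation k x := by simpa [zero_lt_iff] using hx
  rw [map_mul] at h'
  have h2 := mul_lt_mul_of_pos_left ht1 this
  rw [mul_one] at h2
  exact absurd h' (not_le.mpr h2)

omit [TopologicalSpace k] [IsNonarchimedeanLocalField k] in
theorem valuation_natCast_le_one (n : ℕ) : valuation k (n : k) ≤ 1 :=
  natCast_mem (valuation k).integer n

theorem isClopen_ball {r : k} (hr : r ≠ 0) : IsClopen {x : k | valuation k x ≤ valuation k r} := by
  constructor
  · exact (IsNonarchimedeanLocalField.isCompact_closedBall k _).isClosed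
  · rw [isOpen_iff_mem_nhds]
    intro x hx
    filter_upwards [eventually_sub_le x hr] with y hy
    have := Valuation.map_add_le _ hy hx
    simpa using this

/-- A complex number all of whose iterated squares are close to `1` is equal to `1`. -/
theorem eq_one_of_pow_two_pow {z : ℂ} (h : ∀ n : ℕ, ‖z ^ 2 ^ n - 1‖ ≤ 1 / 2) : z = 1 := by
  -- In `w² - 1 = (w - 1)(w + 1)` the second factor has norm at least `2 - 1/2 = 3/2`, so the
  -- distance to `1` grows geometrically unless it is zero.
  have key : ∀ n : ℕ, (3 / 2 : ℝ) ^ n * ‖z - 1‖ ≤ ‖z ^ 2 ^ n - 1‖ := by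
    intro n
    induction n with
    | zero => simp
    | succ n ih =>
      have h1 : z ^ 2 ^ (n + 1) - 1 = (z ^ 2 ^ n - 1) * (z ^ 2 ^ n + 1) := by
        rw [pow_succ, pow_mul]; ring
      have h2 : (3 / 2 : ℝ) ≤ ‖z ^ 2 ^ n + 1‖ := by
        have h3 : ‖(2 : ℂ)‖ ≤ ‖z ^ 2 ^ n + 1‖ + ‖z ^ 2 ^ n - 1‖ := by
          calc ‖(2 : ℂ)‖ = ‖(z ^ 2 ^ n + 1) - (z ^ 2 ^ n - 1)‖ := by congr 1; ring
            _ ≤ _ := norm_sub_le _ _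
        have := h n
        norm_num at h3
        linarith
      rw [h1, norm_mul, pow_succ]
      nlinarith [norm_nonneg (z ^ 2 ^ n - 1), norm_nonneg (z - 1)]
  by_contra hz
  have hpos : 0 < ‖z - 1‖ := norm_pos_iff.mpr (sub_ne_zero.mpr hz)
  obtain ⟨n, hn⟩ := pow_unbounded_of_one_lt (1 / ‖z - 1‖) (by norm_num : (1 : ℝ) < 3 / 2)
  have h1 := (key n).trans (h n)
  rw [div_lt_iff₀ hpos] at hn
  linarith

/-- There are no small subgroups in `ℂ*`. Balls are stable under multiplication by powers of `2`, so
if a ball maps close to `1`, then so do all iterated squares of its values. -/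
theorem exists_addChar_eq_one (ψ : AddChar k ℂ) (hψ : Continuous ψ) :
    ∃ r : k, r ≠ 0 ∧ ∀ x, valuation k x ≤ valuation k r → ψ x = 1 := by
  have h : ψ ⁻¹' Metric.closedBall 1 (1 / 2) ∈ 𝓝 (0 : k) := by
    apply hψ.continuousAt
    rw [AddChar.map_zero_eq_one]
    exact Metric.closedBall_mem_nhds _ (by norm_num)
  obtain ⟨r, hr, hr'⟩ := hasBasis_nhds_zero_ball.mem_iff.mp h
  refine ⟨r, hr, fun x hx => eq_one_of_pow_two_pow fun n => ?_⟩
  have h1 : valuation k ((2 ^ n : ℕ) • x) ≤ valuation k r := by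
    rw [nsmul_eq_mul, map_mul]
    refine le_trans (mul_le_of_le_one_left' ?_) hx
    exact valuation_natCast_le_one _ 
  have h2 := hr' h1
  rw [Set.mem_preimage, AddChar.map_nsmul_eq_pow, Metric.mem_closedBall, dist_eq_norm] at h2
  exact h2

/-- Multiplicative form of the same argument: for `|r| ≤ 1` the set `{x : |x - 1| ≤ |r|}` is stable
under squaring, because `y² - 1 = (y - 1)((y - 1) + 2)`. -/
theorem eventually_character_eq_one (χ : kˣ →* ℂˣ) (hχ : Continuous χ) :
    ∀ᶠ x in 𝓝 (1 : kˣ), χ x = 1 := by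
  have h : (fun x : kˣ => (χ x : ℂ)) ⁻¹' Metric.closedBall 1 (1 / 2) ∈ 𝓝 (1 : kˣ) := by
    apply (Units.continuous_val.comp hχ).continuousAt
    simpa using Metric.closedBall_mem_nhds (1 : ℂ) (by norm_num : (0 : ℝ) < 1 / 2)
  have hemb : IsEmbedding (Units.val : kˣ → k) := Units.isEmbedding_val₀
  rw [hemb.isInducing.nhds_eq_comap, mem_comap] at h
  obtain ⟨t, ht, ht'⟩ := h
  have h1 : (fun x : k => 1 + x) ⁻¹' t ∈ 𝓝 (0 : k) := by
    have : Continuous fun x : k => 1 + x := by fun_prop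
    apply this.continuousAt
    simpa using ht
  obtain ⟨r, hr, hr'⟩ := hasBasis_nhds_zero_ball.mem_iff.mp
    (inter_mem h1 (ball_mem_nhds_zero (one_ne_zero (α := k))))
  have hev : ∀ᶠ x : kˣ in 𝓝 1, valuation k ((x : k) - 1) ≤ valuation k r :=
    (Units.continuous_val.tendsto (1 : kˣ)).eventually (eventually_sub_le ((1 : kˣ) : k) hr)
  filter_upwards [hev] with x hx
  have hpow : ∀ n : ℕ, valuation k ((x : k) ^ 2 ^ n - 1) ≤ valuation k r := by
    intro n
    induction n with
    | zero => simpa using hx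
    | succ n ih =>
      have h2 : (x : k) ^ 2 ^ (n + 1) - 1 =
          ((x : k) ^ 2 ^ n - 1) * ((x : k) ^ 2 ^ n - 1 + 2) := by
        rw [pow_succ, pow_mul]; ring
      rw [h2, map_mul]
      refine le_trans (mul_le_of_le_one_right' ?_) ih
      refine Valuation.map_add_le _ ?_ (valuation_natCast_le_one 2)
      simpa using (hr' ih).2
  ext
  refine eq_one_of_pow_two_pow fun n => ?_
  have h3 : (x : k) ^ 2 ^ n ∈ t := by simpa using (hr' (hpow n)).1
  have h4 : x ^ 2 ^ n ∈ Units.val ⁻¹' t := by simpa using h3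
  have h5 := ht' h4
  rw [Set.mem_preimage, Metric.mem_closedBall, dist_eq_norm] at h5
  simpa using h5

theorem eventually_absHom_eq_one : ∀ᶠ x in 𝓝 (1 : kˣ), absHom x = 1 := by
  have h := Units.continuous_val.continuousAt.eventually
    (by simpa using eventually_valuation_eq (one_ne_zero (α := k)) :
      ∀ᶠ y in 𝓝 (((1 : kˣ) : k)), valuation k y = 1)
  filter_upwards [h] with x hx
  ext
  simp [absHom_apply, normalizedAbs_eq_one_of_valuation hx]

theorem exists_valuation_uniformizer : ∃ ϖ : kˣ,
    IsNonarchimedeanLocalField.valueGroupWithZeroIsoInt k (valuation k (ϖ : k)) =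
      WithZero.exp (-1) ∧
    ∀ x : k, valuation k x < 1 ↔ valuation k x ≤ valuation k (ϖ : k) := by
  set e := IsNonarchimedeanLocalField.valueGroupWithZeroIsoInt k
  obtain ⟨ϖ, hϖ⟩ := valuation_surjective (e.symm (WithZero.exp (-1)))
  have h0 : ϖ ≠ 0 := by
    rintro rfl
    rw [map_zero] at hϖ
    have := congrArg e hϖ
    rw [map_zero, OrderMonoidIso.apply_symm_apply] at this
    exact WithZero.exp_ne_zero this.symm
  have hϖ' : e (valuation k ϖ) = WithZero.exp (-1) := by rw [hϖ]; simp
  refine ⟨Units.mk0 ϖ h0, hϖ', fun x => ?_⟩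
  rcases eq_or_ne x 0 with rfl | hx
  · simp
  rw [← e.strictMono.lt_iff_lt, ← e.strictMono.le_iff_le, Units.val_mk0, hϖ', map_one]
  have hx' : e (valuation k x) ≠ 0 := by simpa using hx
  rw [← WithZero.log_lt_log hx' one_ne_zero, ← WithZero.log_le_log hx' WithZero.exp_ne_zero]
  simp only [WithZero.log_one, WithZero.log_exp]
  omega

theorem mem_maximalIdeal_integer (x : (valuation k).integer) :
    x ∈ IsLocalRing.maximalIdeal (valuation k).integer ↔ valuation k (x : k) < 1 := by
  rw [IsLocalRing.mem_maximalIdeal, mem_nonunits_iff,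
    Valuation.Integers.isUnit_iff_valuation_eq_one (Valuation.integer.integers _)]
  exact (lt_iff_le_and_ne.trans (and_iff_right x.2)).symm

/-- The ball of radius `|r|` in a product of copies of `k`. -/
def polyball (ι : Type*) (r : k) : AddSubgroup (ι → k) where
  carrier := {u | ∀ l, valuation k (u l) ≤ valuation k r}
  zero_mem' l := by simp
  add_mem' ha hb l := Valuation.map_add_le _ (ha l) (hb l)
  neg_mem' ha l := by simpa using ha l

omit [TopologicalSpace k] [IsNonarchimedeanLocalField k] in
theorem mem_polyball {ι : Type*} {r : k} {u : ι → k} :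
    u ∈ polyball ι r ↔ ∀ l, valuation k (u l) ≤ valuation k r := Iff.rfl

theorem isCompact_polyball {ι : Type*} (r : k) :
    IsCompact (polyball ι r : Set (ι → k)) := by
  have := isCompact_univ_pi (ι := ι)
    fun _ => IsNonarchimedeanLocalField.isCompact_closedBall k (valuation k r)
  convert! this using 1
  ext u
  simp [mem_polyball]

theorem polyball_mem_nhds {ι : Type*} [Finite ι] {r : k} (hr : r ≠ 0) :
    (polyball ι r : Set (ι → k)) ∈ 𝓝 0 := by
  have := set_pi_mem_nhds (i := Set.univ) (x := (0 : ι → k)) Set.finite_univ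
    fun l _ => ball_mem_nhds_zero hr
  refine mem_of_superset this fun u hu l => hu l trivial

theorem isOpen_polyball {ι : Type*} [Finite ι] {r : k} (hr : r ≠ 0) :
    IsOpen (polyball ι r : Set (ι → k)) :=
  (polyball ι r).isOpen_of_mem_nhds (g := 0) (polyball_mem_nhds hr)

theorem exists_polyball_subset {ι : Type*} [Finite ι] {s : Set (ι → k)} (hs : s ∈ 𝓝 0) :
    ∃ r : k, r ≠ 0 ∧ (polyball ι r : Set (ι → k)) ⊆ s := by
  have := Fintype.ofFinite ι
  rw [nhds_pi, Filter.mem_pi] at hs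
  obtain ⟨I, -, t, ht, hts⟩ := hs
  have h : ⋂ i, t i ∈ 𝓝 (0 : k) := by
    rw [Filter.iInter_mem]
    exact ht
  obtain ⟨r, hr, hr'⟩ := hasBasis_nhds_zero_ball.mem_iff.mp h
  exact ⟨r, hr, fun u hu => hts fun i _ => Set.mem_iInter.mp (hr' (hu i)) i⟩

/-! ### Scaling one coordinate multiplies Haar measure by the normalized absolute value. -/

section Haar
open MeasureTheory MeasureTheory.Measure
open scoped Pointwise

variable {ι : Type*} [Fintype ι] [DecidableEq ι] [MeasurableSpace (ι → k)] [BorelSpace (ι → k)]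

/-- The factor by which scaling the coordinate `i` scales Haar measures. -/
def coordScale (i : ι) : kˣ →* NNReal :=
  (distribHaarChar (ι → k)).comp (MonoidHom.mulSingle (fun _ : ι => kˣ) i)

omit [MeasurableSpace (ι → k)] [BorelSpace (ι → k)] in
theorem coordScale_eq_one (i : ι) {c : kˣ} (hc : valuation k (c : k) = 1) :
    coordScale i c = 1 := by
  let _ : MeasurableSpace (ι → k) := borel _
  have _ : BorelSpace (ι → k) := ⟨rfl⟩
  have hop := isOpen_polyball (ι := ι) (one_ne_zero (α := k))
  refine distribHaarChar_eq_of_measure_smul_eq_mul (μ := addHaar)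
    (s := (polyball ι (1 : k) : Set (ι → k)))
    (hop.measure_pos _ ⟨0, zero_mem _⟩).ne' (isCompact_polyball (ι := ι) (1 : k)).measure_lt_top.ne ?_
  rw [ENNReal.coe_one, one_mul]
  congr 1
  ext u
  rw [Set.mem_smul_set_iff_inv_smul_mem, SetLike.mem_coe, SetLike.mem_coe, mem_polyball,
    mem_polyball]
  refine forall_congr' fun l => ?_
  rcases eq_or_ne l i with rfl | hl
  · simp [Units.smul_def, hc]
  · simp [hl]

omit [MeasurableSpace (ι → k)] [BorelSpace (ι → k)] in
theorem coordScale_uniformizer (i : ι) {ϖ : kˣ}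
    (hϖ : ∀ x : k, valuation k x < 1 ↔ valuation k x ≤ valuation k (ϖ : k)) :
    coordScale i ϖ =
      (Nat.card (IsLocalRing.ResidueField (valuation k).integer) : NNReal)⁻¹ := by
  let _ : MeasurableSpace (ι → k) := borel _
  have _ : BorelSpace (ι → k) := ⟨rfl⟩
  have hop := isOpen_polyball (ι := ι) (one_ne_zero (α := k))
  have hq : (Nat.card (IsLocalRing.ResidueField (valuation k).integer) : NNReal) ≠ 0 := by
    exact_mod_cast Nat.card_pos.ne'
  set g : ι → kˣ := MonoidHom.mulSingle (fun _ : ι => kˣ) i ϖ with hg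
  set Y : Set (ι → k) := g • (polyball ι (1 : k) : Set (ι → k)) with hY
  have hmem : ∀ u : ι → k, u ∈ Y ↔ (∀ l, valuation k (u l) ≤ 1) ∧ valuation k (u i) < 1 := by
    intro u
    rw [hY, Set.mem_smul_set_iff_inv_smul_mem, SetLike.mem_coe, mem_polyball, hϖ]
    have hpos : 0 < valuation k (ϖ : k) := by simp [zero_lt_iff]
    have hi : valuation k ((g⁻¹ • u) i) ≤ valuation k (1 : k) ↔
        valuation k (u i) ≤ valuation k (ϖ : k) := by
      simp [hg, Units.smul_def, inv_mul_le_iff₀ hpos]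
    have hl : ∀ l, l ≠ i → ((g⁻¹ • u) l) = u l := by
      intro l hl
      simp [hg, hl]
    constructor
    · intro h
      have h1 := hi.mp (h i)
      refine ⟨fun l => ?_, h1⟩
      rcases eq_or_ne l i with rfl | hli
      · exact ((hϖ _).mpr h1).le
      · simpa [hl l hli] using h l
    · rintro ⟨h1, h2⟩ l
      rcases eq_or_ne l i with rfl | hli
      · exact hi.mpr h2
      · simpa [hl l hli] using h1 l
  have hYo : IsOpen Y := by
    rw [hY]
    exact hop.smul g
  have hrep := fun x : IsLocalRing.ResidueField (valuation k).integer =>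
    IsLocalRing.residue_surjective x
  choose rep hrep using hrep
  -- The unit ball is a disjoint union of translates of the scaled ball `Y`, one for each residue
  -- class of the coordinate `i`; hence its volume is that of `Y` times the cardinality of the
  -- residue field.
  have hunion : (polyball ι (1 : k) : Set (ι → k)) =
      ⋃ x : IsLocalRing.ResidueField (valuation k).integer,
        (fun u : ι → k => -(Pi.single i (rep x : k) : ι → k) + u) ⁻¹' Y := by
    ext u
    simp only [SetLike.mem_coe, mem_polyball, map_one, Set.mem_iUnion, Set.mem_preimage, hmem]
    constructor
    · intro h
      refine ⟨IsLocalRing.residue _ ⟨u i, h i⟩, fun l => ?_, ?_⟩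
      · refine Valuation.map_add_le _ ?_ (h l)
        rw [Pi.neg_apply, Valuation.map_neg]
        rcases eq_or_ne l i with rfl | hli
        · rw [Pi.single_eq_same]
          exact (rep _).2
        · simp [hli]
      · have : (⟨u i, h i⟩ : (valuation k).integer) -
            rep (IsLocalRing.residue _ ⟨u i, h i⟩) ∈ IsLocalRing.maximalIdeal _ := by
          rw [← IsLocalRing.residue_eq_zero_iff, map_sub, hrep, sub_self]
        have h3 := (mem_maximalIdeal_integer _).mp this
        simpa [neg_add_eq_sub] using h3
    · rintro ⟨x, h, -⟩ l
      have h1 := h l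
      have h2 : valuation k ((Pi.single i (rep x : k) : ι → k) l) ≤ 1 := by
        rcases eq_or_ne l i with rfl | hli
        · rw [Pi.single_eq_same]
          exact (rep _).2
        · simp [hli]
      have := Valuation.map_add_le _ h2 h1
      simpa using this
  have hdisj : Pairwise (Function.onFun Disjoint
      fun x : IsLocalRing.ResidueField (valuation k).integer =>
        (fun u : ι → k => -(Pi.single i (rep x : k) : ι → k) + u) ⁻¹' Y) := by
    intro x y hxy
    refine Set.disjoint_left.mpr fun u hu hu' => hxy ?_
    rw [Set.mem_preimage, hmem] at hu hu'
    have h1 := hu.2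
    have h2 := hu'.2
    have h3 : valuation k ((rep x - rep y : (valuation k).integer) : k) < 1 := by
      have := Valuation.map_sub_lt _ h2 h1
      simpa [neg_add_eq_sub] using this
    have h4 := (IsLocalRing.residue_eq_zero_iff _).mpr ((mem_maximalIdeal_integer _).mpr h3)
    rw [map_sub, hrep, hrep] at h4
    exact sub_eq_zero.mp h4
  have hvol : (addHaar : Measure (ι → k)) (polyball ι (1 : k) : Set (ι → k)) =
      (Nat.card (IsLocalRing.ResidueField (valuation k).integer) : ENNReal) * addHaar Y := by
    have : Fintype (IsLocalRing.ResidueField (valuation k).integer) := Fintype.ofFinite _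
    rw [hunion, measure_iUnion hdisj]
    · simp [measure_preimage_add, Nat.card_eq_fintype_card]
    · intro x
      exact (hYo.preimage (by fun_prop)).measurableSet
  refine distribHaarChar_eq_of_measure_smul_eq_mul (μ := addHaar)
    (s := (polyball ι (1 : k) : Set (ι → k)))
    (hop.measure_pos _ ⟨0, zero_mem _⟩).ne' (isCompact_polyball (ι := ι) (1 : k)).measure_lt_top.ne ?_
  change addHaar Y = _
  rw [hvol, ← mul_assoc, ENNReal.coe_inv hq, ENNReal.coe_natCast, ENNReal.inv_mul_cancel, one_mul]
  · exact_mod_cast hq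
  · exact ENNReal.natCast_ne_top _

omit [MeasurableSpace (ι → k)] [BorelSpace (ι → k)] in
-- Both sides are homomorphisms on `kˣ`. They agree on elements of valuation `1` and on a
-- uniformizer, and these generate `kˣ`.
theorem coordScale_eq_normalizedAbs (i : ι) (c : kˣ) :
    (coordScale i c : ℝ) = normalizedAbs (c : k) := by
  obtain ⟨ϖ, hϖ1, hϖ2⟩ := exists_valuation_uniformizer (k := k)
  set e := IsNonarchimedeanLocalField.valueGroupWithZeroIsoInt k
  let F : kˣ →* ℝˣ := (NNReal.toRealHom.toMonoidHom.comp (coordScale i)).toHomUnits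
  let A : kˣ →* ℝˣ := MonoidHom.toHomUnits
    { toFun := fun x : kˣ => normalizedAbs (x : k)
      map_one' := by simp [normalizedAbs_eq_one_of_valuation]
      map_mul' := fun x y => by simp [normalizedAbs_mul] }
  have hF : ∀ x, ((F x : ℝˣ) : ℝ) = (coordScale i x : ℝ) := fun x => rfl
  have hA : ∀ x, ((A x : ℝˣ) : ℝ) = normalizedAbs (x : k) := fun x => rfl
  have hunit : ∀ x : kˣ, valuation k (x : k) = 1 → F x = A x := fun x hx => by
    ext
    rw [hF, hA, coordScale_eq_one i hx, normalizedAbs_eq_one_of_valuation hx]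
    simp
  have hunif : F ϖ = A ϖ := by
    ext
    rw [hF, hA, coordScale_uniformizer i hϖ2, normalizedAbs_of_ne_zero ϖ.ne_zero, hϖ1]
    simp
  have hc0 : e (valuation k (c : k)) ≠ 0 := by simp
  set n : ℤ := -WithZero.log (e (valuation k (c : k))) with hn
  have hv : valuation k ((c * (ϖ ^ n)⁻¹ : kˣ) : k) = 1 := by
    have hx : e (valuation k (c : k)) = e (valuation k (ϖ : k) ^ n) := by
      rw [map_zpow₀, hϖ1, ← WithZero.exp_zsmul, hn]
      simp [WithZero.exp_log hc0]
    have hϖ0 : valuation k (ϖ : k) ^ n ≠ 0 := zpow_ne_zero _ (by simp)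
    simp only [Units.val_mul, Units.val_inv_eq_inv_val, Units.val_zpow_eq_zpow_val, map_mul,
      map_inv₀, map_zpow₀]
    rw [e.injective hx, mul_inv_cancel₀ hϖ0]
  have h := hunit _ hv
  rw [map_mul, map_mul, map_inv, map_inv, map_zpow, map_zpow, hunif] at h
  rw [← hF, ← hA, mul_right_cancel h]

theorem integral_coordScale (μ : Measure (ι → k)) [μ.IsAddHaarMeasure] [μ.Regular] (i : ι) (c : kˣ)
    (h : (ι → k) → ℂ) :
    ∫ u, h ((Pi.mulSingle i c : ι → kˣ) • u) ∂μ = (normalizedAbs (c : k) : ℂ)⁻¹ * ∫ u, h u ∂μ := by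
  set g : ι → kˣ := Pi.mulSingle i c with hg
  have hmap : μ.map (fun u => g • u) = (coordScale i c)⁻¹ • μ := by
    ext s hs
    have hmeas : Measurable fun u : ι → k => g • u := (Homeomorph.smul g).measurable
    rw [Measure.map_apply hmeas hs, Set.preimage_smul,
      ← distribHaarChar_mul μ g⁻¹ s, map_inv]
    simp only [Measure.smul_apply]
    rfl
  have hme : MeasurableEmbedding (fun u : ι → k => g • u) :=
    (Homeomorph.smul g).measurableEmbedding
  rw [← hme.integral_map (μ := μ) h, hmap, integral_smul_nnreal_measure, NNReal.smul_def,
    NNReal.coe_inv, coordScale_eq_normalizedAbs, Complex.real_smul]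
  simp

end Haar

end Field

/-! ### Elements of `GSp₄(k)`, and the unipotent elements killed by characters of `Q`. -/

section Group
variable {k : Type*} [Field k]

theorem GSp4_ext {g h : GSp4 k} (H : g.val.val = h.val.val) : g = h :=
  Subtype.ext (Units.ext H)

theorem coe_mul (g h : GSp4 k) : (g * h).val.val = g.val.val * h.val.val := rfl

theorem coe_one : (1 : GSp4 k).val.val = 1 := rfl

theorem mul_mulVec (g h : GSp4 k) (v : Fin 2 ⊕ Fin 2 → k) :
    (g * h).val.val *ᵥ v = g.val.val *ᵥ (h.val.val *ᵥ v) := by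
  rw [coe_mul, Matrix.mulVec_mulVec]

theorem inv_mulVec_mulVec (g : GSp4 k) (v : Fin 2 ⊕ Fin 2 → k) :
    (g⁻¹).val.val *ᵥ (g.val.val *ᵥ v) = v := by
  rw [← mul_mulVec, inv_mul_cancel, coe_one, Matrix.one_mulVec]

theorem mulVec_inv_mulVec (g : GSp4 k) (v : Fin 2 ⊕ Fin 2 → k) :
    g.val.val *ᵥ ((g⁻¹).val.val *ᵥ v) = v := by
  rw [← mul_mulVec, mul_inv_cancel, coe_one, Matrix.one_mulVec]

theorem mulVec_ne_zero (g : GSp4 k) {v : Fin 2 ⊕ Fin 2 → k} (hv : v ≠ 0) :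
    g.val.val *ᵥ v ≠ 0 := by
  intro h
  apply hv
  rw [← inv_mulVec_mulVec g v, h, Matrix.mulVec_zero]

theorem J_apply_inr_inl : J (Fin 2) k (Sum.inr 0) (Sum.inl 0) = 1 := by simp [J]

theorem similitude_eq {g : GSp4 k} {c : k}
    (h : (g.val.val)ᵀ * J (Fin 2) k * g.val.val = c • J (Fin 2) k) : similitude g = c := by
  rw [similitude, h, Matrix.smul_apply, J_apply_inr_inl, smul_eq_mul, mul_one]

theorem similitude_spec (g : GSp4 k) :
    (g.val.val)ᵀ * J (Fin 2) k * g.val.val = similitude g • J (Fin 2) k := by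
  obtain ⟨c, hc⟩ := g.property
  rw [similitude_eq hc, hc]

theorem similitude_ne_zero (g : GSp4 k) : similitude g ≠ 0 := by
  obtain ⟨c, hc⟩ := g.property
  rw [similitude_eq hc]
  exact c.ne_zero

theorem similitude_mul (g h : GSp4 k) : similitude (g * h) = similitude g * similitude h := by
  apply similitude_eq
  calc ((g * h).val.val)ᵀ * J (Fin 2) k * (g * h).val.val
      = (h.val.val)ᵀ * ((g.val.val)ᵀ * J (Fin 2) k * g.val.val) * h.val.val := by
        rw [coe_mul, Matrix.transpose_mul]; simp only [Matrix.mul_assoc]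
    _ = (similitude g * similitude h) • J (Fin 2) k := by
      rw [similitude_spec, Matrix.mul_smul, Matrix.smul_mul, similitude_spec, smul_smul]

/-- The similitude character. -/
def similitudeHom : GSp4 k →* kˣ where
  toFun g := Units.mk0 (similitude g) (similitude_ne_zero g)
  map_one' := by
    ext
    exact similitude_eq (by simp)
  map_mul' g h := by
    ext
    exact similitude_mul g h

theorem coe_similitudeHom (g : GSp4 k) : (similitudeHom g : k) = similitude g := rfl

theorem similitudeHom_eq {g : GSp4 k} {c : kˣ}
    (h : (g.val.val)ᵀ * J (Fin 2) k * g.val.val = (c : k) • J (Fin 2) k) :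
    similitudeHom g = c :=
  Units.ext (similitude_eq h)

/-- The element of `GSp₄(k)` with a given matrix. -/
def ofMatrix (M : Matrix (Fin 2 ⊕ Fin 2) (Fin 2 ⊕ Fin 2) k) (c : kˣ)
    (h : Mᵀ * J (Fin 2) k * M = (c : k) • J (Fin 2) k) : GSp4 k :=
  -- Since `J² = -1`, the relation `Mᵀ J M = c J` exhibits `-c⁻¹ J Mᵀ J` as an inverse of `M`.
  have hl : (-(c⁻¹ : kˣ) : k) • (J (Fin 2) k * Mᵀ * J (Fin 2) k) * M = 1 := by
    have h1 : J (Fin 2) k * Mᵀ * J (Fin 2) k * M = J (Fin 2) k * (Mᵀ * J (Fin 2) k * M) := by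
      simp only [Matrix.mul_assoc]
    rw [Matrix.smul_mul, h1, h, Matrix.mul_smul, J_squared, smul_smul]
    simp
  ⟨⟨M, (-(c⁻¹ : kˣ) : k) • (J (Fin 2) k * Mᵀ * J (Fin 2) k), mul_eq_one_comm.mp hl, hl⟩, c, h⟩

theorem coe_ofMatrix {M : Matrix (Fin 2 ⊕ Fin 2) (Fin 2 ⊕ Fin 2) k} {c : kˣ}
    (h : Mᵀ * J (Fin 2) k * M = (c : k) • J (Fin 2) k) : (ofMatrix M c h).val.val = M := rfl

theorem similitudeHom_ofMatrix {M : Matrix (Fin 2 ⊕ Fin 2) (Fin 2 ⊕ Fin 2) k} {c : kˣ}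
    (h : Mᵀ * J (Fin 2) k * M = (c : k) • J (Fin 2) k) : similitudeHom (ofMatrix M c h) = c :=
  similitudeHom_eq h

/-- The first basis vector. -/
abbrev e₁ : Fin 2 ⊕ Fin 2 → k := Pi.single (Sum.inl 0) 1

theorem e₁_ne_zero : (e₁ : Fin 2 ⊕ Fin 2 → k) ≠ 0 := by
  intro h
  have := congrFun h (Sum.inl 0)
  simp at this

/-- The eigenvalue of an element of the Klingen parabolic on the first basis vector. -/
def eigen (q : klingen k) : k := q.val.val.val (Sum.inl 0) (Sum.inl 0)

theorem eigen_eq {q : klingen k} {c : k} (h : q.val.val.val *ᵥ e₁ = c • e₁) : eigen q = c := by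
  have := congrFun h (Sum.inl 0)
  rw [eigen]
  simpa using this

theorem eigen_spec (q : klingen k) : q.val.val.val *ᵥ e₁ = eigen q • e₁ := by
  obtain ⟨c, hc⟩ := q.property
  rw [eigen_eq hc]
  exact hc

theorem eigen_ne_zero (q : klingen k) : eigen q ≠ 0 := by
  intro h
  have := eigen_spec q
  rw [h, zero_smul] at this
  exact mulVec_ne_zero q.val e₁_ne_zero this

/-- The eigenvalue on the first basis vector, as a homomorphism. -/
def eigenHom : klingen k →* kˣ where
  toFun q := Units.mk0 (eigen q) (eigen_ne_zero q)
  map_one' := by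
    ext
    refine eigen_eq (q := 1) ?_
    rw [Subgroup.coe_one, coe_one, Matrix.one_mulVec, Units.val_one, one_smul]
  map_mul' p q := by
    ext
    rw [Units.val_mul, Units.val_mk0, Units.val_mk0, Units.val_mk0]
    refine eigen_eq ?_
    rw [Subgroup.coe_mul, mul_mulVec, eigen_spec, Matrix.mulVec_smul, eigen_spec, smul_smul,
      mul_comm]

theorem coe_eigenHom (q : klingen k) : (eigenHom q : k) = eigen q := rfl

theorem eigenHom_eq {q : klingen k} {c : kˣ} (h : q.val.val.val *ᵥ e₁ = (c : k) • e₁) :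
    eigenHom q = c := Units.ext (eigen_eq h)

/-- The torus element `diag(a, 1, c/a, c)`. -/
def diagElt (a c : kˣ) : GSp4 k :=
  ofMatrix (fromBlocks !![(a : k), 0; 0, 1] 0 0 !![((c * a⁻¹ : kˣ) : k), 0; 0, (c : k)]) c (by
    simp only [J, fromBlocks_transpose, fromBlocks_multiply, fromBlocks_smul]
    congr 1 <;> ext i j <;> fin_cases i <;> fin_cases j <;> simp [Matrix.mul_apply, Fin.sum_univ_two] <;> field_simp)

theorem similitudeHom_diagElt (a c : kˣ) : similitudeHom (diagElt a c) = c :=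
  similitudeHom_ofMatrix _

theorem diagElt_mulVec (a c : kˣ) : (diagElt a c).val.val *ᵥ e₁ = (a : k) • e₁ := by
  rw [diagElt, coe_ofMatrix]
  ext i
  rcases i with i | i <;> fin_cases i <;> simp

theorem diagElt_mem (a c : kˣ) : diagElt a c ∈ klingen k := ⟨a, diagElt_mulVec a c⟩

theorem diagElt_mul (a b c d : kˣ) : diagElt (a * b) (c * d) = diagElt a c * diagElt b d := by
  apply GSp4_ext
  rw [coe_mul]
  simp only [diagElt, coe_ofMatrix, fromBlocks_multiply]
  congr 1 <;> ext i j <;> fin_cases i <;> fin_cases j <;> simp [Matrix.mul_apply, Fin.sum_univ_two, mul_mul_mul_comm, mul_comm]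

/-- The torus of elements `diag(a, 1, c/a, c)`, as a homomorphism to the Klingen parabolic. -/
def diagHom : kˣ × kˣ →* klingen k where
  toFun p := ⟨diagElt p.1 p.2, diagElt_mem _ _⟩
  map_one' := by
    apply Subtype.ext
    apply GSp4_ext
    change fromBlocks _ _ _ _ = (1 : Matrix (Fin 2 ⊕ Fin 2) (Fin 2 ⊕ Fin 2) k)
    rw [← fromBlocks_one]
    congr 1 <;> ext i j <;> fin_cases i <;> fin_cases j <;> simp [Matrix.mul_apply, Fin.sum_univ_two]
  map_mul' p q := Subtype.ext (diagElt_mul _ _ _ _)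

/-- The unipotent element `e₂ ↦ e₂ + p e₁`, `e₃ ↦ e₃ - p e₄`. -/
def upElt (p : k) : GSp4 k :=
  ofMatrix (fromBlocks !![1, p; 0, 1] 0 0 !![1, 0; -p, 1]) 1 (by
    simp only [J, fromBlocks_transpose, fromBlocks_multiply, fromBlocks_smul]
    congr 1 <;> ext i j <;> fin_cases i <;> fin_cases j <;> simp [Matrix.mul_apply, Fin.sum_univ_two])

/-- The element acting on the span of `e₂` and `e₄` by an element of `SL₂(k)`. -/
def sl2Elt (A B C D : k) (h : A * D - B * C = 1) : GSp4 k :=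
  ofMatrix (fromBlocks !![1, 0; 0, A] !![0, 0; 0, B] !![0, 0; 0, C] !![1, 0; 0, D]) 1 (by
    simp only [J, fromBlocks_transpose, fromBlocks_multiply, fromBlocks_smul]
    congr 1 <;> ext i j <;> fin_cases i <;> fin_cases j <;> simp [Matrix.mul_apply, Fin.sum_univ_two] <;>
      first | ring1 | linear_combination h | linear_combination -h)

theorem mem_klingen_of_fix {g : GSp4 k} (h : g.val.val *ᵥ e₁ = e₁) : g ∈ klingen k :=
  ⟨1, by rw [one_smul]; exact h⟩

theorem siegelN_fix (n : Matrix (Fin 2) (Fin 2) k) (hn : n.IsSymm) :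
    (siegelN n hn).val.val *ᵥ e₁ = e₁ := by
  change fromBlocks 1 n 0 1 *ᵥ e₁ = e₁
  ext i
  rcases i with i | i <;> fin_cases i <;> simp

theorem siegelN_mem (n : Matrix (Fin 2) (Fin 2) k) (hn : n.IsSymm) : siegelN n hn ∈ klingen k :=
  mem_klingen_of_fix (siegelN_fix n hn)

theorem upElt_fix (p : k) : (upElt p).val.val *ᵥ e₁ = e₁ := by
  rw [upElt, coe_ofMatrix]
  ext i
  rcases i with i | i <;> fin_cases i <;> simp

theorem sl2Elt_fix (A B C D : k) (h : A * D - B * C = 1) :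
    (sl2Elt A B C D h).val.val *ᵥ e₁ = e₁ := by
  rw [sl2Elt, coe_ofMatrix]
  ext i
  rcases i with i | i <;> fin_cases i <;> simp

section Character
variable {A : Type*} [CommGroup A] (ρ : klingen k →* A)

/-- The kernel of a character of the Klingen parabolic, as a subgroup of `GSp₄(k)`. -/
def kerSubgroup : Subgroup (GSp4 k) := ρ.ker.map (klingen k).subtype

/-- The relation says that conjugation by `t` inverts `h`, so the image of `h` in an abelian group
has square `1`. Unipotent elements are squares because `2` is invertible, and the sign elements of
the torus invert them; this is how they are shown to lie in the kernel. -/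
theorem mul_self_mem_kerSubgroup {t h : GSp4 k} (ht : t ∈ klingen k) (hh : h ∈ klingen k)
    (H : h * t * h = t) : h * h ∈ kerSubgroup ρ := by
  refine ⟨⟨h, hh⟩ * ⟨h, hh⟩, ?_, rfl⟩
  have h1 : (⟨h, hh⟩ * ⟨t, ht⟩ * ⟨h, hh⟩ : klingen k) = ⟨t, ht⟩ := Subtype.ext H
  have h2 := congrArg ρ h1
  rw [map_mul, map_mul] at h2
  rw [SetLike.mem_coe, MonoidHom.mem_ker, map_mul]
  have h3 : ρ ⟨t, ht⟩ * (ρ ⟨h, hh⟩ * ρ ⟨h, hh⟩) = ρ ⟨t, ht⟩ * 1 := by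
    rw [mul_one]
    nth_rewrite 2 [← h2]
    rw [mul_comm (ρ ⟨h, hh⟩) (ρ ⟨t, ht⟩), mul_assoc]
  exact mul_left_cancel h3

variable (h2 : (2 : k) ≠ 0)
include h2

theorem siegelN_mem_kerSubgroup (n : Matrix (Fin 2) (Fin 2) k) (hn : n.IsSymm) :
    siegelN n hn ∈ kerSubgroup ρ := by
  have hm : ((2 : k)⁻¹ • n).IsSymm := hn.smul _
  have h : siegelN n hn = siegelN _ hm * siegelN _ hm := by
    apply GSp4_ext
    rw [coe_mul]
    simp only [siegelN, fromBlocks_multiply]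
    congr 1 <;> ext i j <;> simp
    field_simp
    ring
  rw [h]
  refine mul_self_mem_kerSubgroup ρ (diagElt_mem 1 (-1)) (siegelN_mem _ _) ?_
  apply GSp4_ext
  simp only [coe_mul, siegelN, diagElt, coe_ofMatrix, fromBlocks_multiply]
  congr 1 <;> ext i j <;> fin_cases i <;> fin_cases j <;> simp [Matrix.mul_apply, Matrix.vecMul, dotProduct, Fin.sum_univ_two]

theorem upElt_mem_kerSubgroup (p : k) : upElt p ∈ kerSubgroup ρ := by
  have h : upElt p = upElt (p / 2) * upElt (p / 2) := by
    apply GSp4_ext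
    simp only [coe_mul, upElt, coe_ofMatrix, fromBlocks_multiply]
    congr 1 <;> ext i j <;> fin_cases i <;> fin_cases j <;> simp [Matrix.mul_apply, Fin.sum_univ_two] <;> field_simp <;> ring
  rw [h]
  refine mul_self_mem_kerSubgroup ρ (diagElt_mem (-1) 1) (mem_klingen_of_fix (upElt_fix _)) ?_
  apply GSp4_ext
  simp only [coe_mul, upElt, diagElt, coe_ofMatrix, fromBlocks_multiply]
  congr 1 <;> ext i j <;> fin_cases i <;> fin_cases j <;> simp [Matrix.mul_apply, Fin.sum_univ_two]

theorem lowElt_mem_kerSubgroup (C : k) (hC : 1 * 1 - 0 * C = 1) :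
    sl2Elt 1 0 C 1 hC ∈ kerSubgroup ρ := by
  have h : sl2Elt 1 0 C 1 hC = sl2Elt 1 0 (C / 2) 1 (by simp) * sl2Elt 1 0 (C / 2) 1 (by simp) := by
    apply GSp4_ext
    simp only [coe_mul, sl2Elt, coe_ofMatrix, fromBlocks_multiply]
    congr 1 <;> ext i j <;> fin_cases i <;> fin_cases j <;>
      simp [Matrix.mul_apply, Fin.sum_univ_two]
    field_simp
    ring
  rw [h]
  refine mul_self_mem_kerSubgroup ρ (diagElt_mem 1 (-1)) (mem_klingen_of_fix (sl2Elt_fix _ _ _ _ _)) ?_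
  apply GSp4_ext
  simp only [coe_mul, sl2Elt, diagElt, coe_ofMatrix, fromBlocks_multiply]
  congr 1 <;> ext i j <;> fin_cases i <;> fin_cases j <;> simp [Matrix.mul_apply, Fin.sum_univ_two]

/-- When the lower left entry is invertible, a matrix of determinant `1` is a product of an upper, a
lower and an upper unipotent matrix. -/
theorem sl2Elt_mem_kerSubgroup_of_ne_zero (A B C D : k) (h : A * D - B * C = 1) (hC : C ≠ 0) :
    sl2Elt A B C D h ∈ kerSubgroup ρ := by
  have hn : ∀ x : k, (!![0, 0; 0, x] : Matrix (Fin 2) (Fin 2) k).IsSymm := fun x => by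
    ext i j; fin_cases i <;> fin_cases j <;> simp [Matrix.mul_apply, Fin.sum_univ_two]
  have H : sl2Elt A B C D h = siegelN _ (hn ((A - 1) / C)) * sl2Elt 1 0 C 1 (by simp) *
      siegelN _ (hn ((D - 1) / C)) := by
    apply GSp4_ext
    simp only [coe_mul, sl2Elt, siegelN, coe_ofMatrix, fromBlocks_multiply]
    congr 1 <;> ext i j <;> fin_cases i <;> fin_cases j <;> simp [Matrix.mul_apply, Fin.sum_univ_two] <;> field_simp <;>
      first | ring1 | linear_combination h | linear_combination -h
  rw [H]
  exact mul_mem (mul_mem (siegelN_mem_kerSubgroup ρ h2 _ _) (lowElt_mem_kerSubgroup ρ h2 _ _))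
    (siegelN_mem_kerSubgroup ρ h2 _ _)

theorem sl2Elt_mem_kerSubgroup (A B C D : k) (h : A * D - B * C = 1) :
    sl2Elt A B C D h ∈ kerSubgroup ρ := by
  by_cases hC : C = 0
  · subst hC
    have hA : A ≠ 0 := by rintro rfl; simp at h
    have h' : A * (B + D) - B * A = 1 := by linear_combination h
    -- A lower unipotent factor replaces the zero entry by `A`, which is nonzero, and reduces to the
    -- previous case.
    have H : sl2Elt A B 0 D h = sl2Elt 1 0 (-1) 1 (by simp) * sl2Elt A B A (B + D) h' := by
      apply GSp4_ext
      simp only [coe_mul, sl2Elt, coe_ofMatrix, fromBlocks_multiply]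
      congr 1 <;> ext i j <;> fin_cases i <;> fin_cases j <;> simp [Matrix.mul_apply, Fin.sum_univ_two]
    rw [H]
    exact mul_mem (lowElt_mem_kerSubgroup ρ h2 _ _)
      (sl2Elt_mem_kerSubgroup_of_ne_zero ρ h2 _ _ _ _ _ hA)
  · exact sl2Elt_mem_kerSubgroup_of_ne_zero ρ h2 _ _ _ _ h hC

/-- Such a `g` is a product of an element of `N`, a unipotent `upElt` and an element of `SL₂` acting
on the span of `e₂` and `e₄`. Each factor lies in the kernel of every character. -/
theorem mem_kerSubgroup_of_fix (g : GSp4 k) (hg : g.val.val *ᵥ e₁ = e₁) (hs : similitude g = 1) :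
    g ∈ kerSubgroup ρ := by
  have hrel := similitude_spec g
  rw [hs, one_smul] at hrel
  have hcol : ∀ i, g.val.val i (Sum.inl 0) = e₁ i := fun i => by
    have := congrFun hg i
    simpa using this
  have c1 := hcol (Sum.inl 0)
  have c2 := hcol (Sum.inl 1)
  have c3 := hcol (Sum.inr 0)
  have c4 := hcol (Sum.inr 1)
  have entry := fun i j => congrFun (congrFun hrel i) j
  have r12 := entry (Sum.inl 0) (Sum.inl 1)
  have r13 := entry (Sum.inl 0) (Sum.inr 0)
  have r14 := entry (Sum.inl 0) (Sum.inr 1)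
  have r23 := entry (Sum.inl 1) (Sum.inr 0)
  have r24 := entry (Sum.inl 1) (Sum.inr 1)
  have r34 := entry (Sum.inr 0) (Sum.inr 1)
  simp only [Sum.inl.injEq, Pi.single_eq_same, ne_eq, reduceCtorEq, not_false_eq_true,
    Pi.single_eq_of_ne, one_ne_zero] at c1 c2 c3 c4
  simp [Matrix.mul_apply, J, Fintype.sum_sum_type, Matrix.one_apply, c1, c2, c3, c4]
    at r12 r13 r14 r23 r24 r34
  simp only [r12, r13, r14, zero_mul, mul_zero, mul_one, zero_add, neg_zero, add_zero] at r23 r24 r34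
  set p := g.val.val (Sum.inl 0) (Sum.inl 1)
  set A := g.val.val (Sum.inl 1) (Sum.inl 1)
  set C := g.val.val (Sum.inr 1) (Sum.inl 1)
  set z := g.val.val (Sum.inl 0) (Sum.inr 0)
  set y := g.val.val (Sum.inl 1) (Sum.inr 0)
  set x := g.val.val (Sum.inr 1) (Sum.inr 0)
  set r := g.val.val (Sum.inl 0) (Sum.inr 1)
  set B := g.val.val (Sum.inl 1) (Sum.inr 1)
  set D := g.val.val (Sum.inr 1) (Sum.inr 1)
  -- The entries of `n` are read off from the third column of `g`; the term `y * x` corrects for the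
  -- product with `upElt (-x)`.
  have hn : (!![z - y * x, y; y, 0] : Matrix (Fin 2) (Fin 2) k).IsSymm := by
    ext i j; fin_cases i <;> fin_cases j <;> simp
  have hdet : A * D - B * C = 1 := by linear_combination -r24
  have H : g = siegelN _ hn * upElt (-x) * sl2Elt A B C D hdet := by
    apply GSp4_ext
    rw [← fromBlocks_toBlocks g.val.val]
    simp only [coe_mul, sl2Elt, siegelN, upElt, coe_ofMatrix, fromBlocks_multiply]
    congr 1 <;> ext i j <;> fin_cases i <;> fin_cases j <;>
      simp [Matrix.mul_apply, Fin.sum_univ_two, Matrix.toBlocks₁₁, Matrix.toBlocks₁₂,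
        Matrix.toBlocks₂₁, Matrix.toBlocks₂₂, c1, c2, c3, c4, r12, r13, r14]
    all_goals first | rfl | linear_combination -r23 | linear_combination r34
  rw [H]
  exact mul_mem (mul_mem (siegelN_mem_kerSubgroup ρ h2 _ _) (upElt_mem_kerSubgroup ρ h2 _))
    (sl2Elt_mem_kerSubgroup ρ h2 _ _ _ _ _)

end Character
end Group

/-! ### Characters of `Q`, and transitivity of `Sp₄(k)` on nonzero vectors. -/

section Group
variable {k : Type*} [Field k]

/-- Dividing `q` by the torus element with the same eigenvalue and similitude leaves a symplectic
element fixing `e₁`, on which `ρ` is trivial. -/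
theorem character_eq {A : Type*} [CommGroup A] (ρ : klingen k →* A) (h2 : (2 : k) ≠ 0)
    (q : klingen k) : ρ q = ρ (diagHom (eigenHom q, similitudeHom q.val)) := by
  set d := diagHom (eigenHom q, similitudeHom q.val) with hd
  have he : d.val.val.val *ᵥ e₁ = eigen q • e₁ := diagElt_mulVec _ _
  have hs : similitudeHom d.val = similitudeHom q.val := similitudeHom_diagElt _ _
  have hfix : (d⁻¹ * q).val.val.val *ᵥ e₁ = e₁ := by
    rw [Subgroup.coe_mul, mul_mulVec, eigen_spec, ← he, Subgroup.coe_inv, inv_mulVec_mulVec]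
  have hsim : similitude (d⁻¹ * q).val = 1 := by
    rw [← coe_similitudeHom, Subgroup.coe_mul, map_mul, Subgroup.coe_inv, map_inv, hs]
    simp
  obtain ⟨r, hr, hr'⟩ := mem_kerSubgroup_of_fix ρ h2 _ hfix hsim
  have hr'' : r = d⁻¹ * q := Subtype.ext hr'
  rw [SetLike.mem_coe, MonoidHom.mem_ker, hr'', map_mul, map_inv, inv_mul_eq_one] at hr
  exact hr.symm

/-- An element of `Sp₄(k)` whose first column is a given vector with nonzero first entry. -/
def sectionElt (a : kˣ) (b c d : k) : GSp4 k :=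
  ofMatrix (fromBlocks !![(a : k), 0; b, 1] 0 !![c, d * (a⁻¹ : kˣ); d, 0]
    !![((a⁻¹ : kˣ) : k), -b * (a⁻¹ : kˣ); 0, 1]) 1 (by
    have := a.ne_zero
    simp only [J, fromBlocks_transpose, fromBlocks_multiply, fromBlocks_smul]
    congr 1 <;> ext i j <;> fin_cases i <;> fin_cases j <;>
      simp [Matrix.mul_apply, Fin.sum_univ_two] <;> field_simp <;> ring)

theorem sectionElt_mulVec (a : kˣ) (b c d : k) :
    (sectionElt a b c d).val.val *ᵥ e₁ = Sum.elim ![(a : k), b] ![c, d] := by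
  rw [sectionElt, coe_ofMatrix]
  ext i
  rcases i with i | i <;> fin_cases i <;> simp

theorem similitudeHom_sectionElt (a : kˣ) (b c d : k) : similitudeHom (sectionElt a b c d) = 1 :=
  similitudeHom_ofMatrix _

theorem sectionElt_one : sectionElt (1 : kˣ) 0 0 0 = 1 := by
  apply GSp4_ext
  rw [sectionElt, coe_ofMatrix, coe_one, ← fromBlocks_one]
  congr 1 <;> ext i j <;> fin_cases i <;> fin_cases j <;> simp

theorem exists_mulVec_eq_of_fst_ne_zero (v : Fin 2 ⊕ Fin 2 → k) (hv : v (Sum.inl 0) ≠ 0) :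
    ∃ x : GSp4 k, similitudeHom x = 1 ∧ x.val.val *ᵥ e₁ = v := by
  refine ⟨sectionElt (Units.mk0 _ hv) (v (Sum.inl 1)) (v (Sum.inr 0)) (v (Sum.inr 1)),
    similitudeHom_sectionElt _ _ _ _, ?_⟩
  rw [sectionElt_mulVec]
  ext i
  rcases i with i | i <;> fin_cases i <;> simp

/-- The Weyl element permuting `e₁, e₂` and `e₃, e₄`. -/
def weylSwap : GSp4 k :=
  ofMatrix (fromBlocks !![0, -1; 1, 0] 0 0 !![0, -1; 1, 0]) 1 (by
    simp only [J, fromBlocks_transpose, fromBlocks_multiply, fromBlocks_smul]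
    congr 1 <;> ext i j <;> fin_cases i <;> fin_cases j <;>
      simp [Matrix.mul_apply, Fin.sum_univ_two])

/-- The Weyl element exchanging the two Lagrangians. -/
def weylJ : GSp4 k := ofMatrix (J (Fin 2) k) 1 (by
  rw [J_transpose, Matrix.neg_mul, J_squared]; simp)

/-- `Sp₄(k)` acts transitively on the nonzero vectors. -/
theorem exists_mulVec_eq (v : Fin 2 ⊕ Fin 2 → k) (hv : v ≠ 0) :
    ∃ x : GSp4 k, similitudeHom x = 1 ∧ x.val.val *ᵥ e₁ = v := by
  -- The statement can be transported along an element of `Sp₄(k)`. The two Weyl elements then bring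
  -- a nonzero coordinate of `v` into the first position, where `sectionElt` applies.
  have step : ∀ (g : GSp4 k) (v : Fin 2 ⊕ Fin 2 → k), similitudeHom g = 1 →
      (∃ x : GSp4 k, similitudeHom x = 1 ∧ x.val.val *ᵥ e₁ = g.val.val *ᵥ v) →
      ∃ x : GSp4 k, similitudeHom x = 1 ∧ x.val.val *ᵥ e₁ = v := by
    rintro g v hg ⟨x, hx, hxv⟩
    refine ⟨g⁻¹ * x, by rw [map_mul, map_inv, hg, hx]; simp, ?_⟩
    rw [mul_mulVec, hxv, inv_mulVec_mulVec]
  have hS : similitudeHom (weylSwap : GSp4 k) = 1 := similitudeHom_ofMatrix _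
  have hJ : similitudeHom (weylJ : GSp4 k) = 1 := similitudeHom_ofMatrix _
  have swap_fst : ∀ v : Fin 2 ⊕ Fin 2 → k,
      ((weylSwap : GSp4 k).val.val *ᵥ v) (Sum.inl 0) = -v (Sum.inl 1) := fun v => by
    rw [weylSwap, coe_ofMatrix]
    simp [Matrix.mulVec, dotProduct, Fintype.sum_sum_type]
  have J_apply : ∀ (v : Fin 2 ⊕ Fin 2 → k) i,
      ((weylJ : GSp4 k).val.val *ᵥ v) (Sum.inl i) = -v (Sum.inr i) := fun v i => by
    rw [weylJ, coe_ofMatrix]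
    simp [Matrix.mulVec, dotProduct, Fintype.sum_sum_type, J, Matrix.one_apply]
  have hl : ∀ v : Fin 2 ⊕ Fin 2 → k, (∃ i, v (Sum.inl i) ≠ 0) →
      ∃ x : GSp4 k, similitudeHom x = 1 ∧ x.val.val *ᵥ e₁ = v := by
    rintro v ⟨i, hi⟩
    fin_cases i
    · exact exists_mulVec_eq_of_fst_ne_zero v hi
    · refine step weylSwap v hS (exists_mulVec_eq_of_fst_ne_zero _ ?_)
      rw [swap_fst]
      simpa using hi
  obtain ⟨i, hi⟩ := Function.ne_iff.mp hv
  rcases i with i | i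
  · exact hl v ⟨i, hi⟩
  · refine step weylJ v hJ (hl _ ⟨i, ?_⟩)
    rw [J_apply]
    simpa using hi

end Group

/-! ### Continuity of the explicit elements, and openness of orbit maps. -/

section Topology
variable {k : Type*} [Field k] [TopologicalSpace k] [IsTopologicalDivisionRing k]

theorem continuous_ofMatrix {X : Type*} [TopologicalSpace X]
    {M : X → Matrix (Fin 2 ⊕ Fin 2) (Fin 2 ⊕ Fin 2) k} (hM : Continuous M) {c : X → kˣ}
    (hc : Continuous c) (h : ∀ x, (M x)ᵀ * J (Fin 2) k * M x = (c x : k) • J (Fin 2) k) :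
    Continuous fun x => ofMatrix (M x) (c x) (h x) := by
  have hval : Continuous fun x => (ofMatrix (M x) (c x) (h x)).val := by
    refine Units.continuous_iff.mpr ⟨hM, ?_⟩
    have hc' : Continuous fun x => (((c x)⁻¹ : kˣ) : k) := Units.continuous_val.comp hc.inv
    change Continuous fun x => (-((c x)⁻¹ : kˣ) : k) • (J (Fin 2) k * (M x)ᵀ * J (Fin 2) k)
    exact hc'.neg.smul
      ((continuous_const.matrix_mul hM.matrix_transpose).matrix_mul continuous_const)
  exact hval.subtype_mk _

theorem continuous_sectionElt :
    Continuous fun p : kˣ × k × k × k => sectionElt p.1 p.2.1 p.2.2.1 p.2.2.2 := by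
  refine continuous_ofMatrix (c := fun _ => 1) ?_ continuous_const _
  have h1 : Continuous fun p : kˣ × k × k × k => (p.1 : k) :=
    Units.continuous_val.comp continuous_fst
  have h2 : Continuous fun p : kˣ × k × k × k => ((p.1⁻¹ : kˣ) : k) :=
    Units.continuous_val.comp continuous_fst.inv
  refine Continuous.matrix_fromBlocks ?_ continuous_const ?_ ?_ <;>
    refine continuous_matrix fun i j => ?_ <;> fin_cases i <;> fin_cases j
  all_goals first
    | exact h1
    | exact h2
    | exact continuous_const
    | exact continuous_snd.fst
    | exact continuous_snd.snd.fst
    | exact continuous_snd.snd.snd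
    | exact continuous_snd.snd.snd.mul h2
    | exact continuous_snd.fst.neg.mul h2

theorem continuous_diagElt : Continuous fun p : kˣ × kˣ => diagElt p.1 p.2 := by
  refine continuous_ofMatrix ?_ continuous_snd _
  have h1 : Continuous fun p : kˣ × kˣ => (p.1 : k) := Units.continuous_val.comp continuous_fst
  have h2 : Continuous fun p : kˣ × kˣ => (p.2 : k) := Units.continuous_val.comp continuous_snd
  have h3 : Continuous fun p : kˣ × kˣ => ((p.2 * p.1⁻¹ : kˣ) : k) :=
    Units.continuous_val.comp (continuous_snd.mul continuous_fst.inv)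
  refine Continuous.matrix_fromBlocks ?_ continuous_const continuous_const ?_ <;>
    refine continuous_matrix fun i j => ?_ <;> fin_cases i <;> fin_cases j
  all_goals first | exact h1 | exact h2 | exact h3 | exact continuous_const

theorem continuous_diagHom : Continuous (diagHom (k := k)) :=
  continuous_diagElt.subtype_mk _

theorem continuous_similitudeHom : Continuous (similitudeHom (k := k)) := by
  have hval : Continuous fun g : GSp4 k => g.val.val :=
    Units.continuous_val.comp continuous_subtype_val
  refine Units.isEmbedding_val₀.continuous_iff.mpr ?_
  change Continuous fun g : GSp4 k => similitude g
  unfold similitude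
  exact (((hval.matrix_transpose).matrix_mul continuous_const).matrix_mul hval).matrix_elem _ _

theorem continuous_mulVec_pair :
    Continuous fun p : GSp4 k × (Fin 2 ⊕ Fin 2 → k) => p.1.val.val *ᵥ p.2 := by
  have hval : Continuous fun p : GSp4 k × (Fin 2 ⊕ Fin 2 → k) => p.1.val.val :=
    Units.continuous_val.comp (continuous_subtype_val.comp continuous_fst)
  exact hval.matrix_mulVec continuous_snd

theorem continuous_mulVec_right (g : GSp4 k) :
    Continuous fun v : Fin 2 ⊕ Fin 2 → k => g.val.val *ᵥ v :=
  continuous_mulVec_pair.comp (by fun_prop : Continuous fun v => (g, v))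

/-- Near `e₁` the first coordinate is nonzero, and there `sectionElt` is a continuous section of the
orbit map, with value `1` at `e₁`. -/
theorem eventually_exists_mulVec_e₁ [T2Space k] {U : Set (GSp4 k)} (hU : U ∈ 𝓝 1) :
    ∀ᶠ v in 𝓝 (e₁ : Fin 2 ⊕ Fin 2 → k), ∃ u ∈ U, similitudeHom u = 1 ∧ u.val.val *ᵥ e₁ = v := by
  classical
  let toUnit : k → kˣ := fun x => if h : x ≠ 0 then Units.mk0 x h else 1
  have h1 : Tendsto toUnit (𝓝 1) (𝓝 1) := by
    rw [Units.isEmbedding_val₀.tendsto_nhds_iff]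
    refine Tendsto.congr' ?_ tendsto_id
    have h : ∀ᶠ x in 𝓝 (1 : k), x ≠ 0 := eventually_ne_nhds one_ne_zero
    filter_upwards [h] with x hx
    simp [toUnit, hx]
  let F : (Fin 2 ⊕ Fin 2 → k) → kˣ × k × k × k :=
    fun v => (toUnit (v (Sum.inl 0)), v (Sum.inl 1), v (Sum.inr 0), v (Sum.inr 1))
  have hF : Tendsto F (𝓝 e₁) (𝓝 (1, 0, 0, 0)) := by
    have hc : ∀ i, Tendsto (fun v : Fin 2 ⊕ Fin 2 → k => v i) (𝓝 e₁) (𝓝 (e₁ i)) :=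
      fun i => (continuous_apply i).tendsto _
    refine Tendsto.prodMk_nhds (h1.comp ?_) (Tendsto.prodMk_nhds ?_ (Tendsto.prodMk_nhds ?_ ?_))
    · simpa using hc (Sum.inl 0)
    · simpa using hc (Sum.inl 1)
    · simpa using hc (Sum.inr 0)
    · simpa using hc (Sum.inr 1)
  have hs := (continuous_sectionElt (k := k)).tendsto (1, 0, 0, 0)
  simp only [sectionElt_one] at hs
  have hne : ∀ᶠ v in 𝓝 (e₁ : Fin 2 ⊕ Fin 2 → k), v (Sum.inl 0) ≠ 0 :=
    ((continuous_apply (Sum.inl 0)).tendsto _).eventually_ne (by simp)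
  filter_upwards [(hs.comp hF) hU, hne] with v hv hv0
  refine ⟨_, hv, similitudeHom_sectionElt _ _ _ _, ?_⟩
  rw [Function.comp_apply, sectionElt_mulVec]
  ext i
  rcases i with i | i <;> fin_cases i <;> simp [F, toUnit, hv0]

/-- Orbit maps on nonzero vectors are open. -/
theorem eventually_exists_mulVec [T2Space k] {U : Set (GSp4 k)} (hU : U ∈ 𝓝 1) {v₀ : Fin 2 ⊕ Fin 2 → k}
    (hv₀ : v₀ ≠ 0) :
    ∀ᶠ v in 𝓝 v₀, ∃ u ∈ U, similitudeHom u = 1 ∧ u.val.val *ᵥ v₀ = v := by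
  obtain ⟨x, hx, rfl⟩ := exists_mulVec_eq v₀ hv₀
  have hU' : (fun u : GSp4 k => x * u * x⁻¹) ⁻¹' U ∈ 𝓝 1 := by
    have hc : Continuous fun u : GSp4 k => x * u * x⁻¹ := by fun_prop
    refine hc.continuousAt ?_
    simpa using hU
  have ht : Tendsto (fun v => (x⁻¹).val.val *ᵥ v) (𝓝 (x.val.val *ᵥ e₁)) (𝓝 e₁) := by
    have := (continuous_mulVec_right x⁻¹).tendsto (x.val.val *ᵥ e₁)
    rwa [inv_mulVec_mulVec] at this
  filter_upwards [ht (eventually_exists_mulVec_e₁ hU')] with v hv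
  obtain ⟨u, hu, hu1, hu2⟩ := hv
  refine ⟨x * u * x⁻¹, hu, by simp [hu1], ?_⟩
  rw [mul_mulVec, mul_mulVec, inv_mulVec_mulVec, hu2, mulVec_inv_mulVec]

end Topology

/-! ### Compactness of the unit sphere, and normalization of vectors by a maximal coordinate. -/

section Sphere
variable {k : Type*} [Field k] [ValuativeRel k] [TopologicalSpace k]
  [IsNonarchimedeanLocalField k] {ι : Type*}

/-- The vectors whose coordinates have maximal absolute value `1`. -/
def unitSphere (k ι : Type*) [Field k] [ValuativeRel k] : Set (ι → k) :=
  {v | (∀ l, valuation k (v l) ≤ 1) ∧ ∃ l, valuation k (v l) = 1}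

theorem isCompact_unitSphere [Finite ι] : IsCompact (unitSphere k ι) := by
  obtain ⟨ϖ, -, hϖ⟩ := exists_valuation_uniformizer (k := k)
  have hcl : IsClosed {x : k | valuation k x = 1} := by
    have h := (isClopen_ball (one_ne_zero (α := k))).diff (isClopen_ball ϖ.ne_zero)
    convert! h.isClosed using 1
    ext x
    have : valuation k x = 1 ↔ valuation k x ≤ valuation k 1 ∧ ¬ valuation k x ≤ valuation k ϖ := by
      rw [← hϖ, not_lt, map_one]
      exact le_antisymm_iff
    exact this
  have hU : IsClosed (⋃ l : ι, {v : ι → k | valuation k (v l) = 1}) :=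
    isClosed_iUnion_of_finite fun l =>
      hcl.preimage (continuous_apply l : Continuous fun v : ι → k => v l)
  convert! (isCompact_polyball (ι := ι) (1 : k)).inter_right hU using 1
  ext v
  simp [unitSphere, mem_polyball]

omit [TopologicalSpace k] [IsNonarchimedeanLocalField k] in
theorem exists_max_coord [Finite ι] {v : ι → k} (hv : v ≠ 0) :
    ∃ j, v j ≠ 0 ∧ ∀ l, valuation k (v l) ≤ valuation k (v j) := by
  obtain ⟨i, hi⟩ := Function.ne_iff.mp hv
  have : Nonempty ι := ⟨i⟩
  obtain ⟨j, hj⟩ := Finite.exists_max fun l => valuation k (v l)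
  refine ⟨j, fun h => hi ?_, hj⟩
  have := hj i
  rw [h, map_zero] at this
  simpa using this

omit [TopologicalSpace k] [IsNonarchimedeanLocalField k] in
theorem inv_smul_mem_unitSphere {v : ι → k} {j : ι} (hj : v j ≠ 0)
    (hmax : ∀ l, valuation k (v l) ≤ valuation k (v j)) : (v j)⁻¹ • v ∈ unitSphere k ι := by
  have hpos : 0 < valuation k (v j) := by simpa [zero_lt_iff] using hj
  refine ⟨fun l => ?_, j, by simp [hj]⟩
  rw [Pi.smul_apply, smul_eq_mul, map_mul, map_inv₀, inv_mul_le_iff₀ hpos, mul_one]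
  exact hmax l

omit [TopologicalSpace k] [IsNonarchimedeanLocalField k] in
theorem ne_zero_of_mem_unitSphere {v : ι → k} (hv : v ∈ unitSphere k ι) : v ≠ 0 := by
  rintro rfl
  obtain ⟨-, l, hl⟩ := hv
  simp at hl

end Sphere

/-! ### The induced representation as homogeneous functions on `k⁴` without the origin. -/

section Model
variable {k : Type*} [Field k] [ValuativeRel k] [TopologicalSpace k]
  [IsNonarchimedeanLocalField k] (ρ : klingen k →ₜ* ℂˣ)

/-- The character `δ_Q^{1/2} ρ`, as a function of the eigenvalue on `e₁` and the similitude. -/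
def twist : kˣ × kˣ →* ℂˣ where
  toFun p := absHom (p.1 ^ 2 * p.2⁻¹) * ρ (diagHom p)
  map_one' := by simp
  map_mul' p q := by
    simp only [Prod.fst_mul, Prod.snd_mul, map_mul, mul_pow, mul_inv]
    ac_rfl

theorem eventually_twist_one_right : ∀ᶠ c in 𝓝 (1 : kˣ), twist ρ (1, c) = 1 := by
  let χ : kˣ →* ℂˣ := (ρ : klingen k →* ℂˣ).comp (diagHom.comp (MonoidHom.inr kˣ kˣ))
  have hχ : Continuous χ := (ρ.continuous_toFun.comp continuous_diagHom).comp
    (by fun_prop : Continuous fun c : kˣ => ((1 : kˣ), c))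
  filter_upwards [eventually_character_eq_one χ hχ, eventually_absHom_eq_one] with c h1 h2
  have h1' : ρ (diagHom (1, c)) = 1 := h1
  simp [twist, h1', h2]

theorem eventually_twist_one_left : ∀ᶠ c in 𝓝 (1 : kˣ), twist ρ (c, 1) = 1 := by
  let χ : kˣ →* ℂˣ := (ρ : klingen k →* ℂˣ).comp (diagHom.comp (MonoidHom.inl kˣ kˣ))
  have hχ : Continuous χ := (ρ.continuous_toFun.comp continuous_diagHom).comp
    (by fun_prop : Continuous fun c : kˣ => (c, (1 : kˣ)))
  filter_upwards [eventually_character_eq_one χ hχ, eventually_absHom_eq_one] with c h1 h2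
  have h1' : ρ (diagHom (c, 1)) = 1 := h1
  simp [twist, h1', h2]

variable {ρ} (h2 : (2 : k) ≠ 0)

include h2 in
theorem coe_twist_klingen (q : klingen k) :
    (twist ρ (eigenHom q, similitudeHom q.val) : ℂ) = (sqrtModulus q : ℂ) * (ρ q : ℂ) := by
  have h := character_eq (ρ : klingen k →* ℂˣ) h2 q
  have h' : ρ q = ρ (diagHom (eigenHom q, similitudeHom q.val)) := h
  simp only [twist, MonoidHom.coe_mk, OneHom.coe_mk, Units.val_mul, absHom_apply, ← h']
  congr 2
  rw [sqrtModulus, Units.val_pow_eq_pow_val, Units.val_inv_eq_inv_val, coe_eigenHom,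
    coe_similitudeHom, div_eq_mul_inv, eigen]

include h2 in
theorem apply_klingen_mul (f : inducedSpace ρ) (q : klingen k) (g : GSp4 k) :
    f.val (q.val * g) = twist ρ (eigenHom q, similitudeHom q.val) * f.val g := by
  rw [f.property.1 q g, coe_twist_klingen h2]

open scoped Classical in
/-- The homogeneous function on `k⁴` attached to an element of the induced representation. -/
def homogFun : inducedSpace ρ →ₗ[ℂ] (Fin 2 ⊕ Fin 2 → k) → ℂ where
  -- The choice of the element of `Sp₄(k)` does not matter, by `apply_inv`; the value at the origin
  -- is a convention.
  toFun f v := if h : v ≠ 0 then f.val (Classical.choose (exists_mulVec_eq v h))⁻¹ else 0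
  map_add' f g := by
    ext v
    by_cases h : v = 0 <;> simp [h]
  map_smul' c f := by
    ext v
    by_cases h : v = 0 <;> simp [h]

include h2

/-- Two elements carrying `e₁` to the same vector differ by an element of `Q` of eigenvalue `1`,
whose effect on `f` depends only on its similitude. So `f` and `homogFun f` determine each other. -/
theorem apply_inv (f : inducedSpace ρ) (x : GSp4 k) :
    f.val x⁻¹ = twist ρ (1, (similitudeHom x)⁻¹) * homogFun f (x.val.val *ᵥ e₁) := by
  have hne := mulVec_ne_zero x e₁_ne_zero
  obtain ⟨hy, hyv⟩ := Classical.choose_spec (exists_mulVec_eq _ hne)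
  set y := Classical.choose (exists_mulVec_eq _ hne) with hydef
  have hφ : homogFun f (x.val.val *ᵥ e₁) = f.val y⁻¹ := by
    simp only [homogFun, LinearMap.coe_mk, AddHom.coe_mk, dif_pos hne]
    rfl
  have hfix : (x⁻¹ * y).val.val *ᵥ e₁ = e₁ := by rw [mul_mulVec, hyv, inv_mulVec_mulVec]
  have h := apply_klingen_mul h2 f ⟨x⁻¹ * y, mem_klingen_of_fix hfix⟩ y⁻¹
  have he : eigenHom (⟨x⁻¹ * y, mem_klingen_of_fix hfix⟩ : klingen k) = 1 :=
    eigenHom_eq (by rw [Units.val_one, one_smul]; exact hfix)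
  rw [he] at h
  simp only [map_mul, map_inv, hy, mul_one, mul_inv_cancel_right] at h
  rw [hφ, ← h]

omit h2 in
theorem homogFun_zero (f : inducedSpace ρ) : homogFun f 0 = 0 := by simp [homogFun]

theorem homogFun_mulVec (f : inducedSpace ρ) (x : GSp4 k) :
    homogFun f (x.val.val *ᵥ e₁) = twist ρ (1, similitudeHom x) * f.val x⁻¹ := by
  have h1 : ((1 : kˣ), similitudeHom x) * (1, (similitudeHom x)⁻¹) = 1 := by simp
  rw [apply_inv h2, ← mul_assoc, ← Units.val_mul, ← map_mul, h1, map_one, Units.val_one, one_mul]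

theorem homogFun_smul (f : inducedSpace ρ) (c : kˣ) (v : Fin 2 ⊕ Fin 2 → k) :
    homogFun f ((c : k) • v) = twist ρ (c⁻¹, 1) * homogFun f v := by
  by_cases hv : v = 0
  · simp [hv, homogFun_zero]
  obtain ⟨x, hx, rfl⟩ := exists_mulVec_eq v hv
  have h1 : (c : k) • (x.val.val *ᵥ e₁) = (x * diagElt c 1).val.val *ᵥ e₁ := by
    rw [mul_mulVec, diagElt_mulVec, Matrix.mulVec_smul]
  have h3 : (x * diagElt c 1)⁻¹ = (diagHom (c⁻¹, 1)).val * x⁻¹ := by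
    have : (c⁻¹, (1 : kˣ)) = (c, 1)⁻¹ := by simp
    rw [_root_.mul_inv_rev, this, map_inv]
    rfl
  have h4 : similitudeHom (diagHom (c⁻¹, (1 : kˣ))).val = 1 := similitudeHom_diagElt _ _
  have h5 : eigenHom (diagHom (c⁻¹, (1 : kˣ))) = c⁻¹ := eigenHom_eq (diagElt_mulVec _ _)
  rw [h1, homogFun_mulVec h2, homogFun_mulVec h2, h3, apply_klingen_mul h2, h4, h5, map_mul, hx,
    similitudeHom_diagElt]
  simp only [mul_one]
  ring

theorem homogFun_rep (f : inducedSpace ρ) (g : GSp4 k) (v : Fin 2 ⊕ Fin 2 → k) :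
    homogFun (inducedRep ρ g f) v =
      twist ρ (1, similitudeHom g) * homogFun f ((g⁻¹).val.val *ᵥ v) := by
  by_cases hv : v = 0
  · simp [hv, homogFun_zero]
  obtain ⟨x, hx, rfl⟩ := exists_mulVec_eq v hv
  rw [← mul_mulVec, homogFun_mulVec h2, homogFun_mulVec h2, hx, map_mul similitudeHom, hx]
  have h1 : (inducedRep ρ g f).val x⁻¹ = f.val (x⁻¹ * g) := rfl
  rw [h1, _root_.mul_inv_rev, inv_inv, ← mul_assoc, ← Units.val_mul, ← map_mul]
  have h3 : ((1 : kˣ), similitudeHom g) * (1, similitudeHom g⁻¹ * 1) = 1 := by simp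
  have h4 : ((1 : kˣ), (1 : kˣ)) = 1 := rfl
  rw [h3, h4, map_one]

theorem eq_zero_of_homogFun_eq_zero (f : inducedSpace ρ) (h : homogFun f = 0) : f = 0 := by
  ext g
  have := apply_inv h2 f g⁻¹
  rw [inv_inv, h] at this
  simpa using this

theorem eventually_homogFun_eq (f : inducedSpace ρ) {v : Fin 2 ⊕ Fin 2 → k} (hv : v ≠ 0) :
    ∀ᶠ v' in 𝓝 v, homogFun f v' = homogFun f v := by
  obtain ⟨U, hU⟩ := f.property.2
  obtain ⟨x, hx, rfl⟩ := exists_mulVec_eq v hv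
  filter_upwards [eventually_exists_mulVec U.mem_nhds_one hv] with v' hv'
  obtain ⟨u, hu, hu1, rfl⟩ := hv'
  rw [← mul_mulVec, homogFun_mulVec h2, homogFun_mulVec h2, map_mul similitudeHom, hu1, hx,
    _root_.mul_inv_rev, hU _ (U.inv_mem hu), one_mul]

/-- Elements of the induced representation are uniformly locally constant. -/
theorem exists_homogFun_add_eq (f : inducedSpace ρ) : ∃ r : k, r ≠ 0 ∧
    ∀ (v v' : Fin 2 ⊕ Fin 2 → k) (j : Fin 2 ⊕ Fin 2), v j ≠ 0 →
      (∀ l, valuation k (v' l) ≤ valuation k (r * v j)) → homogFun f (v + v') = homogFun f v := by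
  -- Local constancy is made uniform on the compact sphere, and homogeneity then extends it to all
  -- nonzero vectors, with a radius proportional to the size of the vector.
  have hev : ∀ᶠ v' in 𝓝 (0 : Fin 2 ⊕ Fin 2 → k), ∀ v ∈ unitSphere k (Fin 2 ⊕ Fin 2),
      homogFun f (v + v') = homogFun f v := by
    refine isCompact_unitSphere.eventually_forall_of_forall_eventually fun v hv => ?_
    have h := eventually_homogFun_eq h2 f (ne_zero_of_mem_unitSphere hv)
    have h1 : Tendsto (fun z : (Fin 2 ⊕ Fin 2 → k) × (Fin 2 ⊕ Fin 2 → k) => z.2 + z.1)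
        (𝓝 (0, v)) (𝓝 v) := by
      have hc : Continuous fun z : (Fin 2 ⊕ Fin 2 → k) × (Fin 2 ⊕ Fin 2 → k) => z.2 + z.1 := by
        fun_prop
      simpa using hc.tendsto (0, v)
    have h3 : Tendsto (fun z : (Fin 2 ⊕ Fin 2 → k) × (Fin 2 ⊕ Fin 2 → k) => z.2)
        (𝓝 (0, v)) (𝓝 v) := continuous_snd.tendsto (0, v)
    filter_upwards [h1.eventually h, h3.eventually h] with z hz1 hz2
    rw [hz1, hz2]
  obtain ⟨r, hr, hr'⟩ := exists_polyball_subset hev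
  refine ⟨r, hr, fun v v' j hj hv' => ?_⟩
  obtain ⟨i, hi, hmax⟩ := exists_max_coord (v := v) (fun h => hj (by rw [h]; rfl))
  have hpos : 0 < valuation k (v i) := by simpa [zero_lt_iff] using hi
  have hmem : (v i)⁻¹ • v' ∈ polyball (Fin 2 ⊕ Fin 2) r := by
    intro l
    rw [Pi.smul_apply, smul_eq_mul, map_mul, map_inv₀, inv_mul_le_iff₀ hpos, mul_comm, ← map_mul]
    refine (hv' l).trans ?_
    rw [map_mul, map_mul]
    exact mul_le_mul_right (hmax j) _
  have h := hr' hmem _ (inv_smul_mem_unitSphere hi hmax)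
  set c : kˣ := Units.mk0 (v i) hi with hc
  have hs : ∀ w, homogFun f ((v i)⁻¹ • w) = twist ρ (c, 1) * homogFun f w := fun w => by
    have := homogFun_smul h2 f c⁻¹ w
    rwa [inv_inv] at this
  rw [← smul_add, hs, hs] at h
  exact mul_left_cancel₀ (Units.ne_zero _) h

omit h2 in
/-- A homogeneous locally constant function on `k⁴` without the origin defines an element of the
induced representation. -/
theorem exists_homogFun_eq (φ : (Fin 2 ⊕ Fin 2 → k) → ℂ)
    (hloc : ∀ v, v ≠ 0 → ∀ᶠ v' in 𝓝 v, φ v' = φ v)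
    (hhom : ∀ (c : kˣ) (v : Fin 2 ⊕ Fin 2 → k), φ ((c : k) • v) = twist ρ (c⁻¹, 1) * φ v)
    (h2 : (2 : k) ≠ 0) :
    ∃ f : inducedSpace ρ, ∀ v, v ≠ 0 → homogFun f v = φ v := by
  -- The stabilizer of `φ`, restricted to similitudes where the character is trivial. It is open, by
  -- compactness of the sphere and homogeneity, and this gives smoothness of the function `F` below.
  let S : Subgroup (GSp4 k) :=
    { carrier := {u | (∀ v, φ (u.val.val *ᵥ v) = φ v) ∧ twist ρ (1, similitudeHom u) = 1}
      one_mem' := by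
        refine ⟨fun v => by rw [coe_one, Matrix.one_mulVec], ?_⟩
        rw [map_one]
        exact map_one _
      mul_mem' := by
        rintro a b ⟨ha, ha'⟩ ⟨hb, hb'⟩
        refine ⟨fun v => by rw [mul_mulVec, ha, hb], ?_⟩
        have : ((1 : kˣ), similitudeHom (a * b)) = (1, similitudeHom a) * (1, similitudeHom b) := by
          simp
        rw [this, map_mul, ha', hb', one_mul]
      inv_mem' := by
        rintro a ⟨ha, ha'⟩
        refine ⟨fun v => by rw [← ha, mulVec_inv_mulVec], ?_⟩
        have : ((1 : kˣ), similitudeHom a⁻¹) = (1, similitudeHom a)⁻¹ := by simp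
        rw [this, map_inv, ha', inv_one] }
  have hS : (S : Set (GSp4 k)) ∈ 𝓝 1 := by
    have h1 : ∀ᶠ u in 𝓝 (1 : GSp4 k), twist ρ (1, similitudeHom u) = 1 := by
      have := (continuous_similitudeHom (k := k)).tendsto 1
      rw [map_one] at this
      exact this.eventually (eventually_twist_one_right ρ)
    have h3 : ∀ᶠ u in 𝓝 (1 : GSp4 k), ∀ v ∈ unitSphere k (Fin 2 ⊕ Fin 2),
        φ (u.val.val *ᵥ v) = φ v := by
      refine isCompact_unitSphere.eventually_forall_of_forall_eventually fun v hv => ?_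
      have h := hloc v (ne_zero_of_mem_unitSphere hv)
      have h4 : Tendsto (fun z : GSp4 k × (Fin 2 ⊕ Fin 2 → k) => z.1.val.val *ᵥ z.2)
          (𝓝 (1, v)) (𝓝 v) := by
        have := (continuous_mulVec_pair (k := k)).tendsto (1, v)
        simpa [coe_one] using this
      have h5 : Tendsto (fun z : GSp4 k × (Fin 2 ⊕ Fin 2 → k) => z.2)
          (𝓝 (1, v)) (𝓝 v) := continuous_snd.tendsto (1, v)
      filter_upwards [h4.eventually h, h5.eventually h] with z hz1 hz2
      rw [hz1, hz2]
    filter_upwards [h1, h3] with u hu1 hu3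
    refine ⟨fun v => ?_, hu1⟩
    by_cases hv : v = 0
    · simp [hv]
    obtain ⟨i, hi, hmax⟩ := exists_max_coord hv
    have h := hu3 _ (inv_smul_mem_unitSphere hi hmax)
    have hs := hhom (Units.mk0 (v i) hi)⁻¹
    simp only [Units.val_inv_eq_inv_val, Units.val_mk0] at hs
    rw [Matrix.mulVec_smul, hs, hs] at h
    exact mul_left_cancel₀ (Units.ne_zero _) h
  let U : OpenSubgroup (GSp4 k) := ⟨S, S.isOpen_of_mem_nhds hS⟩
  let F : GSp4 k → ℂ := fun g => twist ρ (1, similitudeHom g) * φ ((g⁻¹).val.val *ᵥ e₁)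
  have hF : F ∈ inducedSpace ρ := by
    refine ⟨fun q g => ?_, U, fun u hu g => ?_⟩
    · have h1 : (q.val * g)⁻¹.val.val *ᵥ e₁ =
          (((eigenHom q)⁻¹ : kˣ) : k) • ((g⁻¹).val.val *ᵥ e₁) := by
        have hq : ((q.val)⁻¹).val.val *ᵥ e₁ = (((eigenHom q)⁻¹ : kˣ) : k) • e₁ := by
          have := eigen_spec q⁻¹
          rwa [← coe_eigenHom, map_inv] at this
        rw [_root_.mul_inv_rev, mul_mulVec, hq, Matrix.mulVec_smul]
      have h3 := coe_twist_klingen (ρ := ρ) h2 q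
      have h4 : ((1 : kˣ), similitudeHom (q.val * g)) * (eigenHom q, 1) =
          (eigenHom q, similitudeHom q.val) * (1, similitudeHom g) := by simp
      change twist ρ _ * φ _ = _ * (twist ρ _ * φ _)
      rw [h1, hhom, inv_inv, ← h3, ← mul_assoc, ← mul_assoc, ← Units.val_mul, ← Units.val_mul,
        ← map_mul, ← map_mul, h4]
    · have hu' : u⁻¹ ∈ S := S.inv_mem hu
      have h3 : ((1 : kˣ), similitudeHom (g * u)) = (1, similitudeHom g) * (1, similitudeHom u) := by
        simp
      change twist ρ _ * φ _ = twist ρ _ * φ _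
      rw [_root_.mul_inv_rev, mul_mulVec, hu'.1, h3, map_mul, (show _ = _ from hu.2), mul_one]
  refine ⟨⟨F, hF⟩, fun v hv => ?_⟩
  obtain ⟨x, hx, rfl⟩ := exists_mulVec_eq v hv
  have h3 : ((1 : kˣ), (1 : kˣ)) = 1 := rfl
  rw [homogFun_mulVec h2, hx]
  change (twist ρ (1, 1) : ℂ) * (twist ρ (1, similitudeHom x⁻¹) * φ ((x⁻¹⁻¹).val.val *ᵥ e₁)) = _
  rw [inv_inv, map_inv, hx, inv_one, h3, map_one, Units.val_one, one_mul, one_mul]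

end Model

/-! ### The action of `N` on vectors `(u, w)`. -/

section Siegel
variable {k : Type*} [Field k]

theorem siegelN_mul {m n : Matrix (Fin 2) (Fin 2) k} (hm : m.IsSymm) (hn : n.IsSymm) :
    siegelN m hm * siegelN n hn = siegelN (m + n) (hm.add hn) := by
  apply GSp4_ext
  simp only [coe_mul, siegelN, fromBlocks_multiply]
  congr 1 <;> simp [add_comm]

theorem siegelN_comm {m n : Matrix (Fin 2) (Fin 2) k} (hm : m.IsSymm) (hn : n.IsSymm) :
    siegelN m hm * siegelN n hn = siegelN n hn * siegelN m hm := by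
  rw [siegelN_mul, siegelN_mul]
  congr 1
  exact add_comm _ _

theorem similitudeHom_siegelN {n : Matrix (Fin 2) (Fin 2) k} (hn : n.IsSymm) :
    similitudeHom (siegelN n hn) = 1 := by
  apply similitudeHom_eq
  simp [siegelN, J, fromBlocks_transpose, fromBlocks_multiply, hn.eq]

theorem inv_siegelN_mulVec {n : Matrix (Fin 2) (Fin 2) k} (hn : n.IsSymm) (u w : Fin 2 → k) :
    (siegelN n hn)⁻¹.val.val *ᵥ Sum.elim u w = Sum.elim (u - n *ᵥ w) w := by
  change fromBlocks 1 (-n) 0 1 *ᵥ _ = _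
  rw [fromBlocks_mulVec]
  simp [sub_eq_add_neg, Matrix.neg_mulVec]

/-- The rotation of a vector by a right angle. -/
def perp (w : Fin 2 → k) : Fin 2 → k := ![-w 1, w 0]

theorem vecMulVec_perp_mulVec (w : Fin 2 → k) : vecMulVec (perp w) (perp w) *ᵥ w = 0 := by
  ext i
  fin_cases i <;> simp [vecMulVec, Matrix.mulVec, dotProduct, perp, Fin.sum_univ_two] <;> ring

theorem vecMulVec_isSymm (x : Fin 2 → k) : (vecMulVec x x).IsSymm := by
  ext i j
  simp [vecMulVec, mul_comm]

theorem trace_mul_vecMulVec (s : Matrix (Fin 2) (Fin 2) k) (x : Fin 2 → k) :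
    (s * vecMulVec x x).trace = x ⬝ᵥ s *ᵥ x := by
  rw [Matrix.mul_vecMulVec, Matrix.trace_vecMulVec, dotProduct_comm]

end Siegel

/-! ### Equivariant functionals are supported over isotropic vectors. -/

section Support
variable {k : Type*} [Field k] [ValuativeRel k] [TopologicalSpace k]
  [IsNonarchimedeanLocalField k] {ρ : klingen k →ₜ* ℂˣ} (h2 : (2 : k) ≠ 0)

include h2 in
theorem homogFun_siegelN (f : inducedSpace ρ) {n : Matrix (Fin 2) (Fin 2) k} (hn : n.IsSymm)
    (u w : Fin 2 → k) :
    homogFun (inducedRep ρ (siegelN n hn) f) (Sum.elim u w) =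
      homogFun f (Sum.elim (u - n *ᵥ w) w) := by
  have h3 : ((1 : kˣ), (1 : kˣ)) = 1 := rfl
  rw [homogFun_rep h2, similitudeHom_siegelN, inv_siegelN_mulVec, h3, map_one, Units.val_one,
    one_mul]

/-- The difference operator attached to an element of `N`. -/
def diffOp (ρ : klingen k →ₜ* ℂˣ) (n : Matrix (Fin 2) (Fin 2) k) (hn : n.IsSymm) :
    Module.End ℂ (inducedSpace ρ) := inducedRep ρ (siegelN n hn) - 1

include h2 in
theorem homogFun_diffOp (f : inducedSpace ρ) {n : Matrix (Fin 2) (Fin 2) k} (hn : n.IsSymm)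
    (u w : Fin 2 → k) :
    homogFun (diffOp ρ n hn f) (Sum.elim u w) =
      homogFun f (Sum.elim (u - n *ᵥ w) w) - homogFun f (Sum.elim u w) := by
  rw [diffOp, LinearMap.sub_apply, Module.End.one_apply, map_sub, Pi.sub_apply,
    homogFun_siegelN h2]

theorem commute_rep_siegelN {m n : Matrix (Fin 2) (Fin 2) k} (hm : m.IsSymm) (hn : n.IsSymm) :
    Commute (inducedRep ρ (siegelN m hm)) (inducedRep ρ (siegelN n hn)) := by
  rw [Commute, SemiconjBy, ← map_mul, siegelN_comm, map_mul]

/-- The set of `w` such that an element of the induced representation vanishes on all the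
vectors `(u, w)`. -/
def zeroFibers (f : inducedSpace ρ) : Set (Fin 2 → k) :=
  {w | ∀ u, homogFun f (Sum.elim u w) = 0}

include h2

theorem zeroFibers_smul (f : inducedSpace ρ) {w : Fin 2 → k} {c : k} (hc : c ≠ 0)
    (hw : c • w ∈ zeroFibers f) : w ∈ zeroFibers f := by
  intro u
  have h := hw (c • u)
  have h1 : Sum.elim (c • u) (c • w) = ((Units.mk0 c hc : kˣ) : k) • Sum.elim u w := by
    ext i
    rcases i with i | i <;> rfl
  rw [h1, homogFun_smul h2, mul_eq_zero] at h
  exact h.resolve_left (Units.ne_zero _)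

theorem zeroFibers_diffOp (f : inducedSpace ρ) {n : Matrix (Fin 2) (Fin 2) k} (hn : n.IsSymm) :
    zeroFibers f ⊆ zeroFibers (diffOp ρ n hn f) := by
  intro w hw u
  rw [homogFun_diffOp h2, hw, hw, sub_zero]

/-- A functional on which `N` acts by a nondegenerate character is supported on the fibres over
the isotropic vectors. -/
theorem functional_eq_zero_of_zeroFibers {ψ : AddChar k ℂ} (hψ : ψ ≠ 1)
    {s : Matrix (Fin 2) (Fin 2) k} (hs : s.IsSymm) (hs0 : s ≠ 0)
    (ℓ : Module.Dual ℂ (inducedSpace ρ))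
    (hℓ : ∀ (n : Matrix (Fin 2) (Fin 2) k) (hn : n.IsSymm) (f : inducedSpace ρ),
      ℓ (inducedRep ρ (siegelN n hn) f) = ψ (s * n).trace * ℓ f)
    (f : inducedSpace ρ)
    (hf : ∀ w : Fin 2 → k, w ≠ 0 → perp w ⬝ᵥ s *ᵥ perp w = 0 → w ∈ zeroFibers f) : ℓ f = 0 := by
  obtain ⟨x, hx⟩ := AddChar.ne_one_iff.mp hψ
  obtain ⟨r, hr, hrf⟩ := exists_homogFun_add_eq h2 f
  have hdiff : ∀ (n : Matrix (Fin 2) (Fin 2) k) (hn : n.IsSymm) (g : inducedSpace ρ),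
      ℓ (diffOp ρ n hn g) = (ψ (s * n).trace - 1) * ℓ g := fun n hn g => by
    rw [diffOp, LinearMap.sub_apply, map_sub, hℓ, Module.End.one_apply, sub_mul, one_mul]
  -- `E` is a product of difference operators. It rescales `ℓ` by a nonzero constant and makes `E f`
  -- vanish over the whole sphere. Locally one difference operator suffices, and since these
  -- operators commute, a product vanishes wherever one of its factors does; compactness provides a
  -- finite product.
  have key : ∃ E : Module.End ℂ (inducedSpace ρ),
      (∀ E' : Module.End ℂ (inducedSpace ρ),
        (∀ (n : Matrix (Fin 2) (Fin 2) k) (hn : n.IsSymm),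
          Commute E' (inducedRep ρ (siegelN n hn))) → Commute E E') ∧
      (∀ g, zeroFibers g ⊆ zeroFibers (E g)) ∧ (∃ c : ℂ, c ≠ 0 ∧ ∀ g, ℓ (E g) = c * ℓ g) ∧
      unitSphere k (Fin 2) ⊆ zeroFibers (E f) := by
    refine isCompact_unitSphere.induction_on (p := fun T => ∃ E : Module.End ℂ (inducedSpace ρ),
      (∀ E' : Module.End ℂ (inducedSpace ρ),
        (∀ (n : Matrix (Fin 2) (Fin 2) k) (hn : n.IsSymm),
          Commute E' (inducedRep ρ (siegelN n hn))) → Commute E E') ∧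
      (∀ g, zeroFibers g ⊆ zeroFibers (E g)) ∧ (∃ c : ℂ, c ≠ 0 ∧ ∀ g, ℓ (E g) = c * ℓ g) ∧
      T ⊆ zeroFibers (E f)) ?_ ?_ ?_ ?_
    · exact ⟨1, fun E' _ => Commute.one_left E', fun g => subset_rfl, ⟨1, one_ne_zero, by simp⟩,
        Set.empty_subset _⟩
    · rintro T T' hT ⟨E, h1, h3, h4, h5⟩
      exact ⟨E, h1, h3, h4, hT.trans h5⟩
    · rintro T T' ⟨E, h1, h3, ⟨c, hc, h4⟩, h5⟩ ⟨E', h1', h3', ⟨c', hc', h4'⟩, h5'⟩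
      refine ⟨E * E', fun F hF => (h1 F hF).mul_left (h1' F hF),
        fun g => (h3' g).trans (h3 _), ⟨c * c', mul_ne_zero hc hc', fun g => ?_⟩, ?_⟩
      · rw [Module.End.mul_apply, h4, h4', mul_assoc]
      · refine Set.union_subset ?_ (h5'.trans (h3 _))
        have hcomm : Commute E E' := h1 E' fun n hn =>
          h1' _ fun m hm => commute_rep_siegelN hn hm
        rw [hcomm.eq]
        exact h5.trans (h3' _)
    · intro w hw
      have hw0 := ne_zero_of_mem_unitSphere hw
      -- Over an isotropic `w` the function `f` already vanishes, hence also over nearby `w'` by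
      -- uniform local constancy.
      by_cases hq : perp w ⬝ᵥ s *ᵥ perp w = 0
      · refine ⟨{w' | w' - w ∈ polyball (Fin 2) r}, ?_, 1, fun E' _ => Commute.one_left E',
          fun g => subset_rfl, ⟨1, one_ne_zero, by simp⟩, ?_⟩
        · refine mem_nhdsWithin_of_mem_nhds ?_
          have hc : Continuous fun w' : Fin 2 → k => w' - w := by fun_prop
          refine hc.continuousAt ?_
          rw [sub_self]
          exact polyball_mem_nhds hr
        · intro w' hw' u
          obtain ⟨l, hl⟩ := hw.2
          have h := hrf (Sum.elim u w) (Sum.elim 0 (w' - w)) (Sum.inr l)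
            (by rintro h; rw [Sum.elim_inr] at h; simp [h] at hl) (by
              rintro (i | i)
              · simp
              · rw [Sum.elim_inr, Sum.elim_inr, map_mul, hl, mul_one]
                exact hw' i)
          rw [hf w hw0 hq u] at h
          rw [Module.End.one_apply]
          refine (congrArg _ ?_).trans h
          ext i
          rcases i with i | i <;> simp
      -- This `n` kills `w`, and is scaled so that the character takes at `n` the value `ψ x ≠ 1`.
      -- Over nearby `w'` the translation by `n w'` is so small that `f` does not see it, so the
      -- difference operator kills `f` there.
      · set n : Matrix (Fin 2) (Fin 2) k :=
          (x / (perp w ⬝ᵥ s *ᵥ perp w)) • vecMulVec (perp w) (perp w) with hndef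
        have hn : n.IsSymm := (vecMulVec_isSymm _).smul _
        have hψn : ψ (s * n).trace ≠ 1 := by
          rwa [hndef, Matrix.mul_smul, Matrix.trace_smul, trace_mul_vecMulVec, smul_eq_mul,
            div_mul_cancel₀ _ hq]
        have hnw : n *ᵥ w = 0 := by
          rw [hndef, Matrix.smul_mulVec, vecMulVec_perp_mulVec, smul_zero]
        refine ⟨{w' | n *ᵥ w' ∈ polyball (Fin 2) r} ∩ unitSphere k (Fin 2), ?_, diffOp ρ n hn,
          fun E' hE' => by
            refine LinearMap.ext fun g => ?_
            have h := LinearMap.congr_fun (hE' n hn).eq g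
            simp only [Module.End.mul_apply, diffOp, LinearMap.sub_apply, Module.End.one_apply,
              map_sub] at h ⊢
            rw [h],
          fun g => zeroFibers_diffOp h2 g hn, ⟨_, sub_ne_zero.mpr hψn, hdiff n hn⟩, ?_⟩
        · refine inter_mem (mem_nhdsWithin_of_mem_nhds ?_) self_mem_nhdsWithin
          have hc : Continuous fun w' : Fin 2 → k => n *ᵥ w' :=
            continuous_const.matrix_mulVec continuous_id
          refine hc.continuousAt ?_
          rw [hnw]
          exact polyball_mem_nhds hr
        · rintro w' ⟨hw', hws⟩ u
          obtain ⟨l, hl⟩ := hws.2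
          have h := hrf (Sum.elim u w') (Sum.elim (-(n *ᵥ w')) 0) (Sum.inr l)
            (by rintro h; rw [Sum.elim_inr] at h; simp [h] at hl) (by
              rintro (i | i)
              · rw [Sum.elim_inl, Sum.elim_inr, map_mul, hl, mul_one, Pi.neg_apply,
                  Valuation.map_neg]
                exact hw' i
              · simp)
          rw [homogFun_diffOp h2, sub_eq_zero]
          refine (congrArg _ ?_).trans h
          ext i
          rcases i with i | i <;> simp only [Pi.add_apply, Sum.elim_inl, Sum.elim_inr, Pi.sub_apply,
            Pi.neg_apply, sub_eq_add_neg, Pi.zero_apply, add_zero]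
  obtain ⟨E, -, -, ⟨c, hc, hcE⟩, hE⟩ := key
  -- One more element of `N` is needed, at which the character is nontrivial; it exists because a
  -- nonzero quadratic form takes a nonzero value, `2` being invertible.
  obtain ⟨n, hn, hψn⟩ : ∃ (n : Matrix (Fin 2) (Fin 2) k), n.IsSymm ∧ ψ (s * n).trace ≠ 1 := by
    by_contra! hcon
    obtain ⟨y, hy⟩ : ∃ y : Fin 2 → k, y ⬝ᵥ s *ᵥ y ≠ 0 := by
      by_contra! h0
      apply hs0
      have h00 := h0 ![1, 0]
      have h11 := h0 ![0, 1]
      have h01 := h0 ![1, 1]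
      have hsymm := hs.apply 0 1
      simp [Matrix.mulVec, dotProduct, Fin.sum_univ_two] at h00 h11 h01
      have h01' : s 0 1 = 0 := by
        have : (2 : k) * s 0 1 = 0 := by linear_combination h01 - h00 - h11 - hsymm
        exact (mul_eq_zero.mp this).resolve_left h2
      ext i j
      fin_cases i <;> fin_cases j <;> simp [h00, h11, h01', hsymm]
    refine hx ?_
    have := hcon ((x / (y ⬝ᵥ s *ᵥ y)) • vecMulVec y y) ((vecMulVec_isSymm _).smul _)
    rwa [Matrix.mul_smul, Matrix.trace_smul, trace_mul_vecMulVec, smul_eq_mul,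
      div_mul_cancel₀ _ hy] at this
  -- By homogeneity `E f` vanishes over every `w ≠ 0`, and over `w = 0` the group `N` acts
  -- trivially.
  have hzero : diffOp ρ n hn (E f) = 0 := by
    apply eq_zero_of_homogFun_eq_zero h2
    ext v
    rw [← Sum.elim_comp_inl_inr v, homogFun_diffOp h2, Pi.zero_apply]
    by_cases hv : v ∘ Sum.inr = 0
    · simp [hv]
    · obtain ⟨j, hj, hmax⟩ := exists_max_coord hv
      have hmem : v ∘ Sum.inr ∈ zeroFibers (E f) :=
        zeroFibers_smul h2 _ (inv_ne_zero hj) (hE (inv_smul_mem_unitSphere hj hmax))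
      rw [hmem, hmem, sub_zero]
  have h := hdiff n hn (E f)
  rw [hzero, map_zero, hcE] at h
  have h' := mul_eq_zero.mp h.symm
  exact (mul_eq_zero.mp (h'.resolve_left (sub_ne_zero.mpr hψn))).resolve_left hc

end Support

/-! ### The diagonal torus and antidiagonal forms. -/

section Split
variable {k : Type*} [Field k]

/-- The element of the diagonal torus of `GL₂(k)` embedded in `GSp₄(k)`. -/
def splitTorus (d : Fin 2 → kˣ) : GSp4 k :=
  ofMatrix (fromBlocks (diagonal fun l => (d l : k)) 0 0
    (diagonal fun l => ((d 0 * d 1 * (d l)⁻¹ : kˣ) : k))) (d 0 * d 1) (by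
    simp only [J, fromBlocks_transpose, fromBlocks_multiply, fromBlocks_smul]
    congr 1 <;> ext i j <;> fin_cases i <;> fin_cases j <;>
      simp [Matrix.mul_apply, Fin.sum_univ_two] <;> field_simp)

theorem similitudeHom_splitTorus (d : Fin 2 → kˣ) : similitudeHom (splitTorus d) = d 0 * d 1 :=
  similitudeHom_ofMatrix _

theorem splitTorus_mulVec (d : Fin 2 → kˣ) (u w : Fin 2 → k) :
    (splitTorus d).val.val *ᵥ Sum.elim u w =
      Sum.elim (fun l => d l * u l) (fun l => ((d 0 * d 1 * (d l)⁻¹ : kˣ) : k) * w l) := by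
  rw [splitTorus, coe_ofMatrix, fromBlocks_mulVec]
  ext i
  rcases i with i | i <;> fin_cases i <;> simp [Matrix.mulVec_diagonal]

theorem splitTorus_inv (d : Fin 2 → kˣ) : (splitTorus d)⁻¹ = splitTorus d⁻¹ := by
  rw [inv_eq_iff_mul_eq_one]
  apply GSp4_ext
  rw [coe_mul, coe_one, ← fromBlocks_one]
  simp only [splitTorus, coe_ofMatrix, fromBlocks_multiply]
  congr 1 <;> ext i j <;> fin_cases i <;> fin_cases j <;>
    simp [Matrix.mul_apply, Fin.sum_univ_two] <;> field_simp

/-- The conjugate of a symmetric matrix by an element of the split torus. -/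
def torusConj (d : Fin 2 → kˣ) (n : Matrix (Fin 2) (Fin 2) k) : Matrix (Fin 2) (Fin 2) k :=
  of fun l m => n l m * ((d 0 * d 1 * (d l)⁻¹ * (d m)⁻¹ : kˣ) : k)

theorem torusConj_isSymm (d : Fin 2 → kˣ) {n : Matrix (Fin 2) (Fin 2) k} (hn : n.IsSymm) :
    (torusConj d n).IsSymm := by
  ext l m
  simp only [torusConj, Matrix.transpose_apply, of_apply, hn.apply]
  rw [mul_right_comm (d 0 * d 1)]

theorem siegelN_mul_splitTorus (d : Fin 2 → kˣ) {n : Matrix (Fin 2) (Fin 2) k} (hn : n.IsSymm) :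
    siegelN n hn * splitTorus d = splitTorus d * siegelN _ (torusConj_isSymm d hn) := by
  apply GSp4_ext
  simp only [coe_mul, splitTorus, siegelN, coe_ofMatrix, fromBlocks_multiply]
  congr 1 <;> ext i j <;> fin_cases i <;> fin_cases j <;>
    simp [Matrix.mul_apply, Fin.sum_univ_two, torusConj] <;> field_simp

/-- The symmetric matrix with zero diagonal and off-diagonal entry `c`. -/
def antidiag (c : k) : Matrix (Fin 2) (Fin 2) k := !![0, c; c, 0]

theorem antidiag_isSymm (c : k) : (antidiag c).IsSymm := by
  ext i j; fin_cases i <;> fin_cases j <;> simp [antidiag]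

theorem trace_antidiag_mul (c : k) {n : Matrix (Fin 2) (Fin 2) k} (hn : n.IsSymm) {i j : Fin 2}
    (hij : j ≠ i) : (antidiag c * n).trace = 2 * c * n j i := by
  have h := hn.apply 0 1
  fin_cases i <;> fin_cases j <;>
    simp [antidiag, Matrix.trace, Fin.sum_univ_two, Matrix.mul_apply, Matrix.vecMul, dotProduct, h]
      at hij ⊢ <;> ring

/-- A symmetric matrix with prescribed column `i`. -/
def symmOfCol (i : Fin 2) (x : Fin 2 → k) : Matrix (Fin 2) (Fin 2) k :=
  of fun l m => if l = i then x m else if m = i then x l else 0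

theorem symmOfCol_isSymm (i : Fin 2) (x : Fin 2 → k) : (symmOfCol i x).IsSymm := by
  ext l m
  fin_cases i <;> fin_cases l <;> fin_cases m <;> simp [symmOfCol]

theorem symmOfCol_mulVec (i : Fin 2) (x : Fin 2 → k) :
    symmOfCol i x *ᵥ Pi.single i 1 = x := by
  ext l
  fin_cases i <;> fin_cases l <;> simp [symmOfCol]

theorem perp_antidiag {c : k} (w : Fin 2 → k) :
    perp w ⬝ᵥ antidiag c *ᵥ perp w = -(2 * c * (w 0 * w 1)) := by
  simp [antidiag, perp, Matrix.mulVec, dotProduct, Fin.sum_univ_two]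
  ring

end Split

/-! ### Restriction to the fibres over the two basis vectors. -/

section Fiber
variable {k : Type*} [Field k] [ValuativeRel k] [TopologicalSpace k]
  [IsNonarchimedeanLocalField k] {ρ : klingen k →ₜ* ℂˣ} (h2 : (2 : k) ≠ 0)

/-- The restriction of an element of the induced representation to the fibre over a basis
vector. -/
def fiber (i : Fin 2) : inducedSpace ρ →ₗ[ℂ] (Fin 2 → k) → ℂ where
  toFun f u := homogFun f (Sum.elim u (Pi.single i 1))
  map_add' f g := by ext; simp
  map_smul' c f := by ext; simp

theorem fiber_apply (i : Fin 2) (f : inducedSpace ρ) (u : Fin 2 → k) :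
    fiber i f u = homogFun f (Sum.elim u (Pi.single i 1)) := rfl

/-- Schwartz–Bruhat functions on `k²`. -/
def IsSchwartz (h : (Fin 2 → k) → ℂ) : Prop :=
  (∃ r : k, r ≠ 0 ∧ ∀ u, ∀ u' ∈ polyball (Fin 2) r, h (u + u') = h u) ∧
    ∃ R : k, ∀ u, u ∉ polyball (Fin 2) R → h u = 0

include h2

theorem fiber_siegelN (i : Fin 2) (f : inducedSpace ρ) {n : Matrix (Fin 2) (Fin 2) k}
    (hn : n.IsSymm) (u : Fin 2 → k) :
    fiber i (inducedRep ρ (siegelN n hn) f) u = fiber i f (u - n *ᵥ Pi.single i 1) :=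
  homogFun_siegelN h2 f hn u _

theorem fiber_diffOp (i : Fin 2) (f : inducedSpace ρ) {n : Matrix (Fin 2) (Fin 2) k}
    (hn : n.IsSymm) (u : Fin 2 → k) :
    fiber i (diffOp ρ n hn f) u = fiber i f (u - n *ᵥ Pi.single i 1) - fiber i f u :=
  homogFun_diffOp h2 f hn u _

theorem exists_fiber_add_eq (i : Fin 2) (f : inducedSpace ρ) :
    ∃ r : k, r ≠ 0 ∧ ∀ u, ∀ u' ∈ polyball (Fin 2) r, fiber i f (u + u') = fiber i f u := by
  obtain ⟨r, hr, h⟩ := exists_homogFun_add_eq h2 f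
  refine ⟨r, hr, fun u u' hu' => ?_⟩
  have := h (Sum.elim u (Pi.single i 1)) (Sum.elim u' 0) (Sum.inr i) (by simp) (by
    rintro (l | l)
    · simpa using hu' l
    · simp)
  rw [fiber_apply, fiber_apply, ← this]
  refine congrArg _ ?_
  ext l
  rcases l with l | l <;> simp only [Pi.add_apply, Sum.elim_inl, Sum.elim_inr, Pi.zero_apply,
    add_zero]

omit h2 in
omit [TopologicalSpace k] [IsNonarchimedeanLocalField k] in
theorem exists_mem_polyball (x : Fin 2 → k) : ∃ R : k, R ≠ 0 ∧ x ∈ polyball (Fin 2) R := by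
  by_cases hx : x = 0
  · exact ⟨1, one_ne_zero, hx ▸ zero_mem _⟩
  · obtain ⟨j, hj, hmax⟩ := exists_max_coord hx
    exact ⟨x j, hj, hmax⟩

/-- The radius of local constancy grows in proportion to the vector, so a fixed translation is
invisible far out: if it has size at most `|R|`, it does nothing once some `|u l|` exceeds `|R /
r|`. The fibre function itself need not have compact support. -/
theorem isSchwartz_fiber_diffOp (i : Fin 2) (f : inducedSpace ρ) {n : Matrix (Fin 2) (Fin 2) k}
    (hn : n.IsSymm) : IsSchwartz (fiber i (diffOp ρ n hn f)) := by
  refine ⟨exists_fiber_add_eq h2 i _, ?_⟩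
  obtain ⟨r, hr, h⟩ := exists_homogFun_add_eq h2 f
  obtain ⟨R, hR, hnR⟩ := exists_mem_polyball (-(n *ᵥ Pi.single i 1))
  refine ⟨R / r, fun u hu => ?_⟩
  rw [mem_polyball, not_forall] at hu
  obtain ⟨l, hl⟩ := hu
  rw [not_le] at hl
  have hul : u l ≠ 0 := by
    intro h0
    simp [h0] at hl
  have hle : valuation k R ≤ valuation k (r * u l) := by
    have : R = r * (R / r) := by field_simp
    rw [this, map_mul, map_mul _ r]
    exact mul_le_mul_right hl.le _
  have := h (Sum.elim u (Pi.single i 1)) (Sum.elim (-(n *ᵥ Pi.single i 1)) 0) (Sum.inl l)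
    hul (by
    rintro (m | m)
    · exact (hnR m).trans hle
    · simp)
  rw [fiber_diffOp h2, sub_eq_zero, fiber_apply, fiber_apply, ← this]
  refine congrArg _ ?_
  ext m
  rcases m with m | m <;> simp only [Pi.add_apply, Sum.elim_inl, Sum.elim_inr, Pi.zero_apply,
    add_zero, Pi.sub_apply, Pi.neg_apply, sub_eq_add_neg]

omit h2 in
theorem diffOp_comm {m n : Matrix (Fin 2) (Fin 2) k} (hm : m.IsSymm) (hn : n.IsSymm)
    (f : inducedSpace ρ) : diffOp ρ m hm (diffOp ρ n hn f) = diffOp ρ n hn (diffOp ρ m hm f) := by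
  have h := LinearMap.congr_fun (commute_rep_siegelN (ρ := ρ) hm hn).eq f
  simp only [Module.End.mul_apply] at h
  simp only [diffOp, LinearMap.sub_apply, Module.End.one_apply, map_sub, h]
  abel

/-- The inverse of the torus element sends `(u, eᵢ)` to `(d j)⁻¹` times a vector of the same fibre
whose coordinate `i` has been multiplied by `d j / d i` and whose coordinate `j` is unchanged; the
scalar is absorbed by homogeneity. -/
theorem fiber_splitTorus {i j : Fin 2} (hij : j ≠ i) (f : inducedSpace ρ) (d : Fin 2 → kˣ)
    (u : Fin 2 → k) :
    fiber i (inducedRep ρ (splitTorus d) f) u =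
      twist ρ (d j, d 0 * d 1) * fiber i f ((Pi.mulSingle i (d j * (d i)⁻¹) : Fin 2 → kˣ) • u) := by
  have hd : d 0 * d 1 = d i * d j := by
    fin_cases i <;> fin_cases j <;> simp at hij ⊢
    exact mul_comm _ _
  have hd' : (d⁻¹) 0 * (d⁻¹) 1 = (d i)⁻¹ * (d j)⁻¹ := by
    rw [Pi.inv_apply, Pi.inv_apply, ← mul_inv, hd, mul_inv]
  have hv : (splitTorus d)⁻¹.val.val *ᵥ Sum.elim u (Pi.single i 1) =
      (((d j)⁻¹ : kˣ) : k) • Sum.elim ((Pi.mulSingle i (d j * (d i)⁻¹) : Fin 2 → kˣ) • u)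
        (Pi.single i 1) := by
    rw [splitTorus_inv, splitTorus_mulVec, hd']
    ext l
    rcases l with l | l
    · simp only [Sum.elim_inl, Pi.smul_apply, smul_eq_mul]
      rcases eq_or_ne l i with rfl | hl
      · have := (d j).ne_zero
        simp [Units.smul_def]
        field_simp
      · have : l = j := by
          fin_cases i <;> fin_cases j <;> fin_cases l <;> simp at hij hl ⊢
        subst this
        simp [hl, Units.smul_def]
    · simp only [Sum.elim_inr, Pi.smul_apply, smul_eq_mul]
      rcases eq_or_ne l i with rfl | hl
      · simp
      · simp [hl]
  have h3 : ((1 : kˣ), d 0 * d 1) * (d j, 1) = (d j, d 0 * d 1) := by simp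
  rw [fiber_apply, homogFun_rep h2, hv, homogFun_smul h2, inv_inv, similitudeHom_splitTorus,
    ← mul_assoc, ← Units.val_mul, ← map_mul, h3, fiber_apply]

end Fiber

/-! ### Fourier coefficients of Schwartz–Bruhat functions on `k²`. -/

section Functional
open MeasureTheory MeasureTheory.Measure
variable {k : Type*} [Field k] [ValuativeRel k] [TopologicalSpace k]
  [IsNonarchimedeanLocalField k]

/-- The Borel `σ`-algebra of `k²`. -/
abbrev borelPlane (k : Type*) [TopologicalSpace k] : MeasurableSpace (Fin 2 → k) := borel _

attribute [local instance] borelPlane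

theorem borelSpace_plane (k : Type*) [TopologicalSpace k] : BorelSpace (Fin 2 → k) := ⟨rfl⟩

attribute [local instance] borelSpace_plane

theorem IsSchwartz.continuous {h : (Fin 2 → k) → ℂ} (hh : IsSchwartz h) : Continuous h := by
  obtain ⟨⟨r, hr, hadd⟩, -⟩ := hh
  refine continuous_iff_continuousAt.mpr fun u => ?_
  have hev : ∀ᶠ u' in 𝓝 u, h u' = h u := by
    have hc : Continuous fun u' : Fin 2 → k => u' - u := by fun_prop
    have : (fun u' : Fin 2 → k => u' - u) ⁻¹' (polyball (Fin 2) r) ∈ 𝓝 u := by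
      refine hc.continuousAt ?_
      rw [sub_self]
      exact polyball_mem_nhds hr
    filter_upwards [this] with u' hu'
    have := hadd u _ hu'
    rwa [add_sub_cancel] at this
  exact (continuousAt_congr hev).mpr continuousAt_const

theorem IsSchwartz.hasCompactSupport {h : (Fin 2 → k) → ℂ} (hh : IsSchwartz h) :
    HasCompactSupport h := by
  obtain ⟨-, R, hR⟩ := hh
  exact HasCompactSupport.intro (isCompact_polyball (ι := Fin 2) R) fun u hu => hR u hu

/-- The Fourier coefficient of a function on `k²` with respect to the character
`u ↦ ψ (y u_j)`. -/
def fourier (ψ : AddChar k ℂ) (y : k) (j : Fin 2) (h : (Fin 2 → k) → ℂ) : ℂ :=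
  ∫ u, h u * ψ (y * u j) ∂(addHaar : Measure (Fin 2 → k))

variable {ψ : AddChar k ℂ} (y : k) (j : Fin 2)

theorem integrable_fourier (hψ : Continuous ψ) {h : (Fin 2 → k) → ℂ} (hh : IsSchwartz h) :
    Integrable (fun u => h u * ψ (y * u j)) (addHaar : Measure (Fin 2 → k)) := by
  have hc : Continuous fun u : Fin 2 → k => ψ (y * u j) := by fun_prop
  exact (hh.continuous.mul hc).integrable_of_hasCompactSupport hh.hasCompactSupport.mul_right

theorem fourier_add (hψ : Continuous ψ) {h h' : (Fin 2 → k) → ℂ} (hh : IsSchwartz h)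
    (hh' : IsSchwartz h') : fourier ψ y j (h + h') = fourier ψ y j h + fourier ψ y j h' := by
  rw [fourier, fourier, fourier,
    ← integral_add (integrable_fourier y j hψ hh) (integrable_fourier y j hψ hh')]
  simp [add_mul]

theorem fourier_sub (hψ : Continuous ψ) {h h' : (Fin 2 → k) → ℂ} (hh : IsSchwartz h)
    (hh' : IsSchwartz h') : fourier ψ y j (h - h') = fourier ψ y j h - fourier ψ y j h' := by
  rw [fourier, fourier, fourier,
    ← integral_sub (integrable_fourier y j hψ hh) (integrable_fourier y j hψ hh')]
  simp [sub_mul]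

theorem fourier_smul (c : ℂ) (h : (Fin 2 → k) → ℂ) :
    fourier ψ y j (c • h) = c * fourier ψ y j h := by
  rw [fourier, fourier, ← integral_const_mul]
  simp [mul_assoc]

theorem fourier_translate (h : (Fin 2 → k) → ℂ) (a : Fin 2 → k) :
    fourier ψ y j (fun u => h (u - a)) = ψ (y * a j) * fourier ψ y j h := by
  rw [fourier, fourier, ← integral_const_mul,
    ← integral_sub_right_eq_self (fun u => ψ (y * a j) * (h u * ψ (y * u j))) a]
  refine integral_congr_ae (Eventually.of_forall fun u => ?_)
  have : y * u j = y * a j + y * (u - a) j := by rw [Pi.sub_apply]; ring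
  simp only [this, AddChar.map_add_eq_mul]
  ring

theorem fourier_coordScale {i j : Fin 2} (hij : j ≠ i) (h : (Fin 2 → k) → ℂ) (c : kˣ) :
    fourier ψ y j (fun u => h ((Pi.mulSingle i c : Fin 2 → kˣ) • u)) =
      (normalizedAbs (c : k) : ℂ)⁻¹ * fourier ψ y j h := by
  rw [fourier, fourier, ← integral_coordScale addHaar i c]
  simp [hij]

open scoped Classical in
-- The character is trivial on the ball, so the coefficient is its volume.
theorem fourier_indicator {r : k} (hr : r ≠ 0)
    (hψr : ∀ x, valuation k x ≤ valuation k r → ψ (y * x) = 1) :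
    fourier ψ y j (Set.indicator (polyball (Fin 2) r) 1) ≠ 0 := by
  have h : fourier ψ y j (Set.indicator (polyball (Fin 2) r) 1) =
      ((addHaar : Measure (Fin 2 → k)).real (polyball (Fin 2) r : Set (Fin 2 → k)) : ℂ) := by
    have hm : MeasurableSet (polyball (Fin 2) r : Set (Fin 2 → k)) :=
      (isOpen_polyball hr).measurableSet
    have h1 : (fun u : Fin 2 → k => Set.indicator (polyball (Fin 2) r) (1 : (Fin 2 → k) → ℂ) u *
        ψ (y * u j)) = Set.indicator (polyball (Fin 2) r) (fun _ => (1 : ℂ)) := by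
      ext u
      by_cases hu : u ∈ (polyball (Fin 2) r : Set (Fin 2 → k))
      · simp [Set.indicator_of_mem hu, hψr _ (hu j)]
      · simp [Set.indicator_of_notMem hu]
    rw [fourier, h1, integral_indicator_const _ hm]
    simp
  rw [h]
  have hpos : 0 < (addHaar : Measure (Fin 2 → k)) (polyball (Fin 2) r : Set (Fin 2 → k)) :=
    (isOpen_polyball hr).measure_pos _ ⟨0, zero_mem _⟩
  have hfin := (isCompact_polyball (ι := Fin 2) r).measure_lt_top (μ := addHaar)
  have := ENNReal.toReal_pos hpos.ne' hfin.ne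
  exact_mod_cast this.ne'

end Functional

/-! ### The regularized functional on a fibre and its equivariance. -/

section BesselFunctional
variable {k : Type*} [Field k] [ValuativeRel k] [TopologicalSpace k]
  [IsNonarchimedeanLocalField k] {ρ : klingen k →ₜ* ℂˣ} (h2 : (2 : k) ≠ 0)
  {ψ : AddChar k ℂ} (hψ : Continuous ψ) (s₀ : k) {i j : Fin 2} (hij : j ≠ i)

include h2

theorem fourier_fiber_siegelN (g : inducedSpace ρ) {n : Matrix (Fin 2) (Fin 2) k}
    (hn : n.IsSymm) :
    fourier ψ (2 * s₀) j (fiber i (inducedRep ρ (siegelN n hn) g)) =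
      ψ (2 * s₀ * n j i) * fourier ψ (2 * s₀) j (fiber i g) := by
  have h : fiber i (inducedRep ρ (siegelN n hn) g) =
      fun u => fiber i g (u - n *ᵥ Pi.single i 1) := funext (fiber_siegelN h2 i g hn)
  rw [h, fourier_translate]
  simp

theorem isSchwartz_fiber_siegelN {g : inducedSpace ρ} (hg : IsSchwartz (fiber i g))
    {n : Matrix (Fin 2) (Fin 2) k} (hn : n.IsSymm) :
    IsSchwartz (fiber i (inducedRep ρ (siegelN n hn) g)) := by
  have h1 := (isSchwartz_fiber_diffOp h2 i g hn)
  have h3 : fiber i (inducedRep ρ (siegelN n hn) g) = fiber i (diffOp ρ n hn g) + fiber i g := by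
    rw [← map_add]
    congr 1
    simp [diffOp]
  obtain ⟨-, R, hR⟩ := h1
  obtain ⟨-, R', hR'⟩ := hg
  refine ⟨exists_fiber_add_eq h2 i _, ?_⟩
  rw [h3]
  rcases le_total (valuation k R) (valuation k R') with h | h
  · refine ⟨R', fun u hu => ?_⟩
    rw [Pi.add_apply, hR' u hu, hR u fun hu' => hu fun l => (hu' l).trans h, add_zero]
  · refine ⟨R, fun u hu => ?_⟩
    rw [Pi.add_apply, hR u hu, hR' u fun hu' => hu fun l => (hu' l).trans h, add_zero]

include hψ

theorem fourier_fiber_diffOp {g : inducedSpace ρ} (hg : IsSchwartz (fiber i g))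
    {n : Matrix (Fin 2) (Fin 2) k} (hn : n.IsSymm) :
    fourier ψ (2 * s₀) j (fiber i (diffOp ρ n hn g)) =
      (ψ (2 * s₀ * n j i) - 1) * fourier ψ (2 * s₀) j (fiber i g) := by
  have h : fiber i (diffOp ρ n hn g) = fiber i (inducedRep ρ (siegelN n hn) g) - fiber i g := by
    rw [diffOp, LinearMap.sub_apply, Module.End.one_apply, map_sub]
  rw [h, fourier_sub _ _ hψ (isSchwartz_fiber_siegelN h2 hg hn) hg, fourier_fiber_siegelN h2,
    sub_mul, one_mul]

/-- The Bessel functional supported on the fibre over a basis vector: up to a scalar, the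
integral over the fibre against a character, regularized by a difference operator. -/
def besselFunctional (i j : Fin 2) {m : Matrix (Fin 2) (Fin 2) k} (hm : m.IsSymm) :
    Module.Dual ℂ (inducedSpace ρ) where
  toFun f := (ψ (2 * s₀ * m j i) - 1)⁻¹ * fourier ψ (2 * s₀) j (fiber i (diffOp ρ m hm f))
  map_add' f g := by
    rw [map_add, map_add, fourier_add _ _ hψ (isSchwartz_fiber_diffOp h2 i f hm)
      (isSchwartz_fiber_diffOp h2 i g hm), mul_add]
  map_smul' c f := by
    rw [map_smul, map_smul, fourier_smul, RingHom.id_apply, smul_eq_mul]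
    ring

variable {m : Matrix (Fin 2) (Fin 2) k} (hm : m.IsSymm) (hψm : ψ (2 * s₀ * m j i) ≠ 1)

theorem besselFunctional_eq_zero_of_fiber {f : inducedSpace ρ}
    (hf : fiber i f = 0) : besselFunctional h2 hψ s₀ i j hm f = 0 := by
  have h : fiber i (diffOp ρ m hm f) = 0 := by
    ext u
    rw [fiber_diffOp h2, hf]
    simp
  change _ * fourier ψ (2 * s₀) j (fiber i (diffOp ρ m hm f)) = 0
  rw [h]
  simp [fourier]

include hψm

theorem mul_besselFunctional_apply (f : inducedSpace ρ) :
    (ψ (2 * s₀ * m j i) - 1) * besselFunctional h2 hψ s₀ i j hm f =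
      fourier ψ (2 * s₀) j (fiber i (diffOp ρ m hm f)) := by
  rw [besselFunctional]
  exact mul_inv_cancel_left₀ (sub_ne_zero.mpr hψm) _

/-- The regularization does not depend on `m`: difference operators commute, so the coefficient of
`D_m D_n f` can be computed in two ways. This freedom is what makes the functional equivariant under
the torus. -/
theorem besselFunctional_eq (f : inducedSpace ρ) {n : Matrix (Fin 2) (Fin 2) k}
    (hn : n.IsSymm) :
    (ψ (2 * s₀ * n j i) - 1) * besselFunctional h2 hψ s₀ i j hm f =
      fourier ψ (2 * s₀) j (fiber i (diffOp ρ n hn f)) := by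
  refine mul_left_cancel₀ (sub_ne_zero.mpr hψm) ?_
  rw [mul_left_comm, mul_besselFunctional_apply h2 hψ s₀ hm hψm,
    ← fourier_fiber_diffOp h2 hψ s₀ (isSchwartz_fiber_diffOp h2 i f hm) hn,
    ← fourier_fiber_diffOp h2 hψ s₀ (isSchwartz_fiber_diffOp h2 i f hn) hm, diffOp_comm]

theorem besselFunctional_of_isSchwartz {f : inducedSpace ρ} (hf : IsSchwartz (fiber i f)) :
    besselFunctional h2 hψ s₀ i j hm f = fourier ψ (2 * s₀) j (fiber i f) := by
  refine mul_left_cancel₀ (sub_ne_zero.mpr hψm) ?_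
  rw [mul_besselFunctional_apply h2 hψ s₀ hm hψm, fourier_fiber_diffOp h2 hψ s₀ hf]

theorem besselFunctional_siegelN (f : inducedSpace ρ) {n : Matrix (Fin 2) (Fin 2) k}
    (hn : n.IsSymm) :
    besselFunctional h2 hψ s₀ i j hm (inducedRep ρ (siegelN n hn) f) =
      ψ (2 * s₀ * n j i) * besselFunctional h2 hψ s₀ i j hm f := by
  refine mul_left_cancel₀ (sub_ne_zero.mpr hψm) ?_
  rw [mul_left_comm, mul_besselFunctional_apply h2 hψ s₀ hm hψm,
    mul_besselFunctional_apply h2 hψ s₀ hm hψm, ← fourier_fiber_siegelN h2 s₀ _ hn]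
  have h := LinearMap.congr_fun (commute_rep_siegelN (ρ := ρ) hm hn).eq f
  simp only [Module.End.mul_apply] at h
  have hE : diffOp ρ m hm (inducedRep ρ (siegelN n hn) f) =
      inducedRep ρ (siegelN n hn) (diffOp ρ m hm f) := by
    simp only [diffOp, LinearMap.sub_apply, Module.End.one_apply, map_sub, h]
  rw [hE]

include hij in
omit hψ hψm in
-- The factor `|d j / d i|` contributed by `δ_Q^{1/2}` cancels the Jacobian of scaling the
-- coordinate `i`, so only the value of `ρ` remains.
theorem fourier_fiber_splitTorus (g : inducedSpace ρ) (d : Fin 2 → kˣ) :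
    fourier ψ (2 * s₀) j (fiber i (inducedRep ρ (splitTorus d) g)) =
      ρ (diagHom (d j, d 0 * d 1)) * fourier ψ (2 * s₀) j (fiber i g) := by
  have h : fiber i (inducedRep ρ (splitTorus d) g) = (twist ρ (d j, d 0 * d 1) : ℂ) •
      fun u => fiber i g ((Pi.mulSingle i (d j * (d i)⁻¹) : Fin 2 → kˣ) • u) :=
    funext (fiber_splitTorus h2 hij g d)
  have hd : (d j) ^ 2 * (d 0 * d 1)⁻¹ = d j * (d i)⁻¹ := by
    have : d 0 * d 1 = d i * d j := by
      fin_cases i <;> fin_cases j <;> simp at hij ⊢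
      exact mul_comm _ _
    rw [this]
    group
  have ht : twist ρ (d j, d 0 * d 1) =
      absHom (d j * (d i)⁻¹) * ρ (diagHom (d j, d 0 * d 1)) := by
    rw [← hd]
    rfl
  rw [h, fourier_smul, fourier_coordScale _ hij, ht, Units.val_mul, ← absHom_apply]
  have := (absHom (d j * (d i)⁻¹)).ne_zero
  field_simp

include hij in
theorem besselFunctional_splitTorus (f : inducedSpace ρ) (d : Fin 2 → kˣ) :
    besselFunctional h2 hψ s₀ i j hm (inducedRep ρ (splitTorus d) f) =
      ρ (diagHom (d j, d 0 * d 1)) * besselFunctional h2 hψ s₀ i j hm f := by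
  -- Moving the torus past `D_m` replaces `m` by its conjugate, whose off-diagonal entry, the only
  -- one seen by the character, is the same.
  have hconj : torusConj d m j i = m j i := by
    have : d 0 * d 1 * (d j)⁻¹ * (d i)⁻¹ = 1 := by
      fin_cases i <;> fin_cases j <;> simp at hij ⊢
    rw [torusConj, of_apply, this, Units.val_one, mul_one]
  refine mul_left_cancel₀ (sub_ne_zero.mpr hψm) ?_
  have h1 := besselFunctional_eq h2 hψ s₀ hm hψm f (torusConj_isSymm d hm)
  rw [hconj] at h1
  rw [mul_left_comm, mul_besselFunctional_apply h2 hψ s₀ hm hψm, h1,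
    ← fourier_fiber_splitTorus h2 s₀ hij]
  have hE : diffOp ρ m hm (inducedRep ρ (splitTorus d) f) =
      inducedRep ρ (splitTorus d) (diffOp ρ _ (torusConj_isSymm d hm) f) := by
    simp only [diffOp, LinearMap.sub_apply, Module.End.one_apply, map_sub]
    rw [← Module.End.mul_apply, ← map_mul, siegelN_mul_splitTorus, map_mul, Module.End.mul_apply]
  rw [hE]

end BesselFunctional

/-! ### Bump functions: elements of the representation supported on one fibre. -/

section Bump
variable {k : Type*} [Field k] [ValuativeRel k] [TopologicalSpace k]
  [IsNonarchimedeanLocalField k] (ρ : klingen k →ₜ* ℂˣ)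

open scoped Classical in
/-- The homogeneous function supported on the vectors whose coordinate `m` dominates. -/
def bump (r : k) (m : Fin 2 ⊕ Fin 2) (v : Fin 2 ⊕ Fin 2 → k) : ℂ :=
  if h : v m ≠ 0 ∧ ∀ l, l ≠ m → valuation k (v l) ≤ valuation k (r * v m) then
    twist ρ ((Units.mk0 (v m) h.1)⁻¹, 1) else 0

theorem bump_smul (r : k) (m : Fin 2 ⊕ Fin 2) (c : kˣ) (v : Fin 2 ⊕ Fin 2 → k) :
    bump ρ r m ((c : k) • v) = twist ρ (c⁻¹, 1) * bump ρ r m v := by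
  have hc : 0 < valuation k (c : k) := by simp [zero_lt_iff]
  have hiff : (((c : k) • v) m ≠ 0 ∧ ∀ l, l ≠ m → valuation k (((c : k) • v) l) ≤
      valuation k (r * ((c : k) • v) m)) ↔
      (v m ≠ 0 ∧ ∀ l, l ≠ m → valuation k (v l) ≤ valuation k (r * v m)) := by
    refine and_congr (by simp) (forall_congr' fun l => imp_congr_right fun _ => ?_)
    rw [Pi.smul_apply, Pi.smul_apply, smul_eq_mul, smul_eq_mul, mul_left_comm, map_mul _ (c : k),
      map_mul _ (c : k), mul_le_mul_iff_right₀ hc]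
  by_cases h : v m ≠ 0 ∧ ∀ l, l ≠ m → valuation k (v l) ≤ valuation k (r * v m)
  · rw [bump, bump, dif_pos h, dif_pos (hiff.mpr h), ← Units.val_mul, ← map_mul]
    have h3 : ∀ h' : ((c : k) • v) m ≠ 0,
        ((Units.mk0 (((c : k) • v) m) h')⁻¹, (1 : kˣ)) = (c⁻¹, 1) * ((Units.mk0 (v m) h.1)⁻¹, 1) :=
      fun h' => by
        rw [Prod.mk_mul_mk, ← mul_inv, mul_one]
        congr 2
        ext
        simp
    rw [h3]
  · rw [bump, bump, dif_neg h, dif_neg (mt hiff.mp h), mul_zero]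

theorem eventually_twist_mk0 {x : k} (hx : x ≠ 0) :
    ∀ᶠ y in 𝓝 x, ∀ hy : y ≠ 0,
      twist ρ ((Units.mk0 y hy)⁻¹, 1) = twist ρ ((Units.mk0 x hx)⁻¹, 1) := by
  have h := eventually_twist_one_left ρ
  rw [Units.isEmbedding_val₀.nhds_eq_comap, Units.val_one, eventually_comap] at h
  have hc : ContinuousAt (fun y : k => y⁻¹ * x) x :=
    (continuousAt_inv₀ hx).mul continuousAt_const
  have h1 : Tendsto (fun y : k => y⁻¹ * x) (𝓝 x) (𝓝 1) := by
    have := hc.tendsto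
    rwa [inv_mul_cancel₀ hx] at this
  filter_upwards [h1.eventually h] with y hy hy0
  have := hy ((Units.mk0 y hy0)⁻¹ * Units.mk0 x hx) (by simp)
  have h3 : ((Units.mk0 y hy0)⁻¹, (1 : kˣ)) =
      ((Units.mk0 y hy0)⁻¹ * Units.mk0 x hx, 1) * ((Units.mk0 x hx)⁻¹, 1) := by simp
  rw [h3, map_mul, this, one_mul]

theorem eventually_bump_eq {r : k} (hr : r ≠ 0) (m : Fin 2 ⊕ Fin 2) {v : Fin 2 ⊕ Fin 2 → k}
    (hv : v ≠ 0) : ∀ᶠ v' in 𝓝 v, bump ρ r m v' = bump ρ r m v := by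
  have hcoord : ∀ l, Tendsto (fun v' : Fin 2 ⊕ Fin 2 → k => v' l) (𝓝 v) (𝓝 (v l)) :=
    fun l => (continuous_apply l).continuousAt
  by_cases hm : v m = 0
  -- The bump vanishes at `v`. Nearby, `|v' m|` stays below `|ϖ v l / r|` while `|v' l| = |v l|`, so
  -- the coordinate `l` violates the domination condition.
  · obtain ⟨l, hl⟩ := Function.ne_iff.mp hv
    have hl0 : v l ≠ 0 := hl
    have hlm : l ≠ m := by rintro rfl; exact hl hm
    obtain ⟨ϖ, -, hϖ⟩ := exists_valuation_uniformizer (k := k)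
    have hϖ1 : valuation k (ϖ : k) < 1 := (hϖ _).mpr le_rfl
    have h1 := (hcoord l).eventually (eventually_valuation_eq hl0)
    have h3 := (hcoord m).eventually (eventually_sub_le (v m)
      (div_ne_zero (mul_ne_zero ϖ.ne_zero hl0) hr))
    have h4 : bump ρ r m v = 0 := by
      rw [bump, dif_neg]
      exact fun h => h.1 hm
    filter_upwards [h1, h3] with v' h1' h3'
    rw [h4, bump, dif_neg]
    rintro ⟨h5, h6⟩
    have h7 := h6 l hlm
    rw [hm, sub_zero] at h3'
    have h8 : valuation k (r * v' m) ≤ valuation k (ϖ * v l) := by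
      rw [← mul_div_cancel₀ (ϖ * v l : k) hr, map_mul, map_mul]
      exact mul_le_mul_right h3' _
    have h9 : valuation k (ϖ * v l) < valuation k (v l) := by
      rw [map_mul]
      refine mul_lt_of_lt_one_left ?_ hϖ1
      simpa [zero_lt_iff] using hl0
    rw [h1'] at h7
    exact absurd (h7.trans h8) (not_le.mpr h9)
  · have h1 := (hcoord m).eventually (eventually_valuation_eq hm)
    have h3 := (hcoord m).eventually (eventually_twist_mk0 ρ hm)
    have h4 : ∀ᶠ v' in 𝓝 v, ∀ l, valuation k (v' l - v l) ≤ valuation k (r * v m) :=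
      eventually_all.mpr fun l =>
        (hcoord l).eventually (eventually_sub_le (v l) (mul_ne_zero hr hm))
    filter_upwards [h1, h3, h4] with v' h1' h3' h4'
    have hm' : v' m ≠ 0 := by
      intro h
      rw [h, map_zero, eq_comm, map_eq_zero] at h1'
      exact hm h1'
    have hrm : valuation k (r * v' m) = valuation k (r * v m) := by rw [map_mul, h1', map_mul]
    have hiff : (v' m ≠ 0 ∧ ∀ l, l ≠ m → valuation k (v' l) ≤ valuation k (r * v' m)) ↔
        (v m ≠ 0 ∧ ∀ l, l ≠ m → valuation k (v l) ≤ valuation k (r * v m)) := by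
      refine and_congr (by simp [hm, hm']) (forall_congr' fun l => imp_congr_right fun _ => ?_)
      rw [hrm]
      constructor
      · intro h
        have := Valuation.map_sub_le _ h (h4' l)
        rwa [sub_sub_cancel] at this
      · intro h
        have := Valuation.map_add_le _ h (h4' l)
        rwa [add_sub_cancel] at this
    by_cases h : v m ≠ 0 ∧ ∀ l, l ≠ m → valuation k (v l) ≤ valuation k (r * v m)
    · rw [bump, bump, dif_pos h, dif_pos (hiff.mpr h), h3']
    · rw [bump, bump, dif_neg h, dif_neg (mt hiff.mp h)]

variable {ρ}

omit [TopologicalSpace k] [IsNonarchimedeanLocalField k] in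
theorem isSchwartz_indicator {r : k} (hr : r ≠ 0) :
    IsSchwartz (Set.indicator (polyball (Fin 2) r : Set (Fin 2 → k)) 1) := by
  refine ⟨⟨r, hr, fun u a ha => ?_⟩, r, fun u hu => Set.indicator_of_notMem hu _⟩
  by_cases hu : u ∈ (polyball (Fin 2) r : Set (Fin 2 → k))
  · rw [Set.indicator_of_mem hu,
      Set.indicator_of_mem (by exact (polyball (Fin 2) r).add_mem hu ha)]
    rfl
  · rw [Set.indicator_of_notMem hu, Set.indicator_of_notMem]
    exact fun h => hu (((polyball (Fin 2) r).add_mem_cancel_right ha).mp h)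

/-- On the fibre over `eᵢ` the dominating coordinate is `1`, so the condition describes the ball of
radius `|r|`; on the other fibre that coordinate is `0`. -/
theorem exists_fiber_eq_indicator (h2 : (2 : k) ≠ 0) {r : k} (hr : r ≠ 0) {i j : Fin 2}
    (hij : j ≠ i) : ∃ β : inducedSpace ρ,
      fiber i β = Set.indicator (polyball (Fin 2) r) 1 ∧ fiber j β = 0 := by
  obtain ⟨β, hβ⟩ := exists_homogFun_eq (bump ρ r (Sum.inr i))
    (fun v hv => eventually_bump_eq ρ hr _ hv) (bump_smul ρ r _) h2
  have hne : ∀ (l : Fin 2) (u : Fin 2 → k), Sum.elim u (Pi.single l (1 : k)) ≠ 0 := fun l u h => by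
    have := congrFun h (Sum.inr l)
    simp at this
  refine ⟨β, ?_, ?_⟩
  · ext u
    rw [fiber_apply, hβ _ (hne _ _)]
    by_cases hu : u ∈ (polyball (Fin 2) r : Set (Fin 2 → k))
    · rw [Set.indicator_of_mem hu, bump, dif_pos]
      · have h1 : ((1 : kˣ), (1 : kˣ)) = 1 := rfl
        simp [h1]
      · refine ⟨by simp, ?_⟩
        rintro (l | l) hl
        · simpa using hu l
        · have : l ≠ i := fun h => hl (by rw [h])
          simp [this]
    · rw [Set.indicator_of_notMem hu, bump, dif_neg]
      rintro ⟨-, h⟩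
      refine hu fun l => ?_
      simpa using h (Sum.inl l) (by simp)
  · ext u
    rw [fiber_apply, hβ _ (hne _ _), bump, dif_neg]
    · rfl
    · rintro ⟨h, -⟩
      simp [hij.symm] at h

end Bump

/-! ### Uniqueness of the equivariant functional on one fibre. -/

section Upper
variable {k : Type*} [Field k] [ValuativeRel k] [TopologicalSpace k]
  [IsNonarchimedeanLocalField k] {ρ : klingen k →ₜ* ℂˣ} (h2 : (2 : k) ≠ 0)
  {ψ : AddChar k ℂ} (hψ : Continuous ψ) {s₀ : k} {i j : Fin 2} (hij : j ≠ i)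
  {m : Matrix (Fin 2) (Fin 2) k} (hm : m.IsSymm) (hψm : ψ (2 * s₀ * m j i) ≠ 1)

theorem exists_mul_le (hψ : Continuous ψ) (c : k) {r₁ : k} (hr₁ : r₁ ≠ 0) :
    ∃ r : k, r ≠ 0 ∧ valuation k r ≤ valuation k r₁ ∧
      ∀ x, valuation k x ≤ valuation k r → ψ (c * x) = 1 := by
  obtain ⟨r₂, hr₂, h⟩ := exists_addChar_eq_one ψ hψ
  have key : ∀ r₃ : k, r₃ ≠ 0 → ∃ r : k, r ≠ 0 ∧ valuation k r ≤ valuation k r₁ ∧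
      valuation k r ≤ valuation k r₃ := fun r₃ hr₃ => by
    rcases le_total (valuation k r₁) (valuation k r₃) with h | h
    exacts [⟨r₁, hr₁, le_rfl, h⟩, ⟨r₃, hr₃, h, le_rfl⟩]
  by_cases hc : c = 0
  · exact ⟨r₁, hr₁, le_rfl, fun x _ => by simp [hc]⟩
  · obtain ⟨r, hr, h1, h3⟩ := key (r₂ / c) (div_ne_zero hr₂ hc)
    refine ⟨r, hr, h1, fun x hx => h _ ?_⟩
    rw [← mul_div_cancel₀ r₂ hc, map_mul, map_mul]
    exact mul_le_mul_right (hx.trans h3) _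

include h2 hψ hij hψm

open scoped Classical in
/-- An element of the induced representation killed by the Bessel functional of a fibre agrees on
this fibre with one that is supported there and killed by all equivariant functionals. -/
theorem exists_fiber_eq_of_besselFunctional_eq_zero {f : inducedSpace ρ}
    (hf : IsSchwartz (fiber i f)) (hf0 : besselFunctional h2 hψ s₀ i j hm f = 0) :
    ∃ g : inducedSpace ρ, fiber i g = fiber i f ∧ fiber j g = 0 ∧
      ∀ ℓ : Module.Dual ℂ (inducedSpace ρ),
        (∀ (n : Matrix (Fin 2) (Fin 2) k) (hn : n.IsSymm) (f : inducedSpace ρ),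
          ℓ (inducedRep ρ (siegelN n hn) f) = ψ (antidiag s₀ * n).trace * ℓ f) → ℓ g = 0 := by
  obtain ⟨⟨r₁, hr₁, hadd⟩, R, hR⟩ := id hf
  -- The ball is taken small enough that the fibre function is constant on its cosets and the
  -- character is trivial on it.
  obtain ⟨r, hr, hrr₁, hψr⟩ := exists_mul_le hψ (2 * s₀) hr₁
  obtain ⟨β, hβi, hβj⟩ := exists_fiber_eq_indicator (ρ := ρ) h2 hr hij
  set A := polyball (Fin 2) r with hA
  have hadd' : ∀ u, ∀ a ∈ A, fiber i f (u + a) = fiber i f u := fun u a ha =>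
    hadd u a fun l => (ha l).trans hrr₁
  have : DiscreteTopology ((Fin 2 → k) ⧸ A) :=
    QuotientAddGroup.discreteTopology (isOpen_polyball hr)
  have hfin : ((QuotientAddGroup.mk : (Fin 2 → k) → (Fin 2 → k) ⧸ A) ''
      (polyball (Fin 2) R : Set (Fin 2 → k))).Finite :=
    ((isCompact_polyball R).image QuotientAddGroup.continuous_mk).finite_of_discrete
  set S := hfin.toFinset with hS
  -- The fibre function is a finite combination of indicators of cosets, each of which is a
  -- translate by `N` of the fibre of the bump `β`.
  let g : inducedSpace ρ := ∑ q ∈ S, fiber i f q.out •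
    inducedRep ρ (siegelN (symmOfCol i q.out) (symmOfCol_isSymm i _)) β
  have hgi : fiber i g = fiber i f := by
    ext u
    have h1 : ∀ q : (Fin 2 → k) ⧸ A, (fiber i f q.out • fiber i (inducedRep ρ
        (siegelN (symmOfCol i q.out) (symmOfCol_isSymm i _)) β)) u =
          if (u : (Fin 2 → k) ⧸ A) = q then fiber i f u else 0 := fun q => by
      rw [Pi.smul_apply, fiber_siegelN h2, symmOfCol_mulVec, hβi]
      by_cases hq : (u : (Fin 2 → k) ⧸ A) = q
      · have hmem : u - q.out ∈ A := by
          rw [← neg_sub, neg_mem_iff, sub_eq_neg_add, ← QuotientAddGroup.eq, hq]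
          exact (QuotientAddGroup.out_eq' q).symm
        rw [if_pos hq, Set.indicator_of_mem (by exact hmem), Pi.one_apply, smul_eq_mul, mul_one,
          ← hadd' _ _ hmem, add_sub_cancel]
      · rw [if_neg hq, Set.indicator_of_notMem, smul_zero]
        intro hmem
        refine hq ?_
        rw [← QuotientAddGroup.out_eq' q, QuotientAddGroup.eq, ← sub_eq_neg_add, ← neg_mem_iff,
          neg_sub]
        exact hmem
    have h3 : fiber i g u = ∑ q ∈ S, if (u : (Fin 2 → k) ⧸ A) = q then fiber i f u else 0 := by
      rw [map_sum, Finset.sum_apply]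
      refine Finset.sum_congr rfl fun q _ => ?_
      rw [map_smul, h1]
    rw [h3, Finset.sum_ite_eq]
    split_ifs with hu
    · rfl
    · refine (hR u fun hu' => hu ?_).symm
      rw [hS, Set.Finite.mem_toFinset]
      exact ⟨u, hu', rfl⟩
  have hgj : fiber j g = 0 := by
    rw [map_sum]
    refine Finset.sum_eq_zero fun q _ => ?_
    rw [map_smul]
    ext u
    rw [Pi.smul_apply, fiber_siegelN h2, hβj, Pi.zero_apply, smul_zero, Pi.zero_apply]
  -- Every equivariant functional takes on `g` the same explicit constant times its value on `β`.
  -- The Bessel functional kills `g` but not `β`, so the constant is zero.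
  have hℓg : ∀ ℓ : Module.Dual ℂ (inducedSpace ρ),
      (∀ (n : Matrix (Fin 2) (Fin 2) k) (hn : n.IsSymm) (f : inducedSpace ρ),
        ℓ (inducedRep ρ (siegelN n hn) f) = ψ (antidiag s₀ * n).trace * ℓ f) →
      ℓ g = (∑ q ∈ S, fiber i f q.out * ψ (antidiag s₀ * symmOfCol i q.out).trace) * ℓ β :=
    fun ℓ hℓ => by
      rw [map_sum, Finset.sum_mul]
      refine Finset.sum_congr rfl fun q _ => ?_
      rw [map_smul, hℓ, smul_eq_mul, mul_assoc]
  have h1 := hℓg (besselFunctional h2 hψ s₀ i j hm) fun n hn f => by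
    rw [besselFunctional_siegelN h2 hψ s₀ hm hψm, trace_antidiag_mul _ hn hij]
  have hSβ : IsSchwartz (fiber i β) := hβi ▸ isSchwartz_indicator hr
  have h3 : besselFunctional h2 hψ s₀ i j hm β ≠ 0 := by
    rw [besselFunctional_of_isSchwartz h2 hψ s₀ hm hψm hSβ, hβi]
    exact fourier_indicator _ _ hr hψr
  have h4 : besselFunctional h2 hψ s₀ i j hm g = 0 := by
    rw [besselFunctional_of_isSchwartz h2 hψ s₀ hm hψm (hgi ▸ hf), hgi,
      ← besselFunctional_of_isSchwartz h2 hψ s₀ hm hψm hf, hf0]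
  rw [h4] at h1
  refine ⟨g, hgi, hgj, fun ℓ hℓ => ?_⟩
  rw [hℓg ℓ hℓ, (mul_eq_zero.mp h1.symm).resolve_right h3, zero_mul]

theorem exists_besselFunctional_ne_zero : ∃ β : inducedSpace ρ,
    besselFunctional h2 hψ s₀ i j hm β ≠ 0 ∧ fiber j β = 0 := by
  obtain ⟨r, hr, -, hψr⟩ := exists_mul_le hψ (2 * s₀) (one_ne_zero (α := k))
  obtain ⟨β, hβi, hβj⟩ := exists_fiber_eq_indicator (ρ := ρ) h2 hr hij
  refine ⟨β, ?_, hβj⟩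
  rw [besselFunctional_of_isSchwartz h2 hψ s₀ hm hψm (hβi ▸ isSchwartz_indicator hr), hβi]
  exact fourier_indicator _ _ hr hψr

end Upper

/-! ### The two functionals of a split form and the dimension count. -/

section SplitFunctionals

theorem rev_ne (i : Fin 2) : i.rev ≠ i := by fin_cases i <;> decide

theorem antidiag_rev {k : Type*} [Field k] (c : k) (i : Fin 2) : antidiag c i.rev i = c := by
  fin_cases i <;> rfl

variable {k : Type*} [Field k] [ValuativeRel k] [TopologicalSpace k]
  [IsNonarchimedeanLocalField k] {ρ : klingen k →ₜ* ℂˣ} (h2 : (2 : k) ≠ 0)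
  {ψ : AddChar k ℂ} (hψ : Continuous ψ) {s₀ c : k}

/-- The two Bessel functionals attached to the two isotropic lines of a split form. -/
def splitFunctional (ρ : klingen k →ₜ* ℂˣ) (s₀ c : k) (i : Fin 2) :
    Module.Dual ℂ (inducedSpace ρ) :=
  besselFunctional h2 hψ s₀ i i.rev (antidiag_isSymm c)

variable (hc : ψ (2 * s₀ * c) ≠ 1)

include hc in
theorem splitFunctional_siegelN (i : Fin 2) (f : inducedSpace ρ) {n : Matrix (Fin 2) (Fin 2) k}
    (hn : n.IsSymm) : splitFunctional h2 hψ ρ s₀ c i (inducedRep ρ (siegelN n hn) f) =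
      ψ (antidiag s₀ * n).trace * splitFunctional h2 hψ ρ s₀ c i f := by
  rw [trace_antidiag_mul _ hn (rev_ne i)]
  exact besselFunctional_siegelN h2 hψ s₀ _ (by rwa [antidiag_rev]) f hn

include hc in
theorem splitFunctional_splitTorus (i : Fin 2) (f : inducedSpace ρ) (d : Fin 2 → kˣ) :
    splitFunctional h2 hψ ρ s₀ c i (inducedRep ρ (splitTorus d) f) =
      ρ (diagHom (d i.rev, d 0 * d 1)) * splitFunctional h2 hψ ρ s₀ c i f :=
  besselFunctional_splitTorus h2 hψ s₀ (rev_ne i) _ (by rwa [antidiag_rev]) f d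

include hc in
-- For each fibre there is a bump on which its own functional is nonzero and the other vanishes.
theorem linearIndependent_splitFunctional :
    LinearIndependent ℂ (splitFunctional h2 hψ ρ s₀ c) := by
  rw [Fintype.linearIndependent_iff]
  intro a ha i
  obtain ⟨β, hβ, hβ0⟩ := exists_besselFunctional_ne_zero (ρ := ρ) h2 hψ (s₀ := s₀) (rev_ne i)
    (antidiag_isSymm c) (by rwa [antidiag_rev])
  have h := LinearMap.congr_fun ha β
  rw [LinearMap.sum_apply, Finset.sum_eq_single i] at h
  · exact (mul_eq_zero.mp h).resolve_right hβ
  · intro l _ hl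
    have : l = i.rev := by fin_cases i <;> fin_cases l <;> simp at hl ⊢
    subst this
    rw [LinearMap.smul_apply, splitFunctional, besselFunctional_eq_zero_of_fiber h2 hψ s₀ _ hβ0,
      smul_zero]
  · simp

include hc in
-- It suffices that `ℓ` kills every `f` killed by both functionals. The difference `D f` has
-- Schwartz fibres; subtracting from it elements that carry these fibres and are killed by `ℓ`
-- leaves a function vanishing over both isotropic lines, which `ℓ` kills by the support theorem.
theorem mem_span_splitFunctional (ℓ : Module.Dual ℂ (inducedSpace ρ))
    (hℓ : ∀ (n : Matrix (Fin 2) (Fin 2) k) (hn : n.IsSymm) (f : inducedSpace ρ),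
      ℓ (inducedRep ρ (siegelN n hn) f) = ψ (antidiag s₀ * n).trace * ℓ f) :
    ℓ ∈ Submodule.span ℂ (Set.range (splitFunctional h2 hψ ρ s₀ c)) := by
  have hs₀ : s₀ ≠ 0 := by
    rintro rfl
    simp at hc
  have hψ1 : ψ ≠ 1 := by
    rintro rfl
    simp at hc
  refine mem_span_of_iInf_ker_le_ker fun f hf => ?_
  simp only [Submodule.mem_iInf, LinearMap.mem_ker] at hf ⊢
  set D := diffOp ρ (antidiag c) (antidiag_isSymm c) with hD
  have hdiff : ∀ ℓ' : Module.Dual ℂ (inducedSpace ρ),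
      (∀ (n : Matrix (Fin 2) (Fin 2) k) (hn : n.IsSymm) (f : inducedSpace ρ),
        ℓ' (inducedRep ρ (siegelN n hn) f) = ψ (antidiag s₀ * n).trace * ℓ' f) →
      ∀ f, ℓ' (D f) = (ψ (2 * s₀ * c) - 1) * ℓ' f := fun ℓ' hℓ' f => by
    rw [hD, diffOp, LinearMap.sub_apply, map_sub, hℓ', Module.End.one_apply, sub_mul, one_mul,
      trace_antidiag_mul _ (antidiag_isSymm c) (rev_ne 0), antidiag_rev]
  have hg : ∀ i : Fin 2, ∃ g : inducedSpace ρ, fiber i g = fiber i (D f) ∧ fiber i.rev g = 0 ∧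
      ℓ g = 0 := fun i => by
    obtain ⟨g, h1, h3, h4⟩ := exists_fiber_eq_of_besselFunctional_eq_zero h2 hψ (s₀ := s₀)
      (rev_ne i) (antidiag_isSymm c) (by rwa [antidiag_rev])
      (isSchwartz_fiber_diffOp h2 i f (antidiag_isSymm c)) (by
        have := hdiff (splitFunctional h2 hψ ρ s₀ c i)
          (fun n hn f => splitFunctional_siegelN h2 hψ hc i f hn) f
        rw [hf, mul_zero] at this
        exact this)
    exact ⟨g, h1, h3, h4 ℓ hℓ⟩
  choose g hg1 hg2 hg3 using hg
  have hfib : ∀ i, fiber i (D f - g 0 - g 1) = 0 := fun i => by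
    have h0 := hg2 0
    have h1 := hg2 1
    rw [show (0 : Fin 2).rev = 1 from rfl] at h0
    rw [show (1 : Fin 2).rev = 0 from rfl] at h1
    rw [map_sub, map_sub]
    fin_cases i
    · simp [hg1, h1]
    · simp [hg1, h0]
  have hzero := functional_eq_zero_of_zeroFibers h2 hψ1 (antidiag_isSymm s₀)
    (fun h => hs₀ (congrFun (congrFun h 0) 1)) ℓ hℓ (D f - g 0 - g 1) fun w hw hw0 => by
      rw [perp_antidiag, neg_eq_zero, mul_eq_zero, mul_eq_zero] at hw0
      have hw' := hw0.resolve_left (by rintro (h | h); exacts [h2 h, hs₀ h])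
      obtain ⟨i, hi, hiw⟩ : ∃ i, w i ≠ 0 ∧ w i.rev = 0 := by
        rcases mul_eq_zero.mp hw' with h | h
        · exact ⟨1, fun h1 => hw (by ext l; fin_cases l <;> simp [h, h1]), h⟩
        · exact ⟨0, fun h1 => hw (by ext l; fin_cases l <;> simp [h, h1]), h⟩
      refine zeroFibers_smul h2 _ (inv_ne_zero hi) ?_
      have : (w i)⁻¹ • w = Pi.single i 1 := by
        ext l
        rcases eq_or_ne l i with rfl | hl
        · simp [hi]
        · have : l = i.rev := by fin_cases i <;> fin_cases l <;> simp at hl ⊢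
          subst this
          simp [hl, hiw]
      rw [this]
      exact fun u => congrFun (hfib i) u
  -- Thus `ℓ (D f) = 0`, and `ℓ (D f)` is a nonzero multiple of `ℓ f`.
  rw [map_sub, map_sub, hg3, hg3, sub_zero, sub_zero, hdiff ℓ hℓ] at hzero
  exact (mul_eq_zero.mp hzero).resolve_left (sub_ne_zero.mpr hc)

variable {K : Type*} [CommRing K] [Algebra k K]

/-- The character by which a split torus acts on one of the two Bessel functionals. -/
def splitChar (ρ : klingen k →ₜ* ℂˣ) (d : Kˣ →* (Fin 2 → kˣ)) (i : Fin 2) : Kˣ →* ℂˣ where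
  toFun t := ρ (diagHom (d t i.rev, d t 0 * d t 1))
  map_one' := by
    rw [map_one, Pi.one_apply, Pi.one_apply, Pi.one_apply, mul_one]
    exact (congrArg _ (map_one diagHom)).trans (map_one ρ)
  map_mul' t t' := by
    rw [← map_mul, ← map_mul, map_mul, Prod.mk_mul_mk]
    simp only [Pi.mul_apply]
    rw [mul_mul_mul_comm]

include hc in
-- The torus acts on the two functionals by `splitChar`. By linear independence, a combination on
-- which it acts by `χ` involves only those whose character is `χ`.
theorem besselFunctionals_eq_span {ι : K →ₐ[k] Matrix (Fin 2) (Fin 2) k}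
    {d : Kˣ →* (Fin 2 → kˣ)} (hd : ∀ t, torus ι t = splitTorus (d t)) (χ : Kˣ →* ℂˣ) :
    besselFunctionals (inducedRep ρ) ψ (antidiag s₀) ι χ =
      Submodule.span ℂ (Set.range fun i : {i // splitChar ρ d i = χ} =>
        splitFunctional h2 hψ ρ s₀ c i) := by
  apply le_antisymm
  · rintro ℓ ⟨hℓT, hℓN⟩
    obtain ⟨a, ha⟩ := (Submodule.mem_span_range_iff_exists_fun ℂ).mp
      (mem_span_splitFunctional h2 hψ hc ℓ hℓN)
    have hcoef : ∀ i, splitChar ρ d i ≠ χ → a i = 0 := fun i hi => by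
      obtain ⟨t, ht⟩ := DFunLike.ne_iff.mp hi
      have hsum : ∑ i, (a i * ((splitChar ρ d i t : ℂ) - χ t)) •
          splitFunctional h2 hψ ρ s₀ c i = 0 := by
        ext f
        have h := hℓT t f
        rw [← ha, hd] at h
        simp only [LinearMap.sum_apply, LinearMap.smul_apply, smul_eq_mul,
          splitFunctional_splitTorus h2 hψ hc, Finset.mul_sum] at h
        rw [← sub_eq_zero, ← Finset.sum_sub_distrib] at h
        rw [LinearMap.sum_apply, LinearMap.zero_apply, ← h]
        refine Finset.sum_congr rfl fun l _ => ?_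
        have : splitChar ρ d l t = ρ (diagHom (d t l.rev, d t 0 * d t 1)) := rfl
        rw [LinearMap.smul_apply, smul_eq_mul, this]
        ring
      have := Fintype.linearIndependent_iff.mp
        (linearIndependent_splitFunctional (ρ := ρ) h2 hψ hc) _ hsum i
      refine (mul_eq_zero.mp this).resolve_right fun h => ht (Units.ext ?_)
      exact sub_eq_zero.mp h
    rw [← ha]
    refine Submodule.sum_mem _ fun i _ => ?_
    by_cases hi : splitChar ρ d i = χ
    · exact Submodule.smul_mem _ _ (Submodule.subset_span ⟨⟨i, hi⟩, rfl⟩)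
    · rw [hcoef i hi, zero_smul]
      exact zero_mem _
  · rw [Submodule.span_le]
    rintro _ ⟨⟨i, rfl⟩, rfl⟩
    refine ⟨fun t f => ?_, fun n hn f => ?_⟩
    · rw [hd]
      exact splitFunctional_splitTorus h2 hψ hc i f (d t)
    · exact splitFunctional_siegelN h2 hψ hc i f hn

include h2 hψ hc in
theorem finrank_besselFunctionals_split {ι : K →ₐ[k] Matrix (Fin 2) (Fin 2) k}
    {d : Kˣ →* (Fin 2 → kˣ)} (hd : ∀ t, torus ι t = splitTorus (d t)) (χ : Kˣ →* ℂˣ) :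
    Module.finrank ℂ (besselFunctionals (inducedRep ρ) ψ (antidiag s₀) ι χ) =
      Nat.card {i // splitChar ρ d i = χ} := by
  classical
  rw [besselFunctionals_eq_span h2 hψ hc hd, Nat.card_eq_fintype_card]
  exact finrank_span_eq_card
    ((linearIndependent_splitFunctional (ρ := ρ) h2 hψ hc).comp _ Subtype.val_injective)

include h2 hψ hc in
theorem besselFunctionals_split_eq_bot {ι : K →ₐ[k] Matrix (Fin 2) (Fin 2) k}
    {d : Kˣ →* (Fin 2 → kˣ)} (hd : ∀ t, torus ι t = splitTorus (d t)) {χ : Kˣ →* ℂˣ}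
    (hχ : ∀ i, splitChar ρ d i ≠ χ) :
    besselFunctionals (inducedRep ρ) ψ (antidiag s₀) ι χ = ⊥ := by
  rw [besselFunctionals_eq_span h2 hψ hc hd, Submodule.span_eq_bot]
  rintro _ ⟨⟨i, hi⟩, rfl⟩
  exact absurd hi (hχ i)

end SplitFunctionals

/-! ### Isotropic binary forms and their similitudes. -/

section QuadraticForms
variable {k : Type*} [Field k]

/-- The transform of the form `s` of a character of `N` under a change of basis. -/
def conjForm (h : GL (Fin 2) k) (s : Matrix (Fin 2) (Fin 2) k) : Matrix (Fin 2) (Fin 2) k :=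
  (h.val.det)⁻¹ • ((h.val)ᵀ * s * h.val)

theorem det_ne_zero (h : GL (Fin 2) k) : h.val.det ≠ 0 :=
  (h.isUnit.map detMonoidHom).ne_zero

theorem conjForm_inv_conjForm (h : GL (Fin 2) k) (s : Matrix (Fin 2) (Fin 2) k) :
    conjForm h⁻¹ (conjForm h s) = s := by
  have h1 : h.val.det * (h⁻¹).val.det = 1 := by rw [← Matrix.det_mul]; simp
  have h3 : ((h⁻¹).val)ᵀ * (h.val)ᵀ = 1 := by
    rw [← Matrix.transpose_mul, Units.mul_inv, Matrix.transpose_one]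
  have h4 : h.val * (h⁻¹).val = 1 := Units.mul_inv h
  have h5 : ((h⁻¹).val)ᵀ * ((h.val)ᵀ * s * h.val) * (h⁻¹).val =
      (((h⁻¹).val)ᵀ * (h.val)ᵀ) * s * (h.val * (h⁻¹).val) := by simp only [Matrix.mul_assoc]
  rw [conjForm, conjForm, Matrix.mul_smul, Matrix.smul_mul, smul_smul, ← mul_inv, mul_comm, h1,
    inv_one, one_smul, h5, h3, h4, Matrix.one_mul, Matrix.mul_one]

/-- The bilinear form attached to a symmetric matrix is symmetric. -/
theorem dotProduct_mulVec_symm {s : Matrix (Fin 2) (Fin 2) k} (hs : s.IsSymm)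
    (u v : Fin 2 → k) : u ⬝ᵥ s *ᵥ v = v ⬝ᵥ s *ᵥ u := by
  rw [Matrix.dotProduct_mulVec, dotProduct_comm, ← Matrix.mulVec_transpose, hs.eq]

theorem exists_conjForm_eq_antidiag (h2 : (2 : k) ≠ 0) {s : Matrix (Fin 2) (Fin 2) k}
    (hs : s.IsSymm) (hs0 : s.det ≠ 0) {u : Fin 2 → k} (hu : u ≠ 0) (huu : u ⬝ᵥ s *ᵥ u = 0) :
    ∃ (h : GL (Fin 2) k) (c : k), c ≠ 0 ∧ conjForm h s = antidiag c := by
  have hsu : s *ᵥ u ≠ 0 := fun h0 => hu (Matrix.eq_zero_of_mulVec_eq_zero hs0 h0)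
  obtain ⟨i, hi⟩ := Function.ne_iff.mp hsu
  set v : Fin 2 → k := Pi.single i 1
  set b := v ⬝ᵥ s *ᵥ u with hbdef
  have hb : b ≠ 0 := by simpa [hbdef, v] using hi
  have hb' : u ⬝ᵥ s *ᵥ v = b := dotProduct_mulVec_symm hs u v
  -- Completes `u` to a hyperbolic pair: subtracting this multiple of `u` from `v` makes it
  -- isotropic without changing its pairing with `u`.
  set w : Fin 2 → k := v - ((v ⬝ᵥ s *ᵥ v) / (2 * b)) • u with hw
  have hwu : w ⬝ᵥ s *ᵥ u = b := by
    rw [hw, sub_dotProduct, smul_dotProduct, huu, smul_zero, sub_zero]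
  have huw : u ⬝ᵥ s *ᵥ w = b := by rw [dotProduct_mulVec_symm hs, hwu]
  have hww : w ⬝ᵥ s *ᵥ w = 0 := by
    have : w ⬝ᵥ s *ᵥ w = w ⬝ᵥ s *ᵥ v - ((v ⬝ᵥ s *ᵥ v) / (2 * b)) * b := by
      conv_lhs => rw [hw, Matrix.mulVec_sub, dotProduct_sub, Matrix.mulVec_smul, dotProduct_smul,
        smul_eq_mul, ← hw, hwu]
    rw [this, hw, sub_dotProduct, smul_dotProduct, hb', smul_eq_mul]
    field_simp
    ring
  set M : Matrix (Fin 2) (Fin 2) k := (of ![u, w])ᵀ with hM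
  have hMs : Mᵀ * s * M = antidiag b := by
    have hent : ∀ i j, (Mᵀ * s * M) i j = ![u, w] i ⬝ᵥ s *ᵥ ![u, w] j := fun i j => by
      rw [Matrix.mul_assoc, Matrix.mul_apply']
      rfl
    ext i j
    rw [hent]
    fin_cases i <;> fin_cases j
    exacts [huu, huw, hwu, hww]
  have hdet : M.det ≠ 0 := by
    intro h0
    have := congrArg Matrix.det hMs
    rw [Matrix.det_mul, h0, mul_zero] at this
    simp [antidiag, Matrix.det_fin_two, hb] at this
  refine ⟨GeneralLinearGroup.mkOfDetNeZero M hdet, M.det⁻¹ * b,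
    mul_ne_zero (inv_ne_zero hdet) hb, ?_⟩
  have h1 : (GeneralLinearGroup.mkOfDetNeZero M hdet).val = M := rfl
  rw [conjForm, h1, hMs]
  ext i j
  fin_cases i <;> fin_cases j <;> simp [antidiag]

theorem cayleyHamilton_two (T : Matrix (Fin 2) (Fin 2) k) :
    T * (T.trace • (1 : Matrix (Fin 2) (Fin 2) k) - T) = T.det • 1 := by
  ext i j
  fin_cases i <;> fin_cases j <;>
    simp [Matrix.mul_apply, Fin.sum_univ_two, Matrix.trace, Matrix.det_fin_two] <;> ring

/-- Similitudes of the hyperbolic plane with similitude factor equal to the determinant are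
diagonal. -/
theorem isDiag_of_antidiag (h2 : (2 : k) ≠ 0) {c : k} (hc : c ≠ 0)
    {T : Matrix (Fin 2) (Fin 2) k} (hT : Tᵀ * antidiag c * T = T.det • antidiag c)
    (hdet : T.det ≠ 0) : T 0 1 = 0 ∧ T 1 0 = 0 := by
  have h00 := congrFun (congrFun hT 0) 0
  have h01 := congrFun (congrFun hT 0) 1
  have h11 := congrFun (congrFun hT 1) 1
  simp [Matrix.mul_apply, Fin.sum_univ_two, antidiag, Matrix.det_fin_two] at h00 h01 h11
  rw [Matrix.det_fin_two] at hdet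
  have h1 : T 0 0 * T 1 0 = 0 := by
    have : (2 * c) * (T 0 0 * T 1 0) = 0 := by linear_combination h00
    exact (mul_eq_zero.mp this).resolve_left (mul_ne_zero h2 hc)
  have h3 : T 0 1 * T 1 1 = 0 := by
    have : (2 * c) * (T 0 1 * T 1 1) = 0 := by linear_combination h11
    exact (mul_eq_zero.mp this).resolve_left (mul_ne_zero h2 hc)
  -- The off-diagonal entry compares `T 0 0 * T 1 1 + T 0 1 * T 1 0` with the determinant. This is
  -- what excludes antidiagonal similitudes, whose factor is minus the determinant.
  have h4 : T 0 1 * T 1 0 = 0 := by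
    have : (2 * c) * (T 0 1 * T 1 0) = 0 := by linear_combination h01
    exact (mul_eq_zero.mp this).resolve_left (mul_ne_zero h2 hc)
  rw [h4, sub_zero] at hdet
  exact ⟨(mul_eq_zero.mp h3).resolve_right (right_ne_zero_of_mul hdet),
    (mul_eq_zero.mp h1).resolve_left (left_ne_zero_of_mul hdet)⟩

end QuadraticForms

/-! ### `K` is split if and only if the form is isotropic. -/

section QuadraticAlgebra
variable {k : Type*} [Field k] {K : Type*} [CommRing K] [Algebra k K]
  {ι : K →ₐ[k] Matrix (Fin 2) (Fin 2) k}

/-- The conjugate of an embedding in `M₂(k)` by a change of basis. -/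
def conjEmb (h : GL (Fin 2) k) (ι : K →ₐ[k] Matrix (Fin 2) (Fin 2) k) :
    K →ₐ[k] Matrix (Fin 2) (Fin 2) k where
  toFun x := (h⁻¹).val * ι x * h.val
  map_one' := by rw [map_one, Matrix.mul_one, Units.inv_mul]
  map_mul' x y := by
    have h1 : h.val * (h⁻¹).val = 1 := Units.mul_inv h
    calc (h⁻¹).val * ι (x * y) * h.val = (h⁻¹).val * ι x * 1 * ι y * h.val := by
          rw [map_mul]; simp only [Matrix.mul_assoc, Matrix.one_mul]
      _ = _ := by rw [← h1]; simp only [Matrix.mul_assoc]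
  map_zero' := by rw [map_zero, Matrix.mul_zero, Matrix.zero_mul]
  map_add' x y := by rw [map_add, Matrix.mul_add, Matrix.add_mul]
  commutes' c := by
    rw [AlgHom.commutes, ← Algebra.commutes, Matrix.mul_assoc, Units.inv_mul, Matrix.mul_one]

theorem conjEmb_apply (h : GL (Fin 2) k) (x : K) :
    conjEmb h ι x = (h⁻¹).val * ι x * h.val := rfl

theorem conjEmb_inv_conjEmb (h : GL (Fin 2) k) : conjEmb h⁻¹ (conjEmb h ι) = ι := by
  ext1 x
  have h1 : h.val * (h⁻¹).val = 1 := Units.mul_inv h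
  rw [conjEmb_apply, conjEmb_apply, inv_inv, ← Matrix.mul_assoc, ← Matrix.mul_assoc, h1,
    Matrix.one_mul, Matrix.mul_assoc, h1, Matrix.mul_one]

theorem conjEmb_injective (hι : Function.Injective ι) (h : GL (Fin 2) k) :
    Function.Injective (conjEmb h ι) := by
  intro x y hxy
  apply hι
  rw [← conjEmb_inv_conjEmb (ι := ι) h, conjEmb_apply, hxy, ← conjEmb_apply]

theorem det_conjEmb (h : GL (Fin 2) k) (x : K) : (conjEmb h ι x).det = (ι x).det := by
  have h1 : (h⁻¹).val.det * h.val.det = 1 := by rw [← Matrix.det_mul]; simp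
  rw [conjEmb_apply, Matrix.det_mul, Matrix.det_mul, mul_right_comm, h1, one_mul]

theorem conjEmb_conjForm {s : Matrix (Fin 2) (Fin 2) k}
    (hT : ∀ t : Kˣ, (ι t)ᵀ * s * ι t = (ι t).det • s) (h : GL (Fin 2) k) (t : Kˣ) :
    (conjEmb h ι t)ᵀ * conjForm h s * conjEmb h ι t =
      (conjEmb h ι t).det • conjForm h s := by
  have h3 : ((h⁻¹).val)ᵀ * (h.val)ᵀ = 1 := by
    rw [← Matrix.transpose_mul, Units.mul_inv, Matrix.transpose_one]
  have h4 : h.val * (h⁻¹).val = 1 := Units.mul_inv h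
  have h5 : ((h⁻¹).val * ι t * h.val)ᵀ * ((h.val)ᵀ * s * h.val) * ((h⁻¹).val * ι t * h.val) =
      (h.val)ᵀ * ((ι t)ᵀ * ((((h⁻¹).val)ᵀ * (h.val)ᵀ) * s * (h.val * (h⁻¹).val)) * ι t) *
        h.val := by
    simp only [Matrix.transpose_mul, Matrix.mul_assoc]
  rw [det_conjEmb, conjForm, conjEmb_apply, Matrix.mul_smul, Matrix.smul_mul, h5, h3, h4,
    Matrix.one_mul, Matrix.mul_one, hT, Matrix.mul_smul, Matrix.smul_mul, smul_comm]

/-- By Cayley–Hamilton the conjugate `tr x - x`, which lies in `K`, is an inverse of `x` up to the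
determinant. -/
theorem isUnit_of_det_ne_zero (hι : Function.Injective ι) {x : K} (hx : (ι x).det ≠ 0) :
    IsUnit x := by
  have h : x * (algebraMap k K (ι x).trace - x) = algebraMap k K (ι x).det := by
    apply hι
    rw [map_mul, map_sub, AlgHom.commutes, AlgHom.commutes, Algebra.algebraMap_eq_smul_one,
      Algebra.algebraMap_eq_smul_one, cayleyHamilton_two]
  refine isUnit_of_mul_isUnit_left (y := algebraMap k K (ι x).trace - x) ?_
  rw [h]
  exact (IsUnit.mk0 _ hx).map _

/-- Serves to pass from units to all of `K`. The determinant of `ι x + c` is a monic quadratic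
polynomial in `c`; its second difference at `-1, 0, 1` is `2`, so it cannot vanish at all three
points. -/
theorem exists_isUnit_add (h2 : (2 : k) ≠ 0) (hι : Function.Injective ι) (x : K) :
    ∃ c : k, IsUnit (x + algebraMap k K c) := by
  by_contra! hcon
  have h : ∀ c : k, (ι x 0 0 + c) * (ι x 1 1 + c) - ι x 0 1 * ι x 1 0 = 0 := fun c => by
    by_contra h
    refine hcon c (isUnit_of_det_ne_zero hι ?_)
    rw [map_add, AlgHom.commutes, Algebra.algebraMap_eq_smul_one, Matrix.det_fin_two]
    simpa using h
  have h0 := h 0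
  have h1 := h 1
  have h3 := h (-1)
  exact h2 (by linear_combination h1 + h3 - 2 * h0)

/-- An embedding in the similitudes of the hyperbolic plane is diagonal. -/
theorem exists_diagonal_of_antidiag (h2 : (2 : k) ≠ 0) (hι : Function.Injective ι) {c : k}
    (hc : c ≠ 0) (hT : ∀ t : Kˣ, (ι t)ᵀ * antidiag c * ι t = (ι t).det • antidiag c) :
    ∃ δ : Fin 2 → K →ₐ[k] k, ∀ x, ι x = diagonal fun i => δ i x := by
  have hunit : ∀ t : Kˣ, ι t 0 1 = 0 ∧ ι t 1 0 = 0 := fun t =>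
    isDiag_of_antidiag h2 hc (hT t)
      ((t.isUnit.map (ι : K →* Matrix (Fin 2) (Fin 2) k)).map
        (detMonoidHom : Matrix (Fin 2) (Fin 2) k →* k)).ne_zero
  -- Adding a scalar to `x` makes it a unit and does not change the off-diagonal entries.
  have hdiag : ∀ x, ι x 0 1 = 0 ∧ ι x 1 0 = 0 := fun x => by
    obtain ⟨a, t, ht⟩ := exists_isUnit_add h2 hι x
    have h := hunit t
    rw [ht, map_add, AlgHom.commutes, Algebra.algebraMap_eq_smul_one] at h
    simpa using h
  have hx : ∀ x, ι x = diagonal fun i => ι x i i := fun x => by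
    ext i j
    fin_cases i <;> fin_cases j <;> simp [hdiag x]
  refine ⟨fun i => ⟨⟨⟨⟨fun x => ι x i i, ?_⟩, ?_⟩, ?_, ?_⟩, ?_⟩, hx⟩
  · simp
  · intro x y
    change ι (x * y) i i = ι x i i * ι y i i
    rw [map_mul]
    conv_lhs => rw [hx x, hx y, Matrix.diagonal_mul_diagonal, Matrix.diagonal_apply_eq]
  · simp
  · intro x y
    simp
  · intro a
    change ι (algebraMap k K a) i i = a
    rw [AlgHom.commutes, Algebra.algebraMap_eq_smul_one]
    simp

theorem bijective_of_diagonal (hK : Module.finrank k K = 2) (hι : Function.Injective ι)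
    {δ : Fin 2 → K →ₐ[k] k} (hδ : ∀ x, ι x = diagonal fun i => δ i x) :
    Function.Bijective fun (x : K) (i : Fin 2) => δ i x := by
  have : Module.Finite k K := Module.finite_of_finrank_eq_succ hK
  let Δ : K →ₗ[k] Fin 2 → k := LinearMap.pi fun i => (δ i).toLinearMap
  have hinj : Function.Injective Δ := fun x y hxy => by
    apply hι
    rw [hδ, hδ]
    congr 1
  exact ⟨hinj, (LinearMap.injective_iff_surjective_of_finrank_eq_finrank (by simp [hK])).mp hinj⟩

/-- The algebra `K` is split if the form of the character is isotropic. -/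
theorem nonempty_algEquiv_of_isotropic (h2 : (2 : k) ≠ 0) (hK : Module.finrank k K = 2)
    (hι : Function.Injective ι) {s : Matrix (Fin 2) (Fin 2) k} (hs : s.IsSymm) (hs0 : s.det ≠ 0)
    (hT : ∀ t : Kˣ, (ι t)ᵀ * s * ι t = (ι t).det • s)
    {u : Fin 2 → k} (hu : u ≠ 0) (huu : u ⬝ᵥ s *ᵥ u = 0) : Nonempty (K ≃ₐ[k] k × k) := by
  obtain ⟨h, c, hc, hsc⟩ := exists_conjForm_eq_antidiag h2 hs hs0 hu huu
  obtain ⟨δ, hδ⟩ := exists_diagonal_of_antidiag h2 (conjEmb_injective hι h) hc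
    (hsc ▸ conjEmb_conjForm hT h)
  have hbij := bijective_of_diagonal hK (conjEmb_injective hι h) hδ
  refine ⟨AlgEquiv.ofBijective ((δ 0).prod (δ 1)) ⟨fun x y hxy => hbij.1 ?_, fun p => ?_⟩⟩
  · have hxy' := Prod.ext_iff.mp hxy
    ext i
    fin_cases i
    exacts [hxy'.1, hxy'.2]
  · obtain ⟨x, hx⟩ := hbij.2 ![p.1, p.2]
    exact ⟨x, Prod.ext (congrFun hx 0) (congrFun hx 1)⟩

/-- The form of the character is isotropic if the algebra `K` is split. -/
theorem exists_isotropic_of_algEquiv (h2 : (2 : k) ≠ 0) (hι : Function.Injective ι)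
    {s : Matrix (Fin 2) (Fin 2) k} (hT : ∀ t : Kˣ, (ι t)ᵀ * s * ι t = (ι t).det • s)
    (φ : K ≃ₐ[k] k × k) : ∃ u : Fin 2 → k, u ≠ 0 ∧ u ⬝ᵥ s *ᵥ u = 0 := by
  set e : K := φ.symm (1, 0) with he
  have hee : e * e = e := by rw [he, ← map_mul]; simp
  have he' : ∀ c : k, ι e ≠ c • 1 := fun c hc => by
    have h1 : e = algebraMap k K c := by
      apply hι
      rw [hc, AlgHom.commutes, Algebra.algebraMap_eq_smul_one]
    have h3 : φ (algebraMap k K c) = (1, 0) := by rw [← h1, he, AlgEquiv.apply_symm_apply]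
    rw [AlgEquiv.commutes, Prod.algebraMap_apply, Prod.mk.injEq] at h3
    simp at h3
    rw [h3.2] at h3
    exact zero_ne_one h3.1
  have hE : ι e * ι e = ι e := by rw [← map_mul, hee]
  have hCH := cayleyHamilton_two (ι e)
  rw [Matrix.mul_sub, hE, Matrix.mul_smul, Matrix.mul_one] at hCH
  -- For an idempotent, Cayley–Hamilton reads `(tr - 1) e = det`, so a trace different from `1`
  -- would make `ι e` scalar.
  have htr : (ι e).trace = 1 := by
    by_contra htr
    refine he' (((ι e).trace - 1)⁻¹ * (ι e).det) ?_
    have h1 : (ι e).trace • ι e - ι e = ((ι e).trace - 1) • ι e := by rw [sub_smul, one_smul]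
    rw [mul_smul, ← hCH, h1, smul_smul, inv_mul_cancel₀ (sub_ne_zero.mpr htr), one_smul]
  have hdet : (ι e).det = 0 := by
    rw [htr, one_smul, sub_self] at hCH
    simpa using congrFun (congrFun hCH.symm 0) 0
  -- The involution `2 e - 1` has determinant `-1`, so it changes the sign of the form; but it fixes
  -- the image of `e`, which is therefore isotropic.
  have hunit : (2 * e - 1) * (2 * e - 1) = 1 := by linear_combination 4 * hee
  set t : Kˣ := ⟨2 * e - 1, 2 * e - 1, hunit, hunit⟩
  have ht : ι t = (2 : k) • ι e - 1 := by
    change ι (2 * e - 1) = _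
    rw [map_sub, map_one, two_mul, map_add, two_smul]
  have htdet : (ι t).det = -1 := by
    rw [Matrix.det_fin_two] at hdet
    rw [Matrix.trace_fin_two] at htr
    rw [ht, Matrix.det_fin_two]
    simp
    linear_combination 4 * hdet - 2 * htr
  obtain ⟨i, hi⟩ : ∃ i, ι e *ᵥ Pi.single i 1 ≠ 0 := by
    by_contra! hcon
    refine he' 0 ?_
    ext l m
    simpa using congrFun (hcon m) l
  refine ⟨ι e *ᵥ Pi.single i 1, hi, ?_⟩
  set u := ι e *ᵥ Pi.single i 1
  have htu : ι t *ᵥ u = u := by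
    rw [ht, Matrix.sub_mulVec, Matrix.smul_mulVec, Matrix.mulVec_mulVec, hE, Matrix.one_mulVec,
      two_smul, add_sub_cancel_right]
  have h1 : u ⬝ᵥ s *ᵥ u = u ⬝ᵥ ((ι t)ᵀ * s * ι t) *ᵥ u := by
    rw [← Matrix.mulVec_mulVec, htu, ← Matrix.mulVec_mulVec, Matrix.dotProduct_mulVec _ (ι t)ᵀ,
      Matrix.vecMul_transpose, htu]
  rw [hT, htdet, Matrix.smul_mulVec, dotProduct_smul, smul_eq_mul] at h1
  have h3 : 2 * (u ⬝ᵥ s *ᵥ u) = 0 := by linear_combination h1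
  exact (mul_eq_zero.mp h3).resolve_left h2

end QuadraticAlgebra

/-! ### Transport of Bessel functionals along a change of basis. -/

section BaseChange
variable {k : Type*} [Field k] {K : Type*} [CommRing K] [Algebra k K]
  (ι : K →ₐ[k] Matrix (Fin 2) (Fin 2) k)

theorem coe_siegelGL (g : GL (Fin 2) k) :
    (siegelGL g).val.val = fromBlocks g.val 0 0 (g.val.det • ((g⁻¹).val)ᵀ) := rfl

theorem siegelGL_mul (g h : GL (Fin 2) k) : siegelGL (g * h) = siegelGL g * siegelGL h := by
  apply GSp4_ext
  rw [coe_mul, coe_siegelGL, coe_siegelGL, coe_siegelGL, fromBlocks_multiply, _root_.mul_inv_rev,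
    Units.val_mul, Units.val_mul, Matrix.det_mul, Matrix.transpose_mul]
  simp [smul_smul, mul_comm]

theorem siegelGL_one : siegelGL (1 : GL (Fin 2) k) = 1 := by
  apply GSp4_ext
  rw [coe_one, coe_siegelGL]
  simp

theorem siegelGL_inv (g : GL (Fin 2) k) : siegelGL g⁻¹ = (siegelGL g)⁻¹ := by
  rw [eq_inv_iff_mul_eq_one, ← siegelGL_mul, inv_mul_cancel, siegelGL_one]

theorem torus_conjEmb (h : GL (Fin 2) k) (t : Kˣ) :
    torus (conjEmb h ι) t = (siegelGL h)⁻¹ * torus ι t * siegelGL h := by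
  rw [← siegelGL_inv, torus, torus, ← siegelGL_mul, ← siegelGL_mul]
  exact congrArg siegelGL (Units.ext rfl)

/-- The action of a change of basis on symmetric matrices. -/
def conjSymm (h : GL (Fin 2) k) (n : Matrix (Fin 2) (Fin 2) k) : Matrix (Fin 2) (Fin 2) k :=
  (h.val.det)⁻¹ • (h.val * n * (h.val)ᵀ)

theorem conjSymm_isSymm (h : GL (Fin 2) k) {n : Matrix (Fin 2) (Fin 2) k} (hn : n.IsSymm) :
    (conjSymm h n).IsSymm := by
  rw [Matrix.IsSymm, conjSymm, Matrix.transpose_smul, Matrix.transpose_mul, Matrix.transpose_mul,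
    Matrix.transpose_transpose, hn.eq, Matrix.mul_assoc]

theorem siegelGL_mul_siegelN (h : GL (Fin 2) k) {n : Matrix (Fin 2) (Fin 2) k} (hn : n.IsSymm) :
    siegelGL h * siegelN n hn = siegelN _ (conjSymm_isSymm h hn) * siegelGL h := by
  have h3 : (h.val)ᵀ * ((h⁻¹).val)ᵀ = 1 := by
    rw [← Matrix.transpose_mul, Units.inv_mul, Matrix.transpose_one]
  apply GSp4_ext
  rw [coe_mul, coe_mul, coe_siegelGL]
  simp only [siegelN, fromBlocks_multiply, conjSymm]
  congr 1
  · simp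
  · rw [Matrix.smul_mul, Matrix.mul_smul, smul_smul, inv_mul_cancel₀ (det_ne_zero h), one_smul,
      Matrix.mul_assoc, h3]
    simp
  · simp
  · simp

theorem trace_mul_conjSymm (h : GL (Fin 2) k) (s n : Matrix (Fin 2) (Fin 2) k) :
    (s * conjSymm h n).trace = (conjForm h s * n).trace := by
  rw [conjSymm, conjForm, Matrix.mul_smul, Matrix.smul_mul, Matrix.trace_smul, Matrix.trace_smul,
    ← Matrix.mul_assoc, Matrix.trace_mul_comm]
  simp only [Matrix.mul_assoc]

variable {V : Type*} [AddCommGroup V] [Module ℂ V] (π : Representation ℂ (GSp4 k) V)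
  {ψ : AddChar k ℂ} {s : Matrix (Fin 2) (Fin 2) k} {χ : Kˣ →* ℂˣ} {ι}

/-- `siegelGL h` normalizes `N`, and `conjForm` is the action on forms dual, under the trace
pairing, to its action on symmetric matrices. -/
theorem comp_mem_besselFunctionals (h : GL (Fin 2) k) {ℓ : Module.Dual ℂ V}
    (hℓ : ℓ ∈ besselFunctionals π ψ s ι χ) :
    ℓ ∘ₗ π (siegelGL h) ∈ besselFunctionals π ψ (conjForm h s) (conjEmb h ι) χ := by
  refine ⟨fun t v => ?_, fun n hn v => ?_⟩
  · rw [LinearMap.comp_apply, LinearMap.comp_apply, ← Module.End.mul_apply, ← map_mul,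
      torus_conjEmb, ← mul_assoc, mul_inv_cancel_left, map_mul, Module.End.mul_apply, hℓ.1]
  · rw [LinearMap.comp_apply, LinearMap.comp_apply, ← Module.End.mul_apply, ← map_mul,
      siegelGL_mul_siegelN, map_mul, Module.End.mul_apply, hℓ.2, trace_mul_conjSymm]

theorem comp_inv_comp (h : GL (Fin 2) k) (ℓ : Module.Dual ℂ V) :
    (ℓ ∘ₗ π (siegelGL h)) ∘ₗ π (siegelGL h⁻¹) = ℓ := by
  rw [LinearMap.comp_assoc, ← Module.End.mul_eq_comp, ← map_mul, siegelGL_inv, mul_inv_cancel,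
    map_one]
  rfl

/-- Spaces of Bessel functionals for conjugate data are isomorphic. -/
def besselFunctionalsConj (h : GL (Fin 2) k) : besselFunctionals π ψ s ι χ ≃ₗ[ℂ]
    besselFunctionals π ψ (conjForm h s) (conjEmb h ι) χ where
  toFun ℓ := ⟨ℓ.val ∘ₗ π (siegelGL h), comp_mem_besselFunctionals π h ℓ.property⟩
  invFun ℓ := ⟨ℓ.val ∘ₗ π (siegelGL h⁻¹), by
    have := comp_mem_besselFunctionals π h⁻¹ ℓ.property
    rwa [conjForm_inv_conjForm, conjEmb_inv_conjEmb] at this⟩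
  map_add' ℓ ℓ' := Subtype.ext (LinearMap.add_comp _ _ _)
  map_smul' c ℓ := Subtype.ext (LinearMap.smul_comp _ _ _)
  left_inv ℓ := Subtype.ext (comp_inv_comp π h ℓ.val)
  right_inv ℓ := Subtype.ext (by
    have := comp_inv_comp π h⁻¹ ℓ.val
    rwa [inv_inv] at this)

theorem torus_eq_splitTorus {δ : Fin 2 → K →ₐ[k] k}
    (hδ : ∀ x, ι x = diagonal fun i => δ i x) (t : Kˣ) :
    torus ι t = splitTorus fun i => Units.map (δ i : K →* k) t := by
  apply GSp4_ext
  have h1 : ((Units.map (ι : K →* Matrix (Fin 2) (Fin 2) k) t)⁻¹).val =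
      diagonal fun i => δ i (t⁻¹ : Kˣ) := hδ _
  have h3 : (Units.map (ι : K →* Matrix (Fin 2) (Fin 2) k) t).val =
      diagonal fun i => δ i t := hδ _
  rw [torus, coe_siegelGL, h1, h3, splitTorus, coe_ofMatrix, Matrix.det_diagonal,
    Matrix.diagonal_transpose, Fin.prod_univ_two]
  congr 1
  ext i j
  rw [Matrix.smul_apply, Matrix.diagonal_apply, Matrix.diagonal_apply]
  split_ifs
  · simp [← map_inv]
  · simp

end BaseChange

/-! ### Restrictions of `ρ` to the torus. -/

section Restriction
variable {k : Type*} [Field k] [ValuativeRel k] [TopologicalSpace k]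
  [IsNonarchimedeanLocalField k] {ρ : klingen k →ₜ* ℂˣ} {K : Type*} [CommRing K] [Algebra k K]
  {ι : K →ₐ[k] Matrix (Fin 2) (Fin 2) k} {χ : Kˣ →* ℂˣ}

theorem IsRestriction.conj (h : GL (Fin 2) k) (H : IsRestriction ρ ι χ) :
    IsRestriction ρ (conjEmb h ι) χ := by
  obtain ⟨x, hx, hχ⟩ := H
  have key : ∀ t, (x * siegelGL h) * torus (conjEmb h ι) t * (x * siegelGL h)⁻¹ =
      x * torus ι t * x⁻¹ := fun t => by
    rw [torus_conjEmb]
    group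
  refine ⟨x * siegelGL h, fun t => (key t).symm ▸ hx t, fun t => ?_⟩
  rw [hχ]
  congr 2
  exact (key t).symm

theorem isRestriction_conj_iff (h : GL (Fin 2) k) :
    IsRestriction ρ (conjEmb h ι) χ ↔ IsRestriction ρ ι χ := by
  refine ⟨fun H => ?_, fun H => H.conj h⟩
  have := H.conj h⁻¹
  rwa [conjEmb_inv_conjEmb] at this

theorem weylSwap_mul_splitTorus (d : Fin 2 → kˣ) :
    weylSwap * splitTorus d = splitTorus (d ∘ Fin.rev) * weylSwap := by
  apply GSp4_ext
  simp only [coe_mul, splitTorus, weylSwap, coe_ofMatrix, fromBlocks_multiply]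
  congr 1 <;> ext i j <;> fin_cases i <;> fin_cases j <;>
    simp [Matrix.mul_apply, Fin.sum_univ_two, mul_comm, Matrix.vecMul, dotProduct,
      Matrix.diagonal_apply]

theorem splitTorus_mem_klingenLevi (d : Fin 2 → kˣ) : splitTorus d ∈ klingenLevi k := by
  refine ⟨⟨d 0, ?_⟩, ⟨d 1, ?_⟩⟩
  · ext l
    rcases l with l | l <;> fin_cases l <;>
      simp [splitTorus, coe_ofMatrix]
  · ext l
    rcases l with l | l <;> fin_cases l <;>
      simp [splitTorus, coe_ofMatrix] <;> field_simp

theorem eigenHom_splitTorus (d : Fin 2 → kˣ) :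
    eigenHom ⟨splitTorus d, klingenLevi_le (splitTorus_mem_klingenLevi d)⟩ = d 0 := by
  apply eigenHom_eq
  ext l
  rcases l with l | l <;> fin_cases l <;>
    simp [splitTorus, coe_ofMatrix, e₁]

/-- If `x` conjugates the torus into `M'`, then `x⁻¹ e₁` is an eigenvector of the torus. Any nonzero
coordinate of it shows that the eigenvalue is one of the two coordinate characters, the same for all
`t`; this and the similitude determine `ρ`. Conversely, the identity and `weylSwap` realize both
characters. -/
theorem isRestriction_split_iff (h2 : (2 : k) ≠ 0) {d : Kˣ →* (Fin 2 → kˣ)}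
    (hd : ∀ t, torus ι t = splitTorus (d t)) :
    IsRestriction ρ ι χ ↔ ∃ i, splitChar ρ d i = χ := by
  have hρ : ∀ q : klingen k, ρ q = ρ (diagHom (eigenHom q, similitudeHom q.val)) :=
    fun q => character_eq (ρ : klingen k →* ℂˣ) h2 q
  constructor
  · rintro ⟨x, hx, hχ⟩
    have hv : (x⁻¹).val.val *ᵥ e₁ ≠ 0 := mulVec_ne_zero _ e₁_ne_zero
    set v := (x⁻¹).val.val *ᵥ e₁ with hvdef
    obtain ⟨l, hl⟩ := Function.ne_iff.mp hv
    have heig : ∀ t, (splitTorus (d t)).val.val *ᵥ v =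
        (eigenHom ⟨x * torus ι t * x⁻¹, klingenLevi_le (hx t)⟩ : k) • v := fun t => by
      have h := eigen_spec ⟨x * torus ι t * x⁻¹, klingenLevi_le (hx t)⟩
      rw [← coe_eigenHom, mul_mulVec, mul_mulVec, ← hvdef] at h
      have h' := congrArg ((x⁻¹).val.val *ᵥ ·) h
      simp only [inv_mulVec_mulVec, Matrix.mulVec_smul] at h'
      rw [← hd]
      exact h'
    obtain ⟨i, hi⟩ : ∃ i : Fin 2, ∀ t, eigenHom
        ⟨x * torus ι t * x⁻¹, klingenLevi_le (hx t)⟩ = d t i.rev := by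
      rw [← Sum.elim_comp_inl_inr v] at heig
      rcases l with l | l
      · refine ⟨l.rev, fun t => Units.ext ?_⟩
        have h := congrFun (heig t) (Sum.inl l)
        rw [splitTorus_mulVec, Sum.elim_inl, Pi.smul_apply, Sum.elim_inl, smul_eq_mul] at h
        rw [Fin.rev_rev]
        exact (mul_right_cancel₀ hl h).symm
      · refine ⟨l, fun t => Units.ext ?_⟩
        have h := congrFun (heig t) (Sum.inr l)
        rw [splitTorus_mulVec, Sum.elim_inr, Pi.smul_apply, Sum.elim_inr, smul_eq_mul] at h
        have h1 : d t 0 * d t 1 * (d t l)⁻¹ = d t l.rev := by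
          fin_cases l
          · exact mul_inv_cancel_comm _ _
          · exact mul_inv_cancel_right _ _
        rw [h1] at h
        exact (mul_right_cancel₀ hl h).symm
    refine ⟨i, MonoidHom.ext fun t => ?_⟩
    rw [hχ, hρ, hi]
    have h1 : similitudeHom (x * torus ι t * x⁻¹) = d t 0 * d t 1 := by
      rw [map_mul, map_mul, map_inv, mul_inv_cancel_comm, hd, similitudeHom_splitTorus]
    rw [h1]
    rfl
  · rintro ⟨i, rfl⟩
    obtain ⟨x, hx⟩ : ∃ x : GSp4 k, ∀ t, ∃ d' : Fin 2 → kˣ, d' 0 = d t i.rev ∧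
        d' 0 * d' 1 = d t 0 * d t 1 ∧ x * torus ι t * x⁻¹ = splitTorus d' := by
      fin_cases i
      · refine ⟨weylSwap, fun t => ⟨d t ∘ Fin.rev, rfl, mul_comm _ _, ?_⟩⟩
        rw [hd, weylSwap_mul_splitTorus, mul_inv_cancel_right]
      · refine ⟨1, fun t => ⟨d t, rfl, rfl, ?_⟩⟩
        rw [hd, one_mul, inv_one, mul_one]
    refine ⟨x, fun t => ?_, fun t => ?_⟩
    · obtain ⟨d', -, -, h⟩ := hx t
      exact h.symm ▸ splitTorus_mem_klingenLevi d'
    · obtain ⟨d', h0, h1, h⟩ := hx t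
      have h3 : ∀ hmem : x * torus ι t * x⁻¹ ∈ klingen k,
          (⟨x * torus ι t * x⁻¹, hmem⟩ : klingen k) =
            ⟨splitTorus d', klingenLevi_le (splitTorus_mem_klingenLevi d')⟩ :=
        fun _ => Subtype.ext h
      rw [h3, hρ, eigenHom_splitTorus, similitudeHom_splitTorus, h1, h0]
      rfl

/-- The quotient of the two characters is `ρ` at the torus element of similitude `1` with eigenvalue
`d t 1 / d t 0`. As `d` is surjective, every eigenvalue occurs. -/
theorem splitChar_eq_iff (h2 : (2 : k) ≠ 0) {d : Kˣ →* (Fin 2 → kˣ)}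
    (hd : Function.Surjective d) : splitChar ρ d 0 = splitChar ρ d 1 ↔
      ∀ q : klingen k, similitude q.val = 1 → ρ q = 1 := by
  have hρ : ∀ q : klingen k, ρ q = ρ (diagHom (eigenHom q, similitudeHom q.val)) :=
    fun q => character_eq (ρ : klingen k →* ℂˣ) h2 q
  have hmul : ∀ t, splitChar ρ d 0 t =
      ρ (diagHom (d t 1 * (d t 0)⁻¹, 1)) * splitChar ρ d 1 t := fun t => by
    change ρ (diagHom (d t 1, d t 0 * d t 1)) = _ * ρ (diagHom (d t 0, d t 0 * d t 1))
    rw [← map_mul, ← map_mul, Prod.mk_mul_mk, inv_mul_cancel_right, one_mul]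
  constructor
  · intro h q hq
    obtain ⟨t, ht⟩ := hd ![1, eigenHom q]
    have h1 := hmul t
    rw [h, ht] at h1
    have hq' : similitudeHom q.val = 1 := Units.ext hq
    rw [hρ, hq']
    simpa using h1
  · intro h
    ext1 t
    rw [hmul, h, one_mul]
    rw [← coe_similitudeHom]
    exact congrArg Units.val (similitudeHom_diagElt _ _)

end Restriction

/-! ### The nonsplit and split cases. -/

section Main
variable {k : Type*} [Field k] [ValuativeRel k] [TopologicalSpace k]
  [IsNonarchimedeanLocalField k] (h2 : (2 : k) ≠ 0)
  {ψ : AddChar k ℂ} {s : Matrix (Fin 2) (Fin 2) k} (hs : s.IsSymm) (hs0 : s.det ≠ 0)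
  {K : Type*} [CommRing K] [Algebra k K] (hK : Module.finrank k K = 2)
  {ι : K →ₐ[k] Matrix (Fin 2) (Fin 2) k} (hι : Function.Injective ι)
  (hT : ∀ t : Kˣ, (ι t)ᵀ * s * ι t = (ι t).det • s) {ρ : klingen k →ₜ* ℂˣ}

include h2 hs hs0 hK hι hT in
theorem besselFunctionals_eq_bot_of_nonsplit (hψ1 : ψ ≠ 1) (hns : ¬ Nonempty (K ≃ₐ[k] k × k))
    (χ : Kˣ →* ℂˣ) : besselFunctionals (inducedRep ρ) ψ s ι χ = ⊥ := by
  rw [Submodule.eq_bot_iff]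
  rintro ℓ ⟨-, hℓ⟩
  refine LinearMap.ext fun f => functional_eq_zero_of_zeroFibers h2 hψ1 hs ?_ ℓ hℓ f ?_
  · rintro rfl
    simp at hs0
  · intro w hw hw0
    refine absurd (nonempty_algEquiv_of_isotropic h2 hK hι hs hs0 hT ?_ hw0) hns
    intro h
    apply hw
    ext i
    have h0 := congrFun h 0
    have h1 := congrFun h 1
    simp [perp] at h0 h1
    fin_cases i <;> simp [h0, h1]

/-- The homomorphism from `K*` to the diagonal torus attached to a diagonal embedding. -/
def diagUnits (δ : Fin 2 → K →ₐ[k] k) : Kˣ →* (Fin 2 → kˣ) :=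
  MonoidHom.pi fun i => Units.map (δ i : K →* k)

theorem surjective_diagUnits {δ : Fin 2 → K →ₐ[k] k}
    (hδ : Function.Bijective fun (x : K) (i : Fin 2) => δ i x) :
    Function.Surjective (diagUnits δ) := by
  intro a
  obtain ⟨x, hx⟩ := hδ.2 fun i => (a i : k)
  -- The preimage of the inverse coordinates is the inverse of `x`, since `K` is isomorphic to `k²`
  -- as a ring.
  obtain ⟨y, hy⟩ := hδ.2 fun i => ((a i)⁻¹ : kˣ)
  have hxy : x * y = 1 := by
    apply hδ.1
    ext i
    have h1 := congrFun hx i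
    have h3 := congrFun hy i
    simp only at h1 h3
    simp only [map_mul, h1, h3, map_one, Units.mul_inv]
  refine ⟨⟨x, y, hxy, (mul_comm y x).trans hxy⟩, ?_⟩
  ext i
  exact congrFun hx i

theorem continuous_splitChar [TopologicalSpace K] [IsModuleTopology k K]
    (δ : Fin 2 → K →ₐ[k] k) (i : Fin 2) : Continuous (splitChar ρ (diagUnits δ) i) := by
  have hc : ∀ l, Continuous fun t : Kˣ => diagUnits δ t l := fun l =>
    Continuous.units_map (δ l : K →* k)
      (IsModuleTopology.continuous_of_linearMap (δ l).toLinearMap)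
  exact (ρ.continuous_toFun.comp continuous_diagHom).comp
    ((hc i.rev).prodMk ((hc 0).mul (hc 1)))

include h2 hs hs0 hK hι hT in
/-- In the split case, the Bessel functionals and the restrictions are described by two
continuous characters. -/
theorem exists_splitChar [TopologicalSpace K] [IsModuleTopology k K] (hψ : Continuous ψ)
    (hψ1 : ψ ≠ 1) (hsplit : Nonempty (K ≃ₐ[k] k × k)) (ρ : klingen k →ₜ* ℂˣ) :
    ∃ η : Fin 2 → Kˣ →ₜ* ℂˣ,
      ((η 0 : Kˣ →* ℂˣ) = η 1 ↔ ∀ q : klingen k, similitude q.val = 1 → ρ q = 1) ∧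
      ∀ χ : Kˣ →* ℂˣ, (IsRestriction ρ ι χ ↔ ∃ i, (η i : Kˣ →* ℂˣ) = χ) ∧
        Module.finrank ℂ (besselFunctionals (inducedRep ρ) ψ s ι χ) =
          Nat.card {i // (η i : Kˣ →* ℂˣ) = χ} ∧
        ((∀ i, (η i : Kˣ →* ℂˣ) ≠ χ) → besselFunctionals (inducedRep ρ) ψ s ι χ = ⊥) := by
  obtain ⟨φ⟩ := hsplit
  obtain ⟨u, hu, huu⟩ := exists_isotropic_of_algEquiv h2 hι hT φ
  obtain ⟨h, s₀, hs₀, hsc⟩ := exists_conjForm_eq_antidiag h2 hs hs0 hu huu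
  obtain ⟨δ, hδ⟩ := exists_diagonal_of_antidiag h2 (conjEmb_injective hι h) hs₀
    (hsc ▸ conjEmb_conjForm hT h)
  have hbij := bijective_of_diagonal hK (conjEmb_injective hι h) hδ
  have hd : ∀ t, torus (conjEmb h ι) t = splitTorus (diagUnits δ t) := torus_eq_splitTorus hδ
  obtain ⟨x, hx⟩ := AddChar.ne_one_iff.mp hψ1
  have hc : ψ (2 * s₀ * (x / (2 * s₀))) ≠ 1 := by
    rwa [mul_div_cancel₀ _ (mul_ne_zero h2 hs₀)]
  refine ⟨fun i => ⟨splitChar ρ (diagUnits δ) i, continuous_splitChar δ i⟩,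
    splitChar_eq_iff h2 (surjective_diagUnits hbij), fun χ => ⟨?_, ?_, fun hχ => ?_⟩⟩
  · rw [← isRestriction_conj_iff h]
    exact isRestriction_split_iff h2 hd
  · rw [(besselFunctionalsConj (inducedRep ρ) h).finrank_eq, hsc]
    exact finrank_besselFunctionals_split h2 hψ hc hd χ
  · have e := besselFunctionalsConj (inducedRep ρ) h (ψ := ψ) (s := s) (χ := χ) (ι := ι)
    rw [hsc, besselFunctionals_split_eq_bot h2 hψ hc hd hχ] at e
    rw [Submodule.eq_bot_iff]
    intro ℓ hℓ
    exact congrArg Subtype.val (e.injective (Subsingleton.elim (e ⟨ℓ, hℓ⟩) (e 0)))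

end Main

end

end GSp4Bessel

theorem proposition2p4 {k : Type*} [Field k] [ValuativeRel k] [TopologicalSpace k]
    [IsNonarchimedeanLocalField k] (h2 : (2 : k) ≠ 0)
    -- a nontrivial additive character of `k`
    (ψ₀₀ : AddChar k ℂ) (hψ : Continuous ψ₀₀) (hψ1 : ψ₀₀ ≠ 1)
    -- a nondegenerate character `n ↦ ψ₀₀ (tr (s n))` of `N`
    (s : Matrix (Fin 2) (Fin 2) k) (hs : s.IsSymm) (hs0 : s.det ≠ 0)
    -- a quadratic algebra `K` with `K* ⊆ GL₂(k)` centralizing this character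
    {K : Type*} [CommRing K] [Algebra k K] [TopologicalSpace K] [IsModuleTopology k K]
    (hK : Module.finrank k K = 2)
    (ι : K →ₐ[k] Matrix (Fin 2) (Fin 2) k) (hι : Function.Injective ι)
    (hT : ∀ t : Kˣ, (ι t)ᵀ * s * ι t = (ι t).det • s)
    -- a one-dimensional representation of the Klingen parabolic
    (ρ : GSp4Bessel.klingen k →ₜ* ℂˣ) :
    ((∃ χ : Kˣ →ₜ* ℂˣ,
        GSp4Bessel.besselFunctionals (GSp4Bessel.inducedRep ρ) ψ₀₀ s ι (χ : Kˣ →* ℂˣ) ≠ ⊥) ↔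
      Nonempty (K ≃ₐ[k] k × k)) ∧
    (Nonempty (K ≃ₐ[k] k × k) →
      (∃ χ : Kˣ →ₜ* ℂˣ, GSp4Bessel.IsRestriction ρ ι (χ : Kˣ →* ℂˣ)) ∧
      ∀ χ : Kˣ →ₜ* ℂˣ,
        (GSp4Bessel.IsRestriction ρ ι (χ : Kˣ →* ℂˣ) →
          ((∃ q : GSp4Bessel.klingen k, GSp4Bessel.similitude q.val = 1 ∧ ρ q ≠ 1) →
            Module.finrank ℂ (GSp4Bessel.besselFunctionals
              (GSp4Bessel.inducedRep ρ) ψ₀₀ s ι (χ : Kˣ →* ℂˣ)) = 1) ∧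
          ((∀ q : GSp4Bessel.klingen k, GSp4Bessel.similitude q.val = 1 → ρ q = 1) →
            Module.finrank ℂ (GSp4Bessel.besselFunctionals
              (GSp4Bessel.inducedRep ρ) ψ₀₀ s ι (χ : Kˣ →* ℂˣ)) = 2)) ∧
        (¬ GSp4Bessel.IsRestriction ρ ι (χ : Kˣ →* ℂˣ) →
          GSp4Bessel.besselFunctionals
            (GSp4Bessel.inducedRep ρ) ψ₀₀ s ι (χ : Kˣ →* ℂˣ) = ⊥)) := by
  refine ⟨⟨?_, fun hsplit => ?_⟩, fun hsplit => ?_⟩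
  · rintro ⟨χ, hχ⟩
    by_contra hns
    exact hχ (GSp4Bessel.besselFunctionals_eq_bot_of_nonsplit h2 hs hs0 hK hι hT hψ1 hns χ)
  · obtain ⟨η, -, hη⟩ := GSp4Bessel.exists_splitChar h2 hs hs0 hK hι hT hψ hψ1 hsplit ρ
    refine ⟨η 0, fun hbot => ?_⟩
    -- The dimension for `η 0` counts at least the index `0`, so the space cannot be zero.
    have h := (hη (η 0)).2.1
    rw [hbot, finrank_bot] at h
    have : Nonempty {i // (η i : Kˣ →* ℂˣ) = η 0} := ⟨⟨0, rfl⟩⟩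
    exact Nat.card_pos.ne h
  · obtain ⟨η, hη01, hη⟩ := GSp4Bessel.exists_splitChar h2 hs hs0 hK hι hT hψ hψ1 hsplit ρ
    refine ⟨⟨η 0, (hη _).1.mpr ⟨0, rfl⟩⟩, fun χ => ⟨fun hχ => ⟨?_, fun htriv => ?_⟩, fun hχ => ?_⟩⟩
    · rintro ⟨q, hq, hρq⟩
      obtain ⟨i, hi⟩ := (hη χ).1.mp hχ
      have hne : (η 0 : Kˣ →* ℂˣ) ≠ η 1 := fun h => hρq (hη01.mp h q hq)
      rw [(hη χ).2.1, Nat.card_eq_one_iff_exists]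
      refine ⟨⟨i, hi⟩, fun ⟨j, hj⟩ => Subtype.ext ?_⟩
      have hij := hj.trans hi.symm
      fin_cases i <;> fin_cases j
      exacts [rfl, absurd hij.symm hne, absurd hij hne, rfl]
    · obtain ⟨i, hi⟩ := (hη χ).1.mp hχ
      have h01 := hη01.mpr htriv
      have hall : ∀ j, (η j : Kˣ →* ℂˣ) = χ := fun j => by
        rw [← hi]
        fin_cases i <;> fin_cases j
        exacts [rfl, h01.symm, h01, rfl]
      rw [(hη χ).2.1, Nat.card_congr (Equiv.subtypeUnivEquiv hall), Nat.card_fin]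
    · exact (hη χ).2.2 fun i hi => hχ ((hη χ).1.mpr ⟨i, hi⟩)
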